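/- **Notation.** Let $r\ge 1$, $m\ge r-1$ be integers. For a finitely supported sequence $u$ of complex matrices indexed by $\mathbb Z$ put $\hat u(\xi)=\sum_k u(k)e^{-ik\xi}$; for a compactly supported distribution $\phi$ on $\mathbb R$ put $\hat\phi(\xi)=\langle \phi,e^{-i\,\cdot\,\xi}\rangle$. For smooth $f,g$, "$f(\xi)=g(\xi)+O(|\xi|^n)$ as $\xi\to0$" means $f^{(j)}(0)=g^{(j)}(0)$ for $0\le j<n$. Let $a:\mathbb Z\to\mathbb C^{r\times r}$ be finitely supported (the mask), $(S_a v)(j)=2\sum_{k} v(k)a(j-2k)$ for any sequence $v$ of matrices with $r$ columns, $(w*u)(j)=\sum_k w(j-k)u(k)$, and let $\delta I_r$ be the sequence equal to $I_r$ at $0$ and $0$ elsewhere. A finitely supported $v:\mathbb Z\to\mathbb C^{1\times r}$ is an *order $n$ matching filter* of $a$ if $\hat v(0)\neq0$ and $\hat v(2\xi)\hat a(\xi)=\hat v(\xi)+O(|\xi|^n)$; $a$ has *order $n$ sum rules* with the matching filter $v$ if moreover $\hat v(2\xi)\hat a(\xi+\pi)=O(|\xi|^n)$. Let $\mathrm{sr}(a)$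 be the largest $n\ge 0$ for which $a$ has order $n$ sum rules with some $v$. Set $$\rho_j(a,v)_\infty=\sup\Big\{\limsup_{n\to\infty}\|(S_a^n(\delta I_r))*u\|_{\ell_\infty}^{1/n}\;:\; u:\mathbb Z\to\mathbb C^{r\times1}\text{ finitely supported},\ \hat v(\xi)\hat u(\xi)=O(|\xi|^j)\Big\}$$ and $\mathrm{sm}_\infty(a)=-\log_2\rho_{\mathrm{sr}(a)}(a,v)_\infty$, where $a$ has order $\mathrm{sr}(a)$ sum rules with $v$ (the value does not depend on the choice of $v$). For a scalar distribution $f$, $\mathrm{sm}_\infty(f)$ is the supremum of all $k+\tau$, $k\in\mathbb Z_{\ge0}$, $0\le\tau<1$, such that $f$ is a function with $f,\dots,f^{(k-1)}$ absolutely continuous, $f,\dots,f^{(k)}\in L_\infty(\mathbb R)$, and $\|f^{(k)}-f^{(k)}(\cdot-t)\|_{L_\infty}\le C|t|^\tau$ for all $t\in\mathbb R$, for some constant $C$ ($-\infty$ if there are none); for a vector it is the minimum over the entries. The *Hermite subdivision scheme of order $r$ with mask $a$ is convergent with limiting functions in $C^m$* if for every $w_0:\mathbb Z\to\mathbb C^{1\times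 r}$ there is $\eta\in C^m(\mathbb R)$ such that for every $K>0$ and $\ell=1,\dots,r$ $$\lim_{n\to\infty}\ \sup_{k\in\mathbb Z\cap[-2^nK,2^nK]}\big|(S_a^nw_0)(k)\,2^{(\ell-1)n}e_\ell-\eta^{(\ell-1)}(2^{-n}k)\big|=0 .$$ **Theorem.** Assume that $1$ is a simple eigenvalue of $\hat a(0)$ and that no $2^k$, $k\ge1$, is an eigenvalue of $\hat a(0)$. Let $\vartheta_a$ be an order $r$ matching filter of $a$ such that the first nonzero entry of $\hat\vartheta_a(0)$ is $1$. Let $\phi$ be an $r\times1$ vector of compactly supported distributions with $\hat\phi(2\xi)=\hat a(\xi)\hat\phi(\xi)$ for all $\xi\in\mathbb R$ and $\hat\vartheta_a(0)\hat\phi(0)=1$. 1. If the Hermite subdivision scheme of order $r$ with mask $a$ is convergent with limiting functions in $C^m$, then $\mathrm{sm}_\infty(a)>0$, $\mathrm{sm}_\infty(\phi)>m$, and $$\hat\vartheta_a(\xi)=\big[1+O(|\xi|),\ i\xi+O(|\xi|^2),\ \dots,\ (i\xi)^{r-1}+O(|\xi|^r)\big],\qquad \xi\to0. \tag{$*$}$$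 2. Conversely, if $\mathrm{sm}_\infty(a)>r-1$, $\mathrm{sm}_\infty(\phi)>m$ and $(*)$ holds, then the Hermite subdivision scheme of order $r$ with mask $a$ is convergent with limiting functions in $C^m$. -/

import Mathlib

open Filter Topology MeasureTheory Matrix
open scoped ENNReal SchwartzMap

noncomputable section

namespace Subdivision

/-! ### Sequences, symbols, subdivision -/

/-- `l(ℤ)^{s × r}`: all sequences of complex `s × r` matrices. -/
abbrev MSeq (s r : ℕ) : Type := ℤ → Matrix (Fin s) (Fin r) ℂ

/-- `l₀(ℤ)^{s × r}`: the finitely supported sequences of complex `s × r` matrices. -/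
abbrev FSeq (s r : ℕ) : Type := ℤ →₀ Matrix (Fin s) (Fin r) ℂ

/-- The symbol `û(ξ) = ∑ₖ u(k) e^{-ikξ}` of a finitely supported sequence. -/
def symbol {s r : ℕ} (u : FSeq s r) (ξ : ℝ) : Matrix (Fin s) (Fin r) ℂ :=
  ∑ k ∈ u.support, Complex.exp (-(Complex.I * (k : ℂ) * (ξ : ℂ))) • u k

/-- The subdivision operator `(S_a v)(j) = 2 ∑ₖ v(k) a(j - 2k)`. For every `j` only finitely many
terms of the sum are nonzero. -/
def subdiv {s r : ℕ} (a : FSeq r r) (v : MSeq s r) : MSeq s r :=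
  fun j => (2 : ℂ) • ∑ᶠ k : ℤ, v k * a (j - 2 * k)

/-- The sequence `δ I_r`. -/
def diracId (r : ℕ) : MSeq r r := fun k => if k = 0 then 1 else 0

/-- The convolution `(w * u)(j) = ∑ₖ w(j - k) u(k)` with a finitely supported `u`. -/
def conv {s r t : ℕ} (w : MSeq s r) (u : FSeq r t) : MSeq s t :=
  fun j => ∑ k ∈ u.support, w (j - k) * u k

/-- The supremum norm of a sequence of matrices (largest modulus of an entry), as an extended
nonnegative real. -/
def supNorm {s r : ℕ} (w : MSeq s r) : ℝ≥0∞ :=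
  ⨆ k : ℤ, ⨆ i : Fin s, ⨆ j : Fin r, ‖w k i j‖ₑ

/-- `f(ξ) = g(ξ) + O(|ξ|^n)` as `ξ → 0`, for smooth `f`, `g`, understood as
`f^{(j)}(0) = g^{(j)}(0)` for `j = 0, …, n - 1`. -/
def EqUpTo (n : ℕ) (f g : ℝ → ℂ) : Prop :=
  ∀ j < n, iteratedDeriv j f 0 = iteratedDeriv j g 0

/-- `v` is an order `n` matching filter of the mask `a`:
`v̂(0) ≠ 0` and `v̂(2ξ) â(ξ) = v̂(ξ) + O(|ξ|^n)`. -/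
def IsMatchingFilter {r : ℕ} (a : FSeq r r) (v : FSeq 1 r) (n : ℕ) : Prop :=
  symbol v 0 ≠ 0 ∧
    ∀ l : Fin r, EqUpTo n (fun ξ => (symbol v (2 * ξ) * symbol a ξ) 0 l)
      (fun ξ => symbol v ξ 0 l)

/-- The mask `a` has order `n` sum rules with the matching filter `v`: moreover
`v̂(2ξ) â(ξ + π) = O(|ξ|^n)`. -/
def HasSumRules {r : ℕ} (a : FSeq r r) (v : FSeq 1 r) (n : ℕ) : Prop :=
  IsMatchingFilter a v n ∧
    ∀ l : Fin r, EqUpTo n (fun ξ => (symbol v (2 * ξ) * symbol a (ξ + Real.pi)) 0 l) (fun _ => 0)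

/-- `1` is a simple eigenvalue of `â(0)` and no `2^k` with `k ≥ 1` is an eigenvalue of `â(0)`. -/
def EigenvalueCondition {r : ℕ} (a : FSeq r r) : Prop :=
  (symbol a 0).charpoly.rootMultiplicity 1 = 1 ∧
    ∀ k : ℕ, 1 ≤ k → ¬ (symbol a 0).charpoly.IsRoot ((2 : ℂ) ^ k)

/-- The first nonzero entry of `v̂(0)` is `1`. -/
def IsNormalized {r : ℕ} (v : FSeq 1 r) : Prop :=
  ∃ l : Fin r, symbol v 0 0 l = 1 ∧ ∀ l' < l, symbol v 0 0 l' = 0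

/-- `v̂(ξ) = [1 + O(|ξ|), iξ + O(|ξ|²), …, (iξ)^{r-1} + O(|ξ|^r)]`; with entries numbered from
`0`, the entry `l` is `(iξ)^l + O(|ξ|^{l+1})`. -/
def IsHermiteFilter {r : ℕ} (v : FSeq 1 r) : Prop :=
  ∀ l : Fin r, EqUpTo ((l : ℕ) + 1) (fun ξ => symbol v ξ 0 l)
    (fun ξ => (Complex.I * (ξ : ℂ)) ^ (l : ℕ))

/-! ### The smoothness exponent of a mask -/

/-- The space `{u : v̂(ξ) û(ξ) = O(|ξ|^j)}` of finitely supported column sequences. -/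
def annihilated {r : ℕ} (v : FSeq 1 r) (j : ℕ) : Set (FSeq r 1) :=
  {u | EqUpTo j (fun ξ => (symbol v ξ * symbol u ξ) 0 0) (fun _ => 0)}

/-- `ρ_j(a, v)_∞`: the supremum of `limsup ‖(S_a^n (δ I_r)) * u‖_∞^{1/n}` over all `u` with
`v̂(ξ) û(ξ) = O(|ξ|^j)`. -/
def rho {r : ℕ} (a : FSeq r r) (v : FSeq 1 r) (j : ℕ) : ℝ≥0∞ :=
  ⨆ u ∈ annihilated v j,
    limsup (fun n : ℕ => supNorm (conv ((subdiv a)^[n] (diracId r)) u) ^ (1 / (n : ℝ))) atTop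

/-- `sr(a)`: the largest order of sum rules of `a`. -/
def sumRuleOrder {r : ℕ} (a : FSeq r r) : ℕ :=
  sSup {n : ℕ | ∃ v : FSeq 1 r, HasSumRules a v n}

/-- `sm_∞(a) = -log₂ ρ_{sr(a)}(a, v)_∞`, where `v` is a matching filter with which `a` has order
`sr(a)` sum rules. The value does not depend on the choice of `v`; the infimum over all such `v` is
taken here only to avoid choosing one. -/
def smMask {r : ℕ} (a : FSeq r r) : EReal :=
  ⨅ v : FSeq 1 r, ⨅ _ : HasSumRules a v (sumRuleOrder a),
    -(ENNReal.log (rho a v (sumRuleOrder a)) / ((Real.log 2 : ℝ) : EReal))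

/-! ### Compactly supported distributions -/

/-- The tempered distribution `T` is supported in `[-R, R]`. -/
def SupportedIn (T : 𝓢'(ℝ, ℂ)) (R : ℝ) : Prop :=
  Distribution.IsVanishingOn T (Set.Icc (-R) R)ᶜ

/-- `T` has compact support. -/
def IsCompactlySupported (T : 𝓢'(ℝ, ℂ)) : Prop := ∃ R : ℝ, SupportedIn T R

/-- The Schwartz function `g` coincides with `x ↦ e^{-ixξ}` in a neighbourhood of an interval which
contains the support of `T`. -/
def IsCutoffExp (T : 𝓢'(ℝ, ℂ)) (ξ : ℝ) (g : 𝓢(ℝ, ℂ)) : Prop :=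
  ∃ R : ℝ, SupportedIn T R ∧
    ∀ x ∈ Set.Icc (-(R + 1)) (R + 1), g x = Complex.exp (-(Complex.I * (x : ℂ) * (ξ : ℂ)))

open Classical in
/-- The Fourier transform `T̂(ξ) = ⟨T, e^{-i·ξ}⟩` of a compactly supported distribution `T`, where
`e^{-i·ξ}` is cut off away from the support of `T`. -/
def fourierFn (T : 𝓢'(ℝ, ℂ)) (ξ : ℝ) : ℂ :=
  if h : ∃ g : 𝓢(ℝ, ℂ), IsCutoffExp T ξ g then T h.choose else 0

theorem exists_isCutoffExp {T : 𝓢'(ℝ, ℂ)} (hT : IsCompactlySupported T) (ξ : ℝ) :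
    ∃ g : 𝓢(ℝ, ℂ), IsCutoffExp T ξ g := by
  obtain ⟨R, hR⟩ := hT
  let b : ContDiffBump (0 : ℝ) := ⟨|R| + 1, |R| + 2, by positivity, by linarith⟩
  let f : ℝ → ℂ := fun x => ((b x : ℝ) : ℂ) * Complex.exp (-(Complex.I * (x : ℂ) * (ξ : ℂ)))
  have hb : ContDiff ℝ (⊤ : ℕ∞) (fun x : ℝ => ((b x : ℝ) : ℂ)) :=
    Complex.ofRealCLM.contDiff.comp b.contDiff
  have hx : ContDiff ℝ (⊤ : ℕ∞) (fun x : ℝ => (x : ℂ)) := Complex.ofRealCLM.contDiff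
  have hf : ContDiff ℝ (⊤ : ℕ∞) f :=
    hb.mul (((contDiff_const.mul hx).mul contDiff_const).neg.cexp)
  have hc : HasCompactSupport f := by
    have h0 : HasCompactSupport (fun x : ℝ => ((b x : ℝ) : ℂ)) :=
      b.hasCompactSupport.comp_left (g := fun y : ℝ => (y : ℂ)) (by simp)
    exact h0.mul_right
  refine ⟨hc.toSchwartzMap hf, R, hR, fun x hx => ?_⟩
  have hxR : |x| ≤ |R| + 1 := by
    rw [abs_le]
    constructor <;> [linarith [hx.1, le_abs_self R]; linarith [hx.2, le_abs_self R]]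
  have h1 : b x = 1 := b.one_of_mem_closedBall (by simpa [Real.norm_eq_abs] using hxR)
  change f x = _
  simp [f, h1]

/-- The value of the Fourier transform does not depend on the cut-off. -/
theorem fourierFn_eq {T : 𝓢'(ℝ, ℂ)} {ξ : ℝ} {g : 𝓢(ℝ, ℂ)} (hg : IsCutoffExp T ξ g) :
    fourierFn T ξ = T g := by
  have key : ∀ (g₁ g₂ : 𝓢(ℝ, ℂ)) (R₁ R₂ : ℝ), R₁ ≤ R₂ → SupportedIn T R₁ →
      (∀ x ∈ Set.Icc (-(R₁ + 1)) (R₁ + 1),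
        g₁ x = Complex.exp (-(Complex.I * (x : ℂ) * (ξ : ℂ)))) →
      (∀ x ∈ Set.Icc (-(R₂ + 1)) (R₂ + 1),
        g₂ x = Complex.exp (-(Complex.I * (x : ℂ) * (ξ : ℂ)))) → T g₁ = T g₂ := by
    intro g₁ g₂ R₁ R₂ hR hs h₁ h₂
    have h0 : T (g₁ - g₂) = 0 := by
      apply hs
      intro x hx hxR
      have hnot : x ∉ tsupport (g₁ - g₂ : 𝓢(ℝ, ℂ)) := by
        rw [notMem_tsupport_iff_eventuallyEq]
        have hnb : Set.Icc (-(R₁ + 1)) (R₁ + 1) ∈ 𝓝 x :=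
          Icc_mem_nhds (by linarith [hxR.1]) (by linarith [hxR.2])
        filter_upwards [hnb] with y hy
        have h2 := h₂ y ⟨by linarith [hy.1], by linarith [hy.2]⟩
        simp [h₁ y hy, h2]
      exact hnot hx
    rw [map_sub] at h0
    exact sub_eq_zero.mp h0
  have h : ∃ g : 𝓢(ℝ, ℂ), IsCutoffExp T ξ g := ⟨g, hg⟩
  rw [fourierFn, dif_pos h]
  obtain ⟨R₁, hs₁, h₁⟩ := h.choose_spec
  obtain ⟨R₂, hs₂, h₂⟩ := hg
  rcases le_total R₁ R₂ with hR | hR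
  · exact key _ _ _ _ hR hs₁ h₁ h₂
  · exact (key _ _ _ _ hR hs₂ h₂ h₁).symm

/-- `φ̂(2ξ) = â(ξ) φ̂(ξ)` for all real `ξ`. -/
def IsRefinable {r : ℕ} (a : FSeq r r) (φ : Fin r → 𝓢'(ℝ, ℂ)) : Prop :=
  ∀ ξ : ℝ, (fun i => fourierFn (φ i) (2 * ξ)) = symbol a ξ *ᵥ (fun i => fourierFn (φ i) ξ)

/-! ### The smoothness exponent of a function -/

/-- The distribution `T` is given by the function `f`. -/
def IsGivenBy (T : 𝓢'(ℝ, ℂ)) (f : ℝ → ℂ) : Prop :=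
  ∀ g : 𝓢(ℝ, ℂ), T g = ∫ x, f x * g x

/-- The Sobolev space `W^k_∞(ℝ)`: `f, …, f^{(k-1)}` are absolutely continuous (on every compact
interval) and `f, …, f^{(k)}` belong to `L_∞(ℝ)`. -/
def MemSobolevInf (k : ℕ) (f : ℝ → ℂ) : Prop :=
  (∀ j < k, ∀ x y : ℝ, AbsolutelyContinuousOnInterval (iteratedDeriv j f) x y) ∧
    ∀ j ≤ k, MemLp (iteratedDeriv j f) ∞ volume

/-- `Lip(τ, L_∞)`: `‖f - f(· - t)‖_∞ ≤ C |t|^τ` for all real `t`. -/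
def MemLipInf (τ : ℝ) (f : ℝ → ℂ) : Prop :=
  ∃ C : ℝ, 0 < C ∧ ∀ t : ℝ,
    eLpNorm (fun x => f x - f (x - t)) ∞ volume ≤ ENNReal.ofReal (C * |t| ^ τ)

/-- `sm_∞(T)`: the supremum of all `k + τ`, `k` a nonnegative integer and `0 ≤ τ < 1`, such that
`T` is a function `f ∈ W^k_∞(ℝ)` with `f^{(k)} ∈ Lip(τ, L_∞)`; it is `-∞` if there are none. -/
def smDistribution (T : 𝓢'(ℝ, ℂ)) : EReal :=
  sSup {s : EReal | ∃ (k : ℕ) (τ : ℝ) (f : ℝ → ℂ), 0 ≤ τ ∧ τ < 1 ∧ IsGivenBy T f ∧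
    MemSobolevInf k f ∧ MemLipInf τ (iteratedDeriv k f) ∧ s = (((k : ℝ) + τ : ℝ) : EReal)}

/-- `sm_∞(φ)` of a vector: the smallest of the exponents of its entries. -/
def smVector {r : ℕ} (φ : Fin r → 𝓢'(ℝ, ℂ)) : EReal := ⨅ i, smDistribution (φ i)

/-! ### Convergence of Hermite subdivision schemes -/

/-- The Hermite subdivision scheme of order `r` with mask `a` is convergent with limiting functions
in `C^m(ℝ)`: for every input `w₀` there is a `C^m` function `η` such that for all `K > 0`, uniformly
in the integers `k ∈ [-2^n K, 2^n K]`, the difference of the `l`-th entry of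
`2^{ln} (S_a^n w₀)(k)` and `η^{(l)}(2^{-n} k)` tends to `0`, `l = 0, …, r - 1`. -/
def HermiteConvergent {r : ℕ} (a : FSeq r r) (m : ℕ) : Prop :=
  ∀ w₀ : MSeq 1 r, ∃ η : ℝ → ℂ, ContDiff ℝ m η ∧ ∀ K : ℝ, 0 < K → ∀ l : Fin r,
    Tendsto (fun n : ℕ => ⨆ k : ℤ, ⨆ _ : |(k : ℝ)| ≤ 2 ^ n * K,
      ‖((subdiv a)^[n] w₀) k 0 l * 2 ^ ((l : ℕ) * n)
        - iteratedDeriv (l : ℕ) η ((k : ℝ) / 2 ^ n)‖ₑ) atTop (𝓝 0)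

end Subdivision

end

noncomputable section

namespace Subdivision

/-! ### Pairings and dilated convolutions of finitely supported sequences -/

/-! Write A_n for S_a^n(δ I_r), which is `maskIter a n`. By linearity and locality every output of
the scheme is a superposition of shifted rows of A_n. Convergence therefore means that 2^{ln}
A_n(k)_{il} is uniformly close to g_i^{(l)}(2^{-n}k) for compactly supported g_i in C^m; this is
`IsMaskLimit`. Conditions of the form O(|ξ|^n) are read throughout as identities between moments of
finite sequences.

Necessity. Iterating the matching relation gives 2^N v̂(ξ) for v̂(2^N ξ) Â_N(ξ) to the prescribed
order. In the limit the j-th moment of entry l of v, multiplied by 2^{(l-j)N}, converges to a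
combination of integrals of g_i^{(l)} against polynomials. It must vanish for j < l, and for j = l
integration by parts evaluates it (`IsMaskLimit.moments`, `IsMaskLimit.mass`); with the
normalization this is (*). The same Riemann sums against exponentials identify φ with g
(`IsMaskLimit.isGivenBy`), since a compactly supported distribution is determined by its Fourier
transform. Both strict inequalities come from one principle, `exists_exponential_decay`: on a
finite-dimensional space, pointwise convergence to zero of a cocycle forces a geometric rate. The
cocycle is A_{n+p} = A_n combined with A_p, acting on sequences in a fixed window [-N, N]
(`win_add`, `exists_decay_on_window`). Applied to differences of samples of g^{(m)}, it gives Hölder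
continuity, hence sm_∞(φ) > m (`lt_smVector_of_refinable`). Applied to windows whose first component
has sum zero, it gives a rate q < 1 common to all admissible u, hence sm_∞(a) > 0
(`IsMaskLimit.smMask_pos`).

Sufficiency. Smoothness of φ yields C^m representatives g satisfying the refinement equation. Let U
be the sequence of integer samples of g. Then A_n * U samples g on the grid 2^{-n}ℤ, so 2^{ln} A_n *
∇^l U tends to (-1)^l g^{(l)}, and higher differences tend to zero at this scale. The hypothesis on
sm_∞(a) says that 2^{(r-1)n} A_n * u tends to zero whenever u is annihilated to order s = sr(a) by a
filter v' (`HasMaskDecay`). A triangular system of moments writes δ e_l as a combination of ∇^q U, l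
≤ q < s, plus an annihilated remainder (`exists_sub_mem_annihilated`). The coefficient of ∇^l U is
(-1)^l exactly because of (*), and so column l of A_n converges to the l-th derivatives
(`HasMaskDecay.isMaskLimit`). Condition (*) concerns the given filter while the decay concerns v'.
The two are compared in `HasMaskDecay.exists_moments_eq`: decay forces every left eigenvector of
â(0) for an eigenvalue 2^{-j}, j ≤ r - 1, to be a multiple of v̂'(0), so the moments up to order r -
1 agree up to one constant. -/

/-- The pairing `∑ₖ F(k) u(k)` of a finitely supported sequence with a scalar sequence. -/
def pairing {s t : ℕ} : FSeq s t →ₗ[ℂ] (ℤ → ℂ) →ₗ[ℂ] Matrix (Fin s) (Fin t) ℂ :=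
  LinearMap.mk₂ ℂ (fun u F => u.sum fun k M => F k • M)
    (fun u v F => Finsupp.sum_add_index' (by simp) (by simp))
    (fun c u F => by
      rw [Finsupp.sum_smul_index' (by simp), Finsupp.smul_sum]
      exact Finsupp.sum_congr fun k _ => smul_comm _ _ _)
    (fun u F G => by simp [add_smul, Finsupp.sum_add])
    (fun c u F => by simp [Finsupp.smul_sum, smul_smul])

theorem pairing_apply {s t : ℕ} (u : FSeq s t) (F : ℤ → ℂ) :
    pairing u F = u.sum fun k M => F k • M := rfl

@[simp] theorem pairing_single {s t : ℕ} (k : ℤ) (M : Matrix (Fin s) (Fin t) ℂ) (F : ℤ → ℂ) :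
    pairing (Finsupp.single k M) F = F k • M := by
  rw [pairing_apply, Finsupp.sum_single_index (by simp)]

theorem symbol_eq_pairing {s t : ℕ} (u : FSeq s t) (ξ : ℝ) :
    symbol u ξ = pairing u fun k => Complex.exp (-(Complex.I * (k : ℂ) * (ξ : ℂ))) := rfl

theorem symbol_zero_eq_pairing {s t : ℕ} (u : FSeq s t) : symbol u 0 = pairing u fun _ => 1 := by
  rw [symbol_eq_pairing]; simp

/-- The sequence with symbol `v̂(tξ) û(ξ)`. -/
def comb {s r q : ℕ} (t : ℤ) : FSeq s r →ₗ[ℂ] FSeq r q →ₗ[ℂ] FSeq s q :=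
  LinearMap.mk₂ ℂ (fun v u => v.sum fun k V => u.sum fun b U => Finsupp.single (t * k + b) (V * U))
    (fun v w u => Finsupp.sum_add_index' (by simp)
      (by intro k V W; simp [Matrix.add_mul, Finsupp.sum_add]))
    (fun c v u => by
      rw [Finsupp.sum_smul_index' (by simp), Finsupp.smul_sum]
      refine Finsupp.sum_congr fun k _ => ?_
      rw [Finsupp.smul_sum]
      refine Finsupp.sum_congr fun b _ => ?_
      simp)
    (fun v u w => by
      rw [← Finsupp.sum_add]
      refine Finsupp.sum_congr fun k _ => ?_
      exact Finsupp.sum_add_index' (by simp) (by intro b U W; simp [Matrix.mul_add]))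
    (fun c v u => by
      rw [Finsupp.smul_sum]
      refine Finsupp.sum_congr fun k _ => ?_
      rw [Finsupp.sum_smul_index' (by simp), Finsupp.smul_sum]
      refine Finsupp.sum_congr fun b _ => ?_
      simp)

theorem comb_apply {s r q : ℕ} (t : ℤ) (v : FSeq s r) (u : FSeq r q) :
    comb t v u = v.sum fun k V => u.sum fun b U => Finsupp.single (t * k + b) (V * U) := rfl

@[simp] theorem comb_single_single {s r q : ℕ} (t k b : ℤ) (V : Matrix (Fin s) (Fin r) ℂ)
    (U : Matrix (Fin r) (Fin q) ℂ) :
    comb t (Finsupp.single k V) (Finsupp.single b U) = Finsupp.single (t * k + b) (V * U) := by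
  rw [comb_apply, Finsupp.sum_single_index (by simp), Finsupp.sum_single_index (by simp)]

theorem pairing_comb {s r q : ℕ} (t : ℤ) (v : FSeq s r) (u : FSeq r q) (F : ℤ → ℂ) :
    pairing (comb t v u) F = v.sum fun k V => u.sum fun b U => F (t * k + b) • (V * U) := by
  induction v using Finsupp.induction_linear with
  | zero => simp
  | add v w hv hw =>
    rw [map_add, LinearMap.add_apply, map_add, LinearMap.add_apply, hv, hw,
      Finsupp.sum_add_index' (by simp) (by intro k V W; simp [Matrix.add_mul, Finsupp.sum_add])]
  | single k V =>
    rw [Finsupp.sum_single_index (by simp)]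
    induction u using Finsupp.induction_linear with
    | zero => simp
    | add v w hv hw =>
      rw [map_add, map_add, LinearMap.add_apply, hv, hw,
        Finsupp.sum_add_index' (by simp) (by intro k V W; simp [Matrix.mul_add])]
    | single b U => rw [Finsupp.sum_single_index (by simp)]; simp

/-- Summation over the left factor last. -/
theorem pairing_comb_left {s r q : ℕ} (t : ℤ) (v : FSeq s r) (u : FSeq r q) (F : ℤ → ℂ) :
    pairing (comb t v u) F = v.sum fun k V => V * pairing u fun b => F (t * k + b) := by
  rw [pairing_comb]
  refine Finsupp.sum_congr fun k _ => ?_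
  rw [pairing_apply, Finsupp.sum, Finsupp.sum, Matrix.mul_sum]
  exact Finset.sum_congr rfl fun b _ => by simp

/-- Summation over the right factor last. -/
theorem pairing_comb_right {s r q : ℕ} (t : ℤ) (v : FSeq s r) (u : FSeq r q) (F : ℤ → ℂ) :
    pairing (comb t v u) F = u.sum fun b U => (pairing v fun k => F (t * k + b)) * U := by
  rw [pairing_comb, Finsupp.sum, Finsupp.sum]
  simp only [Finsupp.sum]
  rw [Finset.sum_comm]
  refine Finset.sum_congr rfl fun b _ => ?_
  rw [pairing_apply, Finsupp.sum, Matrix.sum_mul]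
  exact Finset.sum_congr rfl fun k _ => by simp

theorem pairing_comb_one {s r q : ℕ} (t : ℤ) (v : FSeq s r) (u : FSeq r q) :
    pairing (comb t v u) (fun _ => 1) = pairing v (fun _ => 1) * pairing u (fun _ => 1) := by
  rw [pairing_comb_left, pairing_apply v, Finsupp.sum, Finsupp.sum, Matrix.sum_mul]
  simp

theorem comb_assoc {s r q p : ℕ} (t t' : ℤ) (u : FSeq s r) (v : FSeq r q) (w : FSeq q p) :
    comb t (comb t' u v) w = comb (t * t') u (comb t v w) := by
  induction u using Finsupp.induction_linear with
  | zero => simp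
  | add v w hv hw => simp only [map_add, LinearMap.add_apply, hv, hw]
  | single k U =>
    induction v using Finsupp.induction_linear with
    | zero => simp
    | add v w hv hw => simp only [map_add, LinearMap.add_apply, hv, hw]
    | single j V =>
      induction w using Finsupp.induction_linear with
      | zero => simp
      | add v w hv hw => simp only [map_add, hv, hw]
      | single i W =>
        rw [comb_single_single, comb_single_single, comb_single_single, comb_single_single,
          Matrix.mul_assoc]
        congr 1; ring

theorem symbol_comb {s r q : ℕ} (t : ℤ) (v : FSeq s r) (u : FSeq r q) (ξ : ℝ) :
    symbol (comb t v u) ξ = symbol v (t * ξ) * symbol u ξ := by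
  rw [symbol_eq_pairing, pairing_comb_left, symbol_eq_pairing v, pairing_apply, Finsupp.sum,
    Finsupp.sum, Matrix.sum_mul]
  refine Finset.sum_congr rfl fun k _ => ?_
  rw [Matrix.smul_mul, symbol_eq_pairing, ← Matrix.mul_smul, ← map_smul]
  congr 2
  funext b
  rw [Pi.smul_apply, smul_eq_mul, ← Complex.exp_add]
  congr 1
  push_cast
  ring

theorem symbol_add_two_pi {s t : ℕ} (u : FSeq s t) (ξ : ℝ) :
    symbol u (ξ + 2 * Real.pi) = symbol u ξ := by
  rw [symbol_eq_pairing, symbol_eq_pairing]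
  congr 1
  funext k
  rw [Complex.exp_eq_exp_iff_exists_int]
  exact ⟨-k, by push_cast; ring⟩

/-- Doubling turns the shift by π into a full period of v̂. The sum-rule expression thus becomes a
single symbol at ξ + π, whose derivatives at 0 are alternating moments. -/
theorem symbol_mul_symbol_add_pi {s r q : ℕ} (v : FSeq s r) (u : FSeq r q) (ξ : ℝ) :
    symbol v (2 * ξ) * symbol u (ξ + Real.pi) = symbol (comb 2 v u) (ξ + Real.pi) := by
  rw [symbol_comb, ← symbol_add_two_pi v (2 * ξ)]
  congr 2
  push_cast
  ring

/-- Pointwise values of a dilated convolution. -/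
theorem comb_apply_apply {s r q : ℕ} (t : ℤ) (v : FSeq s r) (u : FSeq r q) (j : ℤ) :
    comb t v u j = v.sum fun k V => V * u (j - t * k) := by
  induction v using Finsupp.induction_linear with
  | zero => simp
  | add v w hv hw =>
    rw [map_add, LinearMap.add_apply, Finsupp.add_apply, hv, hw,
      Finsupp.sum_add_index' (by simp) (by intro k V W; simp [Matrix.add_mul])]
  | single k V =>
    rw [Finsupp.sum_single_index (by simp)]
    induction u using Finsupp.induction_linear with
    | zero => simp
    | add v w hv hw =>
      rw [map_add, Finsupp.add_apply, hv, hw, Finsupp.add_apply, Matrix.mul_add]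
    | single b U =>
      rw [comb_single_single, Finsupp.single_apply, Finsupp.single_apply]
      by_cases h : t * k + b = j
      · rw [if_pos h, if_pos (by omega)]
      · rw [if_neg h, if_neg (by omega), Matrix.mul_zero]

theorem conv_eq_comb {s r q : ℕ} (w : FSeq s r) (u : FSeq r q) : conv (⇑w) u = ⇑(comb 1 w u) := by
  funext j
  rw [conv]
  have : comb 1 w u j = u.sum fun k U => w (j - k) * U := by
    induction u using Finsupp.induction_linear with
    | zero => simp
    | add v w hv hw =>
      rw [map_add, Finsupp.add_apply, hv, hw,
        Finsupp.sum_add_index' (by simp) (by intro k V W; simp [Matrix.mul_add])]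
    | single b U =>
      rw [Finsupp.sum_single_index (by simp), comb_apply_apply]
      simp only [Finsupp.single_apply, one_mul]
      rw [Finsupp.sum, Finset.sum_eq_single (j - b)]
      · simp
      · intro k _ hk
        rw [if_neg (by omega), Matrix.mul_zero]
      · intro h
        rw [Finsupp.notMem_support_iff.mp h, Matrix.zero_mul]
  rw [this, Finsupp.sum]

/-! ### Iterated masks -/

/-- The finitely supported sequence `S_a^n (δ I_r)`. -/
def maskIter {r : ℕ} (a : FSeq r r) : ℕ → FSeq r r
  | 0 => Finsupp.single 0 1
  | n + 1 => (2 : ℂ) • comb 2 (maskIter a n) a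

theorem maskIter_zero {r : ℕ} (a : FSeq r r) : maskIter a 0 = Finsupp.single 0 1 := rfl

theorem maskIter_succ {r : ℕ} (a : FSeq r r) (n : ℕ) :
    maskIter a (n + 1) = (2 : ℂ) • comb 2 (maskIter a n) a := rfl

@[simp] theorem comb_single_zero_one {r q : ℕ} (t : ℤ) (u : FSeq r q) :
    comb t (Finsupp.single 0 1) u = u := by
  ext1 j
  rw [comb_apply_apply, Finsupp.sum_single_index (by simp)]
  simp

/-- The cocycle identity behind all decay estimates; it follows from the one-step recursion by
associativity of `comb`. -/
theorem maskIter_add {r : ℕ} (a : FSeq r r) (n p : ℕ) :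
    maskIter a (n + p) = comb (2 ^ p) (maskIter a n) (maskIter a p) := by
  induction p with
  | zero =>
    ext1 j
    rw [comb_apply_apply, maskIter_zero, add_zero, pow_zero]
    simp only [Finsupp.single_apply, one_mul]
    rw [Finsupp.sum, Finset.sum_eq_single j]
    · simp
    · intro k _ hk
      rw [if_neg (by omega), Matrix.mul_zero]
    · intro h
      rw [Finsupp.notMem_support_iff.mp h, Matrix.zero_mul]
  | succ p ih =>
    rw [← add_assoc, maskIter_succ, ih, comb_assoc, maskIter_succ, map_smul, pow_succ, mul_comm]

theorem maskIter_one {r : ℕ} (a : FSeq r r) : maskIter a 1 = (2 : ℂ) • a := by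
  rw [maskIter_succ, maskIter_zero, comb_single_zero_one]

/-- The subdivision operator as a sum over the support of the mask. -/
theorem subdiv_apply {s r : ℕ} (a : FSeq r r) (w : MSeq s r) (j : ℤ) :
    subdiv a w j = (2 : ℂ) • ∑ b ∈ a.support with 2 ∣ j - b, w ((j - b) / 2) * a b := by
  rw [subdiv]
  congr 1
  rw [finsum_eq_sum_of_support_subset (s := (a.support.filter fun b => 2 ∣ j - b).image
    fun b => (j - b) / 2)]
  · rw [Finset.sum_image]
    · refine Finset.sum_congr rfl fun b hb => ?_
      have h2 := (Finset.mem_filter.mp hb).2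
      congr 2; omega
    · intro b hb c hc h
      have h2 := (Finset.mem_filter.mp hb).2
      have h3 := (Finset.mem_filter.mp hc).2
      simp only at h; omega
  · intro k hk
    rw [Function.mem_support] at hk
    rw [Finset.coe_image]
    refine ⟨j - 2 * k, ?_, by simp only; omega⟩
    simp only [Finset.coe_filter, Set.mem_ofPred_eq, Finsupp.mem_support_iff]
    exact ⟨fun h => hk (by rw [h, Matrix.mul_zero]), by omega⟩

theorem subdiv_coe {s r : ℕ} (a : FSeq r r) (w : FSeq s r) :
    subdiv a (⇑w) = ⇑((2 : ℂ) • comb 2 w a) := by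
  funext j
  rw [subdiv, Finsupp.smul_apply, comb_apply_apply]
  congr 1
  rw [finsum_eq_sum_of_support_subset (s := w.support)]
  · rfl
  · intro k hk
    rw [Function.mem_support] at hk
    exact Finsupp.mem_support_iff.mpr fun h => hk (by rw [h, Matrix.zero_mul])

theorem subdiv_iterate_coe {s r : ℕ} (a : FSeq r r) (w : FSeq s r) (n : ℕ) :
    (subdiv a)^[n] (⇑w) = ⇑(comb (2 ^ n) w (maskIter a n)) := by
  induction n with
  | zero =>
    funext j
    rw [comb_apply_apply, maskIter_zero]
    simp only [Finsupp.single_apply, Function.iterate_zero, id, pow_zero, one_mul]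
    rw [Finsupp.sum, Finset.sum_eq_single j]
    · simp
    · intro k _ hk
      rw [if_neg (by omega), Matrix.mul_zero]
    · intro h
      rw [Finsupp.notMem_support_iff.mp h, Matrix.zero_mul]
  | succ n ih =>
    rw [Function.iterate_succ_apply', ih, subdiv_coe, comb_assoc, maskIter_succ, map_smul,
      pow_succ, mul_comm (2 ^ n) (2 : ℤ)]

theorem subdiv_iterate_diracId {r : ℕ} (a : FSeq r r) (n : ℕ) :
    (subdiv a)^[n] (diracId r) = ⇑(maskIter a n) := by
  have h : diracId r = ⇑(Finsupp.single 0 1 : FSeq r r) := by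
    funext k
    rw [diracId, Finsupp.single_apply]
    simp only [eq_comm]
  rw [h, subdiv_iterate_coe, comb_single_zero_one]

/-- A bound for the support of a finitely supported sequence. -/
theorem exists_support_bound {s r : ℕ} (u : FSeq s r) :
    ∃ B : ℕ, ∀ k : ℤ, (B : ℤ) < |k| → u k = 0 := by
  obtain ⟨B, hB⟩ : ∃ B : ℕ, ∀ k ∈ u.support, k.natAbs ≤ B :=
    ⟨u.support.sup Int.natAbs, fun k hk => Finset.le_sup (f := Int.natAbs) hk⟩
  refine ⟨B, fun k hk => ?_⟩
  by_contra h
  have := hB k (Finsupp.mem_support_iff.mpr h)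
  rw [Int.abs_eq_natAbs] at hk
  omega

/-- Each step doubles the support radius and adds B. Starting from 0, the radius after n steps is
B(2^n - 1). -/
theorem maskIter_apply_eq_zero {r : ℕ} {a : FSeq r r} {B : ℕ}
    (hB : ∀ k : ℤ, (B : ℤ) < |k| → a k = 0) (n : ℕ) {k : ℤ} (hk : B * (2 ^ n - 1) < |k|) :
    maskIter a n k = 0 := by
  induction n generalizing k with
  | zero =>
    rw [maskIter_zero, Finsupp.single_apply, if_neg]
    rintro rfl
    simp at hk
  | succ n ih =>
    rw [maskIter_succ, Finsupp.smul_apply, comb_apply_apply, Finsupp.sum, Finset.sum_eq_zero,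
      smul_zero]
    intro i _
    by_cases hi : B * (2 ^ n - 1) < |i|
    · rw [ih hi, Matrix.zero_mul]
    · rw [hB, Matrix.mul_zero]
      push Not at hi
      rw [pow_succ] at hk
      have h1 : |k| ≤ |k - 2 * i| + 2 * |i| := by
        have := abs_add_le (k - 2 * i) (2 * i)
        rw [abs_mul, abs_two] at this
        simpa using this
      nlinarith

/-- Subdivision is local. -/
theorem subdiv_iterate_local {s r : ℕ} {a : FSeq r r} {B : ℕ}
    (hB : ∀ k : ℤ, (B : ℤ) < |k| → a k = 0) {w w' : MSeq s r} {M : ℤ}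
    (h : ∀ k, |k| ≤ M + B → w k = w' k) (n : ℕ) :
    ∀ j, |j| ≤ 2 ^ n * M + B → (subdiv a)^[n] w j = (subdiv a)^[n] w' j := by
  induction n with
  | zero => intro j hj; exact h j (by simpa using hj)
  | succ n ih =>
    intro j hj
    rw [Function.iterate_succ_apply', Function.iterate_succ_apply', subdiv_apply, subdiv_apply]
    congr 1
    refine Finset.sum_congr rfl fun b hb => ?_
    rw [Finset.mem_filter, Finsupp.mem_support_iff] at hb
    have hb1 : |b| ≤ B := not_lt.mp fun hlt => hb.1 (hB b hlt)
    rw [ih]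
    obtain ⟨c, hc⟩ := hb.2
    rw [hc, Int.mul_ediv_cancel_left _ two_ne_zero]
    have h1 : 2 * |c| ≤ |j| + |b| := by
      have := abs_sub j b
      rw [hc, abs_mul, abs_two] at this
      exact this
    rw [pow_succ] at hj
    linarith

/-! ### Moments -/

theorem hasDerivAt_exp_neg_I_mul (k : ℂ) (ξ : ℝ) :
    HasDerivAt (fun ξ : ℝ => Complex.exp (-(Complex.I * k * (ξ : ℂ))))
      (-(Complex.I * k) * Complex.exp (-(Complex.I * k * (ξ : ℂ)))) ξ := by
  have h1 : HasDerivAt (fun ξ : ℝ => -(Complex.I * k * (ξ : ℂ))) (-(Complex.I * k)) ξ := by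
    have h := ((Complex.ofRealCLM.hasDerivAt (x := ξ)).const_mul (-(Complex.I * k)))
    simpa using h
  simpa [mul_comm] using h1.cexp

theorem pairing_entry {s t : ℕ} (u : FSeq s t) (F : ℤ → ℂ) (i : Fin s) (l : Fin t) :
    pairing u F i l = ∑ k ∈ u.support, F k * u k i l := by
  rw [pairing_apply, Finsupp.sum, Matrix.sum_apply]
  rfl

theorem iteratedDeriv_symbol {s t : ℕ} (w : FSeq s t) (i : Fin s) (l : Fin t) (j : ℕ) :
    iteratedDeriv j (fun ξ => symbol w ξ i l) = fun ξ : ℝ => (-Complex.I) ^ j *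
      pairing w (fun k => (k : ℂ) ^ j * Complex.exp (-(Complex.I * (k : ℂ) * (ξ : ℂ)))) i l := by
  induction j with
  | zero => funext ξ; simp [symbol_eq_pairing]
  | succ j ih =>
    rw [iteratedDeriv_succ, ih]
    funext ξ
    simp only [pairing_entry]
    have h : ∀ k ∈ w.support, HasDerivAt (fun ξ : ℝ => (k : ℂ) ^ j *
        Complex.exp (-(Complex.I * (k : ℂ) * (ξ : ℂ))) * w k i l)
        ((k : ℂ) ^ j * (-(Complex.I * k) * Complex.exp (-(Complex.I * (k : ℂ) * (ξ : ℂ))))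
          * w k i l) ξ :=
      fun k _ => ((hasDerivAt_exp_neg_I_mul k ξ).const_mul _).mul_const _
    rw [((HasDerivAt.fun_sum h).const_mul ((-Complex.I) ^ j)).deriv, Finset.mul_sum,
      Finset.mul_sum]
    refine Finset.sum_congr rfl fun k _ => ?_
    ring

theorem iteratedDeriv_symbol_zero {s t : ℕ} (w : FSeq s t) (i : Fin s) (l : Fin t) (j : ℕ) :
    iteratedDeriv j (fun ξ => symbol w ξ i l) 0 =
      (-Complex.I) ^ j * pairing w (fun k => (k : ℂ) ^ j) i l := by
  rw [iteratedDeriv_symbol]; simp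

theorem exp_neg_I_mul_pi (k : ℤ) :
    Complex.exp (-(Complex.I * (k : ℂ) * (Real.pi : ℂ))) = (-1) ^ k := by
  rw [← Complex.exp_pi_mul_I, ← Complex.exp_int_mul, Complex.exp_eq_exp_iff_exists_int]
  exact ⟨-k, by push_cast; ring⟩

theorem iteratedDeriv_symbol_pi {s t : ℕ} (w : FSeq s t) (i : Fin s) (l : Fin t) (j : ℕ) :
    iteratedDeriv j (fun ξ => symbol w (ξ + Real.pi) i l) 0 =
      (-Complex.I) ^ j * pairing w (fun k => (k : ℂ) ^ j * (-1) ^ k) i l := by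
  have h := congrFun (iteratedDeriv_comp_add_const j (fun ξ => symbol w ξ i l) Real.pi) 0
  rw [iteratedDeriv_symbol] at h
  simp only [zero_add, exp_neg_I_mul_pi] at h
  exact h

theorem neg_I_pow_ne_zero (j : ℕ) : (-Complex.I) ^ j ≠ 0 :=
  pow_ne_zero _ (neg_ne_zero.mpr Complex.I_ne_zero)

/-- The j-th derivative of a symbol at 0 is (-i)^j times the j-th moment, and the factor cancels. -/
theorem eqUpTo_symbol_iff {t : ℕ} (w w' : FSeq 1 t) (n : ℕ) :
    (∀ l, EqUpTo n (fun ξ => symbol w ξ 0 l) (fun ξ => symbol w' ξ 0 l)) ↔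
      ∀ j < n, pairing w (fun k => (k : ℂ) ^ j) = pairing w' (fun k => (k : ℂ) ^ j) := by
  constructor
  · intro h j hj
    ext i l
    have := h l j hj
    rw [iteratedDeriv_symbol_zero, iteratedDeriv_symbol_zero] at this
    rw [Subsingleton.elim i 0]
    exact mul_left_cancel₀ (neg_I_pow_ne_zero j) this
  · intro h l j hj
    rw [iteratedDeriv_symbol_zero, iteratedDeriv_symbol_zero, h j hj]

theorem isMatchingFilter_iff {r : ℕ} {a : FSeq r r} {v : FSeq 1 r} {n : ℕ} :
    IsMatchingFilter a v n ↔ pairing v (fun _ => 1) ≠ 0 ∧ ∀ j < n,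
      pairing (comb 2 v a) (fun k => (k : ℂ) ^ j) = pairing v (fun k => (k : ℂ) ^ j) := by
  rw [IsMatchingFilter, symbol_zero_eq_pairing, ← eqUpTo_symbol_iff]
  simp only [symbol_comb, Int.cast_ofNat]

theorem hasSumRules_iff {r : ℕ} {a : FSeq r r} {v : FSeq 1 r} {n : ℕ} :
    HasSumRules a v n ↔ IsMatchingFilter a v n ∧ ∀ j < n,
      pairing (comb 2 v a) (fun k => (k : ℂ) ^ j * (-1) ^ k) = 0 := by
  rw [HasSumRules]
  refine and_congr_right fun _ => ?_
  simp only [symbol_mul_symbol_add_pi, EqUpTo, iteratedDeriv_symbol_pi]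
  constructor
  · intro h j hj
    ext i l
    have := h l j hj
    rw [Subsingleton.elim i 0]
    simpa using this
  · intro h l j hj
    rw [h j hj]; simp

theorem mem_annihilated_iff {r : ℕ} {v : FSeq 1 r} {u : FSeq r 1} {n : ℕ} :
    u ∈ annihilated v n ↔ ∀ j < n, pairing (comb 1 v u) (fun k => (k : ℂ) ^ j) = 0 := by
  have h : u ∈ annihilated v n ↔ ∀ l, EqUpTo n (fun ξ => symbol (comb 1 v u) ξ 0 l)
      (fun ξ => symbol (0 : FSeq 1 1) ξ 0 l) := by
    simp only [symbol_comb, Int.cast_one, one_mul]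
    have h0 : ∀ ξ, symbol (0 : FSeq 1 1) ξ = 0 := fun ξ => by simp [symbol_eq_pairing]
    simp only [h0]
    exact ⟨fun h l => by rw [Subsingleton.elim l 0]; exact h, fun h => h 0⟩
  rw [h, eqUpTo_symbol_iff]
  simp

/-- Vanishing moments annihilate polynomials. -/
theorem pairing_polynomial {s t : ℕ} {w w' : FSeq s t} {n : ℕ} {c : ℤ → ℂ}
    (h : ∀ j < n, pairing w (fun k => (k : ℂ) ^ j * c k) = pairing w' (fun k => (k : ℂ) ^ j * c k))
    {P : Polynomial ℂ} (hP : P.degree < n) :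
    pairing w (fun k => P.eval (k : ℂ) * c k) = pairing w' (fun k => P.eval (k : ℂ) * c k) := by
  have hs : (fun k : ℤ => P.eval (k : ℂ) * c k) =
      ∑ i ∈ P.support, P.coeff i • fun k : ℤ => (k : ℂ) ^ i * c k := by
    funext k
    rw [Polynomial.eval_eq_sum, Polynomial.sum, Finset.sum_apply, Finset.sum_mul]
    refine Finset.sum_congr rfl fun i _ => ?_
    simp [mul_assoc]
  rw [hs, map_sum, map_sum]
  refine Finset.sum_congr rfl fun i hi => ?_
  rw [map_smul, map_smul, h i]
  exact_mod_cast (Polynomial.le_degree_of_mem_supp i hi).trans_lt hP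

theorem pairing_polynomial' {s t : ℕ} {w w' : FSeq s t} {n : ℕ}
    (h : ∀ j < n, pairing w (fun k => (k : ℂ) ^ j) = pairing w' (fun k => (k : ℂ) ^ j))
    {P : Polynomial ℂ} (hP : P.degree < n) :
    pairing w (fun k => P.eval (k : ℂ)) = pairing w' (fun k => P.eval (k : ℂ)) := by
  simpa using pairing_polynomial (c := fun _ => 1) (by simpa using h) hP

theorem degree_comp_le_of_natDegree_le_one {P Q : Polynomial ℂ} {n : ℕ} (hP : P.degree < n)
    (hQ : Q.natDegree ≤ 1) : (P.comp Q).degree < n := by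
  rcases eq_or_ne P 0 with rfl | h0
  · simp
  · have h1 : P.natDegree < n := (Polynomial.natDegree_lt_iff_degree_lt h0).mpr hP
    have h2 : (P.comp Q).natDegree ≤ P.natDegree :=
      Polynomial.natDegree_comp_le.trans (mul_le_of_le_one_right (Nat.zero_le _) hQ)
    exact Polynomial.degree_le_natDegree.trans_lt (by exact_mod_cast h2.trans_lt h1)

theorem natDegree_linear_le (c d : ℂ) :
    (Polynomial.C c * Polynomial.X + Polynomial.C d).natDegree ≤ 1 :=
  Polynomial.natDegree_linear_le

theorem natDegree_scaling_le (c : ℂ) : (Polynomial.C c * Polynomial.X).natDegree ≤ 1 :=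
  (Polynomial.natDegree_C_mul_le c _).trans Polynomial.natDegree_X_le

/-- The matching filter relation for iterated masks. -/
theorem pairing_comb_maskIter {r : ℕ} {a : FSeq r r} {v : FSeq 1 r} {n : ℕ}
    (hv : IsMatchingFilter a v n) (N : ℕ) {P : Polynomial ℂ} (hP : P.degree < n) :
    pairing (comb (2 ^ N) v (maskIter a N)) (fun k => P.eval (k : ℂ)) =
      (2 : ℂ) ^ N • pairing v fun k => P.eval (k : ℂ) := by
  induction N generalizing P with
  | zero =>
    have h : comb (2 ^ 0) v (maskIter a 0) = v := by
      ext1 j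
      have := congrFun (subdiv_iterate_coe a v 0) j
      rw [← this]; rfl
    rw [h]; simp
  | succ N ih =>
    have h : comb (2 ^ (N + 1)) v (maskIter a (N + 1)) =
        (2 : ℂ) • comb 2 (comb (2 ^ N) v (maskIter a N)) a := by
      rw [comb_assoc, maskIter_succ, map_smul, pow_succ, mul_comm]
    rw [h, map_smul, LinearMap.smul_apply, pairing_comb_right]
    have h2 : ∀ b : ℤ, (fun k : ℤ => P.eval ((2 * k + b : ℤ) : ℂ)) = fun k : ℤ =>
        (P.comp (Polynomial.C 2 * Polynomial.X + Polynomial.C (b : ℂ))).eval (k : ℂ) := by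
      intro b; funext k; simp
    have h3 : (a.sum fun b U => (pairing (comb (2 ^ N) v (maskIter a N)) fun k =>
        P.eval ((2 * k + b : ℤ) : ℂ)) * U) = (2 : ℂ) ^ N •
        a.sum fun b U => (pairing v fun k => P.eval ((2 * k + b : ℤ) : ℂ)) * U := by
      rw [Finsupp.smul_sum]
      refine Finsupp.sum_congr fun b _ => ?_
      rw [h2, ih (degree_comp_le_of_natDegree_le_one hP (natDegree_linear_le _ _)),
        Matrix.smul_mul]
    rw [h3, ← pairing_comb_right 2 v a (fun k => P.eval (k : ℂ)),
      pairing_polynomial' (isMatchingFilter_iff.mp hv).2 hP, smul_smul, pow_succ, mul_comm]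

theorem pairing_mul_pairing_maskIter_one {r : ℕ} {a : FSeq r r} {v : FSeq 1 r} {n : ℕ}
    (hv : IsMatchingFilter a v n) (hn : 0 < n) (N : ℕ) :
    pairing v (fun _ => 1) * pairing (maskIter a N) (fun _ => 1) =
      (2 : ℂ) ^ N • pairing v fun _ => 1 := by
  have h := pairing_comb_maskIter hv N (P := 1) (by simpa using hn)
  simp only [Polynomial.eval_one] at h
  rw [← h, pairing_comb_one]

/-! ### Sum rules have bounded order -/

/-- The polynomial sequence `k ↦ ∑ᵢ p(k - i) v(i)`. -/
def polySeq {r : ℕ} (v : FSeq 1 r) (P : Polynomial ℂ) : MSeq 1 r :=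
  fun k => pairing v fun i => P.eval ((k : ℂ) - i)

/-- Subdivision sees only the indices b congruent to j modulo 2, that is, it uses the weight (1 +
(-1)^{j+b})/2. The constant part is handled by the matching relation and the alternating part
vanishes by the sum rules, so subdivision dilates the polynomial. -/
theorem subdiv_polySeq {r : ℕ} {a : FSeq r r} {v : FSeq 1 r} {n : ℕ} (h : HasSumRules a v n)
    {P : Polynomial ℂ} (hP : P.degree < n) :
    subdiv a (polySeq v P) = polySeq v (P.comp (Polynomial.C 2⁻¹ * Polynomial.X)) := by
  have hP2 : (P.comp (Polynomial.C 2⁻¹ * Polynomial.X)).degree < n :=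
    degree_comp_le_of_natDegree_le_one hP (natDegree_scaling_le _)
  set Q := P.comp (Polynomial.C 2⁻¹ * Polynomial.X) with hQ
  have hQe : ∀ x, Q.eval x = P.eval (x / 2) := fun x => by
    rw [hQ, Polynomial.eval_comp]; simp; ring_nf
  funext j
  rw [subdiv_apply]
  have hR : ∀ x, (Q.comp (Polynomial.C (-1) * Polynomial.X + Polynomial.C (j : ℂ))).eval x
      = Q.eval ((j : ℂ) - x) := fun x => by simp [sub_eq_add_neg, add_comm]
  have hRd : (Q.comp (Polynomial.C (-1) * Polynomial.X + Polynomial.C (j : ℂ))).degree < n :=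
    degree_comp_le_of_natDegree_le_one hP2 (natDegree_linear_le _ _)
  have h1 := pairing_polynomial' (isMatchingFilter_iff.mp h.1).2 hRd
  have h2 := pairing_polynomial (w' := 0) (c := fun k => (-1) ^ k)
    (by simpa using (hasSumRules_iff.mp h).2) hRd
  simp only [hR] at h1 h2
  rw [polySeq, ← h1]
  rw [map_zero, LinearMap.zero_apply] at h2
  -- The factor 2 of the subdivision operator cancels the 1/2 in the parity indicator.
  have h3 : (2 : ℂ) • ∑ b ∈ a.support with 2 ∣ j - b, polySeq v P ((j - b) / 2) * a b =
      pairing (comb 2 v a) (fun k => Q.eval ((j : ℂ) - k)) +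
      ((-1 : ℂ) ^ j) • pairing (comb 2 v a) (fun k => Q.eval ((j : ℂ) - k) * (-1) ^ k) := by
    rw [pairing_comb_right, pairing_comb_right, Finsupp.smul_sum, ← Finsupp.sum_add,
      Finset.sum_filter, Finset.smul_sum, Finsupp.sum]
    refine Finset.sum_congr rfl fun b _ => ?_
    have h4 : ∀ k : ℤ, ((-1 : ℂ)) ^ (2 * k + b) = (-1) ^ b := fun k => by
      rw [zpow_add₀ (by norm_num), _root_.zpow_mul]; simp
    simp only [h4]
    have h5 : (pairing v fun k => Q.eval ((j : ℂ) - ((2 * k + b : ℤ) : ℂ)) * (-1 : ℂ) ^ b) =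
        (-1 : ℂ) ^ b • pairing v fun k => Q.eval ((j : ℂ) - ((2 * k + b : ℤ) : ℂ)) := by
      rw [← map_smul]; congr 1; funext k; simp [mul_comm]
    rw [h5, Matrix.smul_mul, smul_smul, ← zpow_add₀ (by norm_num)]
    by_cases h6 : (2 : ℤ) ∣ j - b
    · rw [if_pos h6]
      have h7 : Even (j + b) := by rw [Int.even_iff]; omega
      rw [h7.neg_one_zpow, one_smul, two_smul]
      obtain ⟨c, hc⟩ := h6
      have h8 : polySeq v P ((j - b) / 2) =
          pairing v fun k => Q.eval ((j : ℂ) - ((2 * k + b : ℤ) : ℂ)) := by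
        rw [polySeq, hc, Int.mul_ediv_cancel_left _ two_ne_zero]
        congr 1; funext k
        rw [hQe]
        congr 1
        have h9 : (j : ℂ) = 2 * c + b := by
          have : j = 2 * c + b := by linarith
          exact_mod_cast this
        rw [h9]; push_cast; ring
      rw [h8]
    · rw [if_neg h6]
      have h7 : Odd (j + b) := by rw [Int.odd_iff]; omega
      rw [h7.neg_one_zpow]; simp
  rw [h3, h2, smul_zero, add_zero]

theorem subdiv_iterate_polySeq {r : ℕ} {a : FSeq r r} {v : FSeq 1 r} {n : ℕ}
    (h : HasSumRules a v n) (N : ℕ) {P : Polynomial ℂ} (hP : P.degree < n) :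
    (subdiv a)^[N] (polySeq v P) =
      polySeq v (P.comp (Polynomial.C ((2 : ℂ) ^ N)⁻¹ * Polynomial.X)) := by
  induction N generalizing P with
  | zero => simp
  | succ N ih =>
    rw [Function.iterate_succ_apply, subdiv_polySeq h hP,
      ih (degree_comp_le_of_natDegree_le_one hP (natDegree_scaling_le _)),
      Polynomial.comp_assoc]
    congr 2
    simp only [Polynomial.mul_comp, Polynomial.C_comp, Polynomial.X_comp]
    rw [← mul_assoc, ← Polynomial.C_mul, pow_succ, mul_inv, mul_comm (2 : ℂ)⁻¹]

/-- A polynomial sequence which vanishes often vanishes identically. -/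
theorem eq_zero_of_polySeq_eq_zero {r : ℕ} {v : FSeq 1 r} (hv : pairing v (fun _ => 1) ≠ 0)
    {P : Polynomial ℂ} {S : Finset ℤ} (hS : P.natDegree < S.card)
    (h : ∀ k ∈ S, polySeq v P k = 0) : P = 0 := by
  obtain ⟨l, hl⟩ : ∃ l, pairing v (fun _ => 1) 0 l ≠ 0 := by
    by_contra! hc
    exact hv (by ext i l; rw [Subsingleton.elim i 0]; exact hc l)
  by_contra h0
  -- Entry l of the sequence is itself a polynomial in k; its coefficient of degree deg P is the
  -- leading coefficient of P times the nonzero number v̂_l(0).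
  let R : Polynomial ℂ := ∑ i ∈ v.support,
    Polynomial.C (v i 0 l) * P.comp (Polynomial.X + Polynomial.C (-(i : ℂ)))
  have hR : ∀ k : ℤ, R.eval (k : ℂ) = polySeq v P k 0 l := by
    intro k
    rw [polySeq, pairing_entry, Polynomial.eval_finsetSum]
    refine Finset.sum_congr rfl fun i _ => ?_
    simp [sub_eq_add_neg, mul_comm]
  have hdeg : R.natDegree ≤ P.natDegree := by
    refine Polynomial.natDegree_sum_le_of_forall_le _ _ fun i _ => ?_
    refine Polynomial.natDegree_C_mul_le _ _ |>.trans ?_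
    rw [Polynomial.natDegree_comp, Polynomial.natDegree_X_add_C, mul_one]
  have hc : R.coeff P.natDegree = P.leadingCoeff * pairing v (fun _ => 1) 0 l := by
    rw [Polynomial.finsetSum_coeff, pairing_entry, Finset.mul_sum]
    refine Finset.sum_congr rfl fun i _ => ?_
    rw [Polynomial.coeff_C_mul, one_mul, mul_comm]
    congr 1
    have h1 : (P.comp (Polynomial.X + Polynomial.C (-(i : ℂ)))).natDegree = P.natDegree := by
      rw [Polynomial.natDegree_comp, Polynomial.natDegree_X_add_C, mul_one]
    rw [← h1, Polynomial.coeff_natDegree, Polynomial.leadingCoeff_comp]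
    · rw [Polynomial.leadingCoeff_X_add_C, one_pow, mul_one]
    · rw [Polynomial.natDegree_X_add_C]; exact one_ne_zero
  have hR0 : R = 0 := by
    refine Polynomial.eq_zero_of_natDegree_lt_card_of_eval_eq_zero' R
      (S.image fun k : ℤ => (k : ℂ)) ?_ ?_
    · intro x hx
      obtain ⟨k, hk, rfl⟩ := Finset.mem_image.mp hx
      rw [hR, h k hk]; rfl
    · rw [Finset.card_image_of_injective _ Int.cast_injective]
      exact hdeg.trans_lt hS
  rw [hR0, Polynomial.coeff_zero] at hc
  exact mul_ne_zero (Polynomial.leadingCoeff_ne_zero.mpr h0) hl hc.symm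

/-- If the order exceeded the dimension of the space of sequences on a window, some nonzero
polynomial sequence would vanish on that window. By locality its iterates vanish on growing windows;
these iterates are dilated polynomial sequences, so they vanish at too many integers. Boundedness is
what makes the supremum defining `sumRuleOrder` meaningful. -/
theorem bddAbove_sumRules {r : ℕ} (a : FSeq r r) :
    BddAbove {n : ℕ | ∃ v : FSeq 1 r, HasSumRules a v n} := by
  obtain ⟨B, hB⟩ := exists_support_bound a
  let W : Finset ℤ := Finset.Icc (-(B + 1 : ℤ)) (B + 1)
  refine ⟨Module.finrank ℂ (W → Matrix (Fin 1) (Fin r) ℂ), ?_⟩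
  rintro n ⟨v, hv⟩
  by_contra! hlt
  let f : Polynomial.degreeLT ℂ n →ₗ[ℂ] (W → Matrix (Fin 1) (Fin r) ℂ) :=
    { toFun := fun P k => polySeq v P.1 k
      map_add' := fun P Q => by
        funext k
        simp only [polySeq, Submodule.coe_add, Polynomial.eval_add, Pi.add_apply]
        exact map_add (pairing v) _ _
      map_smul' := fun c P => by
        funext k
        simp only [polySeq, Submodule.coe_smul, Polynomial.eval_smul, Pi.smul_apply]
        exact map_smul (pairing v) c _ }
  have hfin : Module.finrank ℂ (Polynomial.degreeLT ℂ n) = n := by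
    rw [(Polynomial.degreeLTEquiv ℂ n).finrank_eq]; simp
  have : FiniteDimensional ℂ (Polynomial.degreeLT ℂ n) :=
    (Polynomial.degreeLTEquiv ℂ n).symm.finiteDimensional
  obtain ⟨P, hP, hP0⟩ := Submodule.exists_mem_ne_zero_of_ne_bot
    (LinearMap.ker_ne_bot_of_finrank_lt (f := f) (by rwa [hfin]))
  have hPd : P.1.degree < n := Polynomial.mem_degreeLT.mp P.2
  have hw : ∀ k : ℤ, |k| ≤ 1 + B → polySeq v P.1 k = 0 := by
    intro k hk
    have hkW : k ∈ W := Finset.mem_Icc.mpr ⟨by linarith [(abs_le.mp hk).1],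
      by linarith [(abs_le.mp hk).2]⟩
    exact congrFun (LinearMap.mem_ker.mp hP) ⟨k, hkW⟩
  have hz : ∀ N : ℕ, (subdiv a)^[N] (0 : MSeq 1 r) = 0 := by
    intro N
    have h0 : subdiv a (0 : MSeq 1 r) = 0 := by
      funext j
      rw [subdiv_apply]
      simp
    induction N with
    | zero => rfl
    | succ N ih => rw [Function.iterate_succ_apply, h0, ih]
  -- After N = deg P iterations the sequence vanishes for |j| ≤ 2^N + B, a range which contains the
  -- N + 1 points 0, …, N.
  set N := P.1.natDegree
  have hloc := subdiv_iterate_local (w := polySeq v P.1) (w' := 0) hB hw N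
  rw [subdiv_iterate_polySeq hv N hPd, hz] at hloc
  have hdeg : (P.1.comp (Polynomial.C ((2 : ℂ) ^ N)⁻¹ * Polynomial.X)).natDegree ≤ N :=
    Polynomial.natDegree_comp_le.trans
      (mul_le_of_le_one_right (Nat.zero_le _) (natDegree_scaling_le _))
  have h0 := eq_zero_of_polySeq_eq_zero (isMatchingFilter_iff.mp hv.1).1
    (P := P.1.comp (Polynomial.C ((2 : ℂ) ^ N)⁻¹ * Polynomial.X))
    (S := Finset.Icc 0 (N : ℤ)) (by rw [Int.card_Icc]; omega) fun k hk => by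
      rw [Finset.mem_Icc] at hk
      refine hloc k ?_
      have h2 : (N : ℤ) ≤ 2 ^ N := by exact_mod_cast Nat.lt_two_pow_self.le
      rw [abs_of_nonneg hk.1]
      linarith [hk.2, (Nat.cast_nonneg B : (0 : ℤ) ≤ B)]
  refine hP0 (Subtype.ext ?_)
  have h1 := congrArg (fun Q : Polynomial ℂ => Q.comp (Polynomial.C ((2 : ℂ) ^ N) * Polynomial.X)) h0
  simp only [Polynomial.comp_assoc, Polynomial.mul_comp, Polynomial.C_comp, Polynomial.X_comp,
    Polynomial.zero_comp] at h1
  rwa [← mul_assoc, ← Polynomial.C_mul, inv_mul_cancel₀ (pow_ne_zero _ two_ne_zero), Polynomial.C_1, one_mul,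
    Polynomial.comp_X] at h1

/-! ### Exponential decay from submultiplicativity -/

/-- Finite dimension upgrades pointwise smallness to a norm bound 1/2 at one level n₀, uniformly in
k. The cocycle hypothesis `h1` lets this contraction be applied again every n₀ levels. -/
theorem exists_exponential_decay {E K : Type*} [NormedAddCommGroup E] [NormedSpace ℂ E]
    [FiniteDimensional ℂ E] (Λ : ℕ → K → E →ₗ[ℂ] ℂ)
    (hb : ∀ n, ∃ C, ∀ k w, ‖Λ n k w‖ ≤ C * ‖w‖)
    (h0 : ∀ w, ∀ ε > 0, ∃ N, ∀ n ≥ N, ∀ k, ‖Λ n k w‖ ≤ ε)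
    (h1 : ∀ n p k w, ∃ k' w', Λ (n + p) k w = Λ n k' w' ∧
      ∀ c, 0 ≤ c → (∀ i, ‖Λ p i w‖ ≤ c) → ‖w'‖ ≤ c) :
    ∃ C q : ℝ, 0 ≤ C ∧ 1 / 2 ≤ q ∧ q < 1 ∧ ∀ n k w, ‖Λ n k w‖ ≤ C * q ^ n * ‖w‖ := by
  let b := Module.finBasis ℂ E
  let M : ℝ := ∑ i, ‖(b.coord i).toContinuousLinearMap‖
  have hM : 0 ≤ M := Finset.sum_nonneg fun _ _ => norm_nonneg _
  have hMw : ∀ w, ∑ i, ‖b.repr w i‖ ≤ M * ‖w‖ := by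
    intro w
    rw [Finset.sum_mul]
    exact Finset.sum_le_sum fun i _ => (b.coord i).toContinuousLinearMap.le_opNorm w
  -- Smallness on the finitely many basis vectors passes to all w through the coordinate
  -- functionals, whose norms sum to M.
  obtain ⟨n₀, hn₀, hc⟩ : ∃ n₀, 0 < n₀ ∧ ∀ k w, ‖Λ n₀ k w‖ ≤ 1 / 2 * ‖w‖ := by
    choose N hN using fun i => h0 (b i) (1 / (2 * (M + 1))) (by positivity)
    refine ⟨Finset.univ.sup N + 1, Nat.succ_pos _, fun k w => ?_⟩
    conv_lhs => rw [← b.sum_repr w]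
    rw [map_sum]
    calc ‖∑ i, Λ _ k (b.repr w i • b i)‖ ≤ ∑ i, ‖b.repr w i‖ * (1 / (2 * (M + 1))) := by
          refine norm_sum_le_of_le _ fun i _ => ?_
          rw [map_smul, norm_smul]
          gcongr
          exact hN i _ ((Finset.le_sup (Finset.mem_univ i)).trans (Nat.le_succ _)) k
      _ ≤ M * ‖w‖ * (1 / (2 * (M + 1))) := by rw [← Finset.sum_mul]; gcongr; exact hMw w
      _ = M / (M + 1) * (1 / 2 * ‖w‖) := by field_simp
      _ ≤ 1 * (1 / 2 * ‖w‖) := by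
          gcongr
          rw [div_le_one (by positivity)]; linarith
      _ = 1 / 2 * ‖w‖ := one_mul _
  choose D hD using hb
  let C₀ : ℝ := ∑ i ∈ Finset.range n₀, |D i|
  have hC₀ : 0 ≤ C₀ := Finset.sum_nonneg fun _ _ => abs_nonneg _
  have key : ∀ t s, s < n₀ → ∀ k w, ‖Λ (s + n₀ * t) k w‖ ≤ C₀ * (1 / 2) ^ t * ‖w‖ := by
    intro t
    induction t with
    | zero =>
      intro s hs k w
      rw [mul_zero, add_zero, pow_zero, mul_one]
      refine (hD s k w).trans ?_
      gcongr
      exact (le_abs_self _).trans (Finset.single_le_sum (f := fun i => |D i|)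
        (fun _ _ => abs_nonneg _) (Finset.mem_range.mpr hs))
    | succ t ih =>
      intro s hs k w
      obtain ⟨k', w', he, hw'⟩ := h1 (s + n₀ * t) n₀ k w
      rw [Nat.mul_succ, ← add_assoc, he]
      refine (ih s hs k' w').trans ?_
      have := hw' (1 / 2 * ‖w‖) (by positivity) fun i => hc i w
      calc C₀ * (1 / 2) ^ t * ‖w'‖ ≤ C₀ * (1 / 2) ^ t * (1 / 2 * ‖w‖) := by gcongr
        _ = C₀ * (1 / 2) ^ (t + 1) * ‖w‖ := by ring
  let q : ℝ := (1 / 2 : ℝ) ^ (1 / (n₀ : ℝ))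
  have hn₀' : (0 : ℝ) < n₀ := by exact_mod_cast hn₀
  have hq0 : 0 < q := by positivity
  have hq1 : q < 1 := Real.rpow_lt_one (by norm_num) (by norm_num) (by positivity)
  have hqn : q ^ n₀ = 1 / 2 := by
    rw [← Real.rpow_natCast, ← Real.rpow_mul (by norm_num), one_div_mul_cancel hn₀'.ne',
      Real.rpow_one]
  -- The factor 2 absorbs the remainder n % n₀, because q^{n % n₀} ≥ q^{n₀} = 1/2.
  refine ⟨2 * C₀, q, by positivity, ?_, hq1, fun n k w => ?_⟩
  · rw [← hqn]
    exact pow_le_of_le_one hq0.le hq1.le hn₀.ne'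
  · have h := key (n / n₀) (n % n₀) (Nat.mod_lt _ hn₀) k w
    rw [Nat.mod_add_div] at h
    refine h.trans ?_
    gcongr ?_ * _
    have h2 : q ^ n = q ^ (n % n₀) * (1 / 2) ^ (n / n₀) := by
      rw [← hqn, ← pow_mul, ← pow_add, Nat.mod_add_div]
    have h3 : 1 / 2 ≤ q ^ (n % n₀) := by
      rw [← hqn]
      exact pow_le_pow_of_le_one hq0.le hq1.le (Nat.mod_lt _ hn₀).le
    rw [h2]
    calc C₀ * (1 / 2) ^ (n / n₀) = 2 * C₀ * (1 / 2 * (1 / 2) ^ (n / n₀)) := by ring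
      _ ≤ 2 * C₀ * (q ^ (n % n₀) * (1 / 2) ^ (n / n₀)) := by gcongr

/-! ### Functions which vanish far away -/

theorem hasCompactSupport_of_forall_lt {E : Type*} [Zero E] {f : ℝ → E} {R : ℝ}
    (h : ∀ x, R < |x| → f x = 0) : HasCompactSupport f :=
  HasCompactSupport.intro (isCompact_Icc (a := -R) (b := R)) fun x hx => h x (by
    by_contra! hc; exact hx (abs_le.mp hc))

theorem exists_bound_of_forall_lt {f : ℝ → ℂ} {R : ℝ} (hf : Continuous f)
    (h : ∀ x, R < |x| → f x = 0) : ∃ C, 0 < C ∧ ∀ x, ‖f x‖ ≤ C := by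
  obtain ⟨C, hC⟩ := (hasCompactSupport_of_forall_lt h).exists_bound_of_continuous hf
  exact ⟨max C 1, lt_max_of_lt_right one_pos, fun x => (hC x).trans (le_max_left _ _)⟩

theorem exists_dist_le_of_forall_lt {f : ℝ → ℂ} {R : ℝ} (hf : Continuous f)
    (h : ∀ x, R < |x| → f x = 0) {ε : ℝ} (hε : 0 < ε) :
    ∃ δ > 0, ∀ x y, |x - y| < δ → ‖f x - f y‖ ≤ ε := by
  have hu := hf.uniformContinuous_of_tendsto_cocompact
    (hasCompactSupport_of_forall_lt h).is_zero_at_infty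
  obtain ⟨δ, hδ, h1⟩ := Metric.uniformContinuous_iff.mp hu ε hε
  exact ⟨δ, hδ, fun x y hxy => by
    have := h1 (a := x) (b := y) (by rwa [Real.dist_eq])
    rw [dist_eq_norm] at this
    exact this.le⟩

theorem iteratedDeriv_eq_zero_of_forall_lt {f : ℝ → ℂ} {R : ℝ} (h : ∀ x, R < |x| → f x = 0)
    (l : ℕ) : ∀ x, R < |x| → iteratedDeriv l f x = 0 := by
  intro x hx
  have h1 : f =ᶠ[𝓝 x] fun _ => 0 := by
    filter_upwards [(isOpen_lt continuous_const continuous_abs).mem_nhds hx] with y hy using h y hy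
  rw [h1.iteratedDeriv_eq]
  simp

theorem integral_eq_intervalIntegral_of_forall_lt {f : ℝ → ℂ} {R M : ℝ}
    (h : ∀ x, R < |x| → f x = 0) (hR : 0 ≤ R) (hM : R < M) : ∫ x, f x = ∫ x in (-M)..M, f x := by
  rw [intervalIntegral.integral_of_le (by linarith), setIntegral_eq_integral_of_forall_compl_eq_zero]
  intro x hx
  apply h
  by_contra! hc
  have := abs_le.mp hc
  exact hx ⟨by linarith, by linarith⟩

/-- Convergence of dyadic Riemann sums. -/
theorem tendsto_riemann_sum {f : ℝ → ℂ} (hf : Continuous f) {M : ℕ}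
    (h : ∀ x, (M : ℝ) < |x| → f x = 0) :
    Tendsto (fun n : ℕ => ((2 : ℂ) ^ n)⁻¹ * ∑ b ∈ Finset.Ico (-((M + 1) * 2 ^ n : ℤ)) ((M + 1) * 2 ^ n),
      f ((b : ℝ) / 2 ^ n)) atTop (𝓝 (∫ x, f x)) := by
  rw [Metric.tendsto_atTop]
  intro ε hε
  -- The interval of summation has length 2(M + 1), so this tolerance leaves a total error of ε/2.
  obtain ⟨δ, hδ, hu⟩ := exists_dist_le_of_forall_lt hf h (ε := ε / (2 * (2 * (M + 1)))) (by positivity)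
  obtain ⟨N, hN⟩ := exists_pow_lt_of_lt_one hδ (by norm_num : (1 / 2 : ℝ) < 1)
  refine ⟨N, fun n hn => ?_⟩
  have h2n : (0 : ℝ) < 2 ^ n := by positivity
  let T : ℕ := 2 * (M + 1) * 2 ^ n
  let x : ℕ → ℝ := fun k => -(M + 1) + k / 2 ^ n
  have hsum : ∑ b ∈ Finset.Ico (-((M + 1) * 2 ^ n : ℤ)) ((M + 1) * 2 ^ n), f ((b : ℝ) / 2 ^ n)
      = ∑ k ∈ Finset.range T, f (x k) := by
    symm
    refine Finset.sum_nbij' (fun k : ℕ => (k : ℤ) - (M + 1) * 2 ^ n)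
      (fun b : ℤ => (b + (M + 1) * 2 ^ n).toNat) ?_ ?_ ?_ ?_ ?_
    · intro k hk
      have hk' : (k : ℤ) < 2 * (M + 1) * 2 ^ n := by exact_mod_cast Finset.mem_range.mp hk
      rw [Finset.mem_Ico]
      constructor <;> linarith [(Nat.cast_nonneg k : (0 : ℤ) ≤ k)]
    · intro b hb
      rw [Finset.mem_Ico] at hb
      rw [Finset.mem_range, Int.toNat_lt (by linarith)]
      push_cast [T]
      linarith
    · intro k _; simp
    · intro b hb
      rw [Finset.mem_Ico] at hb
      rw [Int.toNat_of_nonneg (by linarith)]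
      ring
    · intro k _
      simp only [x]
      congr 1
      push_cast
      field_simp
      ring
  have hint : ∫ y, f y = ∑ k ∈ Finset.range T, ∫ y in x k..x (k + 1), f y := by
    rw [intervalIntegral.sum_integral_adjacent_intervals
      (fun k _ => hf.intervalIntegrable _ _),
      integral_eq_intervalIntegral_of_forall_lt h (Nat.cast_nonneg M) (lt_add_one (M : ℝ))]
    congr 1
    · simp [x]
    · simp only [x, T]; push_cast; field_simp; ring
  have hxs : ∀ k, x (k + 1) - x k = 1 / 2 ^ n := fun k => by
    simp only [x]; push_cast; field_simp; ring
  have hcell : ∀ k, ‖((2 : ℂ) ^ n)⁻¹ * f (x k) - ∫ y in x k..x (k + 1), f y‖ ≤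
      ε / (2 * (2 * (M + 1))) * (1 / 2 ^ n) := by
    intro k
    have h3 : ((2 : ℂ) ^ n)⁻¹ * f (x k) = ∫ y in x k..x (k + 1), f (x k) := by
      rw [intervalIntegral.integral_const, hxs, Complex.real_smul]
      push_cast; ring
    rw [h3, ← intervalIntegral.integral_sub (by simp) (hf.intervalIntegrable _ _)]
    refine (intervalIntegral.norm_integral_le_of_norm_le_const (C := ε / (2 * (2 * (M + 1))))
      fun y hy => ?_).trans ?_
    · rw [Set.uIoc_of_le (by have := hxs k; have : (0:ℝ) < 1 / 2 ^ n := by positivity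
                             linarith)] at hy
      refine hu _ _ ?_
      have h4 : |x k - y| ≤ (1 / 2) ^ n := by
        rw [abs_sub_comm, abs_of_nonneg (by linarith [hy.1]), _root_.one_div_pow]
        linarith [hy.2, hxs k]
      exact h4.trans_lt ((pow_le_pow_of_le_one (by norm_num) (by norm_num) hn).trans_lt hN)
    · rw [hxs, abs_of_nonneg (by positivity)]
  rw [hsum, hint, dist_eq_norm, Finset.mul_sum, ← Finset.sum_sub_distrib]
  calc _ ≤ ∑ k ∈ Finset.range T, ε / (2 * (2 * (M + 1))) * (1 / 2 ^ n) :=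
        norm_sum_le_of_le _ fun k _ => hcell k
    _ = ε / 2 := by
        rw [Finset.sum_const, Finset.card_range, nsmul_eq_mul]
        push_cast [T]
        field_simp
    _ < ε := by linarith

/-! ### Iterated differences -/

theorem contDiff_fwdDiff {G : ℝ → ℂ} {l : ℕ} (hG : ContDiff ℝ l G) (h : ℝ) :
    ContDiff ℝ l (fwdDiff h G) :=
  (hG.comp (contDiff_id.add contDiff_const)).sub hG

theorem iteratedDeriv_fwdDiff {G : ℝ → ℂ} {l : ℕ} (hG : ContDiff ℝ l G) (h : ℝ) :
    iteratedDeriv l (fwdDiff h G) = fwdDiff h (iteratedDeriv l G) := by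
  funext x
  have h1 : fwdDiff h G = (fun y => G (y + h)) - G := rfl
  have h2 : ContDiff ℝ l fun y => G (y + h) := hG.comp (contDiff_id.add contDiff_const)
  rw [h1, iteratedDeriv_sub h2.contDiffAt hG.contDiffAt, iteratedDeriv_comp_add_const]
  rfl

/-- One difference is absorbed at a time. If G^{(l+1)} is near c, then by the mean value inequality
the l-th derivative of the difference of G is near -hc, on an interval shortened by one step h. -/
theorem norm_iterate_fwdDiff_sub_le (l : ℕ) {G : ℝ → ℂ} (hG : ContDiff ℝ l G) {x h : ℝ} (hh : 0 ≤ h)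
    {c : ℂ} {ε : ℝ} (hc : ∀ y ∈ Set.Icc (x - l * h) x, ‖iteratedDeriv l G y - c‖ ≤ ε) :
    ‖(fwdDiff (-h))^[l] G x - (-h) ^ l * c‖ ≤ h ^ l * ε := by
  induction l generalizing G c ε with
  | zero =>
    have := hc x ⟨by simp, le_rfl⟩
    simpa using this
  | succ l ih =>
    rw [Function.iterate_succ_apply]
    have hG1 : ContDiff ℝ l G := hG.of_le (by norm_cast; omega)
    have h1 := ih (contDiff_fwdDiff hG1 (-h)) (c := (-h) * c) (ε := h * ε) ?_
    · rw [pow_succ, pow_succ, mul_assoc, mul_assoc]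
      exact h1
    · intro y hy
      rw [iteratedDeriv_fwdDiff hG1, fwdDiff]
      have hd : ∀ z, HasDerivAt (iteratedDeriv l G) (iteratedDeriv (l + 1) G z) z := by
        intro z
        rw [iteratedDeriv_succ]
        exact ((hG.differentiable_iteratedDeriv l (by norm_cast; omega)) z).hasDerivAt
      have hd2 : ∀ z, HasDerivAt (fun z : ℝ => iteratedDeriv l G z - z * c)
          (iteratedDeriv (l + 1) G z - c) z := by
        intro z
        have h3 := (hd z).sub ((Complex.ofRealCLM.hasDerivAt (x := z)).mul_const c)
        rw [Complex.ofRealCLM_apply, Complex.ofReal_one, one_mul] at h3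
        exact h3
      have h2 := (convex_Icc (y + -h) y).norm_image_sub_le_of_norm_hasDerivWithin_le (C := ε)
        (fun z _ => (hd2 z).hasDerivWithinAt) (fun z hz => hc z ⟨?_, hz.2.trans hy.2⟩)
        (Set.right_mem_Icc.mpr (by linarith)) (Set.left_mem_Icc.mpr (by linarith))
      · have h3 : ‖y + -h - y‖ = h := by
          rw [Real.norm_eq_abs, add_sub_cancel_left, abs_neg, abs_of_nonneg hh]
        rw [h3, mul_comm ε] at h2
        refine le_of_eq_of_le (congrArg norm ?_) h2
        push_cast
        ring
      · push_cast
        linarith [hy.1, hz.1]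

theorem norm_iterate_fwdDiff_le {G : ℝ → ℂ} {C : ℝ} (hG : ∀ x, ‖G x‖ ≤ C) (h : ℝ) (i : ℕ) (x : ℝ) :
    ‖(fwdDiff h)^[i] G x‖ ≤ 2 ^ i * C := by
  induction i generalizing G C with
  | zero => simpa using hG x
  | succ i ih =>
    rw [Function.iterate_succ_apply, pow_succ, mul_assoc]
    exact ih fun x => (norm_sub_le _ _).trans (by linarith [hG (x + h), hG x])

/-- Divided differences converge uniformly to derivatives. -/
theorem exists_norm_iterate_fwdDiff_sub_le {G : ℝ → ℂ} {l : ℕ} {R : ℝ} (hG : ContDiff ℝ l G)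
    (hR : ∀ x, R < |x| → G x = 0) {ε : ℝ} (hε : 0 < ε) :
    ∃ δ > 0, ∀ h, 0 ≤ h → h < δ → ∀ x,
      ‖(fwdDiff (-h))^[l] G x - (-h) ^ l * iteratedDeriv l G x‖ ≤ h ^ l * ε := by
  obtain ⟨δ, hδ, hu⟩ := exists_dist_le_of_forall_lt (hG.continuous_iteratedDeriv l le_rfl)
    (iteratedDeriv_eq_zero_of_forall_lt hR l) hε
  refine ⟨δ / (l + 1), by positivity, fun h hh hhδ x => ?_⟩
  refine norm_iterate_fwdDiff_sub_le l hG hh fun y hy => hu _ _ ?_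
  rw [lt_div_iff₀ (by positivity)] at hhδ
  rw [abs_lt]
  constructor <;> nlinarith [hy.1, hy.2]

/-- Divided differences of too high order converge uniformly to zero. -/
theorem exists_norm_iterate_fwdDiff_le {G : ℝ → ℂ} {l i : ℕ} {R : ℝ} (hG : ContDiff ℝ l G)
    (hR : ∀ x, R < |x| → G x = 0) (hi : l < i) {ε : ℝ} (hε : 0 < ε) :
    ∃ δ > 0, ∀ h, 0 ≤ h → h < δ → ∀ x, ‖(fwdDiff (-h))^[i] G x‖ ≤ h ^ l * ε := by
  -- The order is i = l + p + 1. The difference of order l + 1 is already o(h^l) by uniform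
  -- continuity of G^{(l)}, and each of the p further differences costs at most a factor 2.
  obtain ⟨p, rfl⟩ := Nat.exists_eq_add_of_lt hi
  have hε' : 0 < ε / (3 * 2 ^ p) := by positivity
  obtain ⟨δ₁, hδ₁, h1⟩ := exists_norm_iterate_fwdDiff_sub_le hG hR hε'
  obtain ⟨δ₂, hδ₂, h2⟩ := exists_dist_le_of_forall_lt (hG.continuous_iteratedDeriv l le_rfl)
    (iteratedDeriv_eq_zero_of_forall_lt hR l) hε'
  refine ⟨min δ₁ δ₂, lt_min hδ₁ hδ₂, fun h hh hhδ x => ?_⟩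
  have h3 : ∀ y, ‖(fwdDiff (-h))^[l + 1] G y‖ ≤ h ^ l * (ε / 2 ^ p) := by
    intro y
    rw [Function.iterate_succ_apply', fwdDiff]
    have e1 := h1 h hh (hhδ.trans_le (min_le_left _ _)) (y + -h)
    have e2 := h1 h hh (hhδ.trans_le (min_le_left _ _)) y
    have e3 := h2 (y + -h) y (by
      rw [add_sub_cancel_left, abs_neg, abs_of_nonneg hh]
      exact hhδ.trans_le (min_le_right _ _))
    have e4 : ‖(-(h : ℂ)) ^ l * (iteratedDeriv l G (y + -h) - iteratedDeriv l G y)‖ ≤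
        h ^ l * (ε / (3 * 2 ^ p)) := by
      rw [norm_mul, norm_pow, norm_neg, Complex.norm_real, Real.norm_of_nonneg hh]
      gcongr
    calc _ = ‖((fwdDiff (-h))^[l] G (y + -h) - (-h) ^ l * iteratedDeriv l G (y + -h))
          - ((fwdDiff (-h))^[l] G y - (-h) ^ l * iteratedDeriv l G y)
          + (-(h : ℂ)) ^ l * (iteratedDeriv l G (y + -h) - iteratedDeriv l G y)‖ := by
          congr 1; ring
      _ ≤ h ^ l * (ε / (3 * 2 ^ p)) + h ^ l * (ε / (3 * 2 ^ p)) + h ^ l * (ε / (3 * 2 ^ p)) :=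
          (norm_add_le _ _).trans (add_le_add ((norm_sub_le _ _).trans (add_le_add e1 e2)) e4)
      _ = h ^ l * (ε / 2 ^ p) := by field_simp; norm_num
  have h4 := norm_iterate_fwdDiff_le h3 (-h) p x
  rw [← Function.iterate_add_apply] at h4
  rw [show l + p + 1 = p + (l + 1) by ring]
  refine h4.trans (le_of_eq ?_)
  field_simp

/-! ### Compactly supported distributions -/

/-- A smooth function equal to `1` on `[-(|R| + 1), |R| + 1]` and to `0` off
`[-(|R| + 2), |R| + 2]`. -/
def cutBump (R : ℝ) : ContDiffBump (0 : ℝ) := ⟨|R| + 1, |R| + 2, by positivity, by linarith⟩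

theorem contDiff_cutBump (R : ℝ) : ContDiff ℝ (⊤ : ℕ∞) (fun x : ℝ => ((cutBump R x : ℝ) : ℂ)) :=
  Complex.ofRealCLM.contDiff.comp (cutBump R).contDiff

theorem cutBump_eq_one {R x : ℝ} (hx : |x| ≤ |R| + 1) : cutBump R x = 1 :=
  (cutBump R).one_of_mem_closedBall (by
    rw [mem_closedBall_zero_iff, Real.norm_eq_abs]; exact hx)

theorem cutBump_eq_zero {R x : ℝ} (hx : |R| + 2 < |x|) : ((cutBump R x : ℝ) : ℂ) = 0 := by
  rw [(cutBump R).zero_of_le_dist (by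
    rw [dist_zero_right, Real.norm_eq_abs]; exact hx.le), Complex.ofReal_zero]

/-- The cut-off of a smooth function. -/
def cut (R : ℝ) (h : ℝ → ℂ) (hh : ContDiff ℝ (⊤ : ℕ∞) h) : 𝓢(ℝ, ℂ) :=
  HasCompactSupport.toSchwartzMap (f := fun x => ((cutBump R x : ℝ) : ℂ) * h x)
    (hasCompactSupport_of_forall_lt (R := |R| + 2) fun x hx => by
      rw [cutBump_eq_zero hx, zero_mul])
    ((contDiff_cutBump R).mul hh)

theorem cut_apply (R : ℝ) (h : ℝ → ℂ) (hh : ContDiff ℝ (⊤ : ℕ∞) h) (x : ℝ) :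
    cut R h hh x = ((cutBump R x : ℝ) : ℂ) * h x := rfl

theorem SupportedIn.apply_eq {T : 𝓢'(ℝ, ℂ)} {R : ℝ} (hT : SupportedIn T R) {g₁ g₂ : 𝓢(ℝ, ℂ)}
    (h : ∀ x, |x| < |R| + 1 → g₁ x = g₂ x) : T g₁ = T g₂ := by
  have h0 : T (g₁ - g₂) = 0 := by
    apply hT
    intro x hx hxR
    have hx1 : |x| < |R| + 1 := by
      rw [abs_lt]
      constructor <;> linarith [hxR.1, hxR.2, le_abs_self R]
    refine notMem_tsupport_iff_eventuallyEq.mpr ?_ hx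
    filter_upwards [(isOpen_lt continuous_abs continuous_const).mem_nhds hx1] with y hy
    simp [h y hy]
  rw [map_sub] at h0
  exact sub_eq_zero.mp h0

theorem SupportedIn.apply_cut {T : 𝓢'(ℝ, ℂ)} {R : ℝ} (hT : SupportedIn T R) (g : 𝓢(ℝ, ℂ)) :
    T (cut R g (g.smooth _)) = T g :=
  hT.apply_eq fun x hx => by rw [cut_apply, cutBump_eq_one hx.le]; simp

theorem contDiff_cexp_mul (z : ℂ) : ContDiff ℝ (⊤ : ℕ∞) fun x : ℝ => Complex.exp (z * x) :=
  (contDiff_const.mul Complex.ofRealCLM.contDiff).cexp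

theorem SupportedIn.fourierFn_eq_cut {T : 𝓢'(ℝ, ℂ)} {R : ℝ} (hT : SupportedIn T R) (ξ : ℝ) :
    fourierFn T ξ = T (cut R _ (contDiff_cexp_mul (-Complex.I * ξ))) := by
  refine fourierFn_eq ⟨R, hT, fun x hx => ?_⟩
  have hx1 : |x| ≤ |R| + 1 := by
    rw [abs_le]
    constructor <;> linarith [hx.1, hx.2, le_abs_self R]
  rw [cut_apply, cutBump_eq_one hx1, Complex.ofReal_one, one_mul]
  congr 1; ring

theorem SupportedIn.mono {T : 𝓢'(ℝ, ℂ)} {R R' : ℝ} (hT : SupportedIn T R) (h : R ≤ R') :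
    SupportedIn T R' :=
  Distribution.IsVanishingOn.mono
    (Set.compl_subset_compl.mpr (Set.Icc_subset_Icc (neg_le_neg h) h)) hT

/-- By the Leibniz rule the function h enters only through its derivatives on the support of the
fixed cut-off. The free bound N ≥ n allows one N to serve finitely many seminorms at once. -/
theorem exists_seminorm_cut_le (R : ℝ) (k n : ℕ) : ∃ C, 0 ≤ C ∧ ∀ (h : ℝ → ℂ)
    (hh : ContDiff ℝ (⊤ : ℕ∞) h) (N : ℕ) (_ : n ≤ N) (ε : ℝ) (_ : 0 ≤ ε),
    (∀ j ≤ N, ∀ x, |x| ≤ |R| + 2 → ‖iteratedDeriv j h x‖ ≤ ε) →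
    SchwartzMap.seminorm ℂ k n (cut R h hh) ≤ C * ε := by
  have hb : ∀ i, ∃ C, 0 < C ∧ ∀ x,
      ‖iteratedDeriv i (fun x : ℝ => ((cutBump R x : ℝ) : ℂ)) x‖ ≤ C := fun i =>
    exists_bound_of_forall_lt ((contDiff_cutBump R).continuous_iteratedDeriv i (by exact_mod_cast le_top))
      (iteratedDeriv_eq_zero_of_forall_lt (fun x hx => cutBump_eq_zero hx) i)
  choose D hD hD' using hb
  refine ⟨(|R| + 2) ^ k * ∑ i ∈ Finset.range (n + 1), (n.choose i : ℝ) * D i,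
    mul_nonneg (by positivity) (Finset.sum_nonneg fun i _ => mul_nonneg (by positivity) (hD i).le),
    fun h hh N hN ε hε hj => ?_⟩
  refine SchwartzMap.seminorm_le_bound' ℂ k n _ (mul_nonneg (mul_nonneg (by positivity)
    (Finset.sum_nonneg fun i _ => mul_nonneg (by positivity) (hD i).le)) hε) fun x => ?_
  by_cases hx : |x| ≤ |R| + 2
  · rw [mul_assoc]
    refine mul_le_mul (pow_le_pow_left₀ (abs_nonneg _) hx _) ?_ (norm_nonneg _) (by positivity)
    have h1 := norm_iteratedFDeriv_mul_le (𝕜 := ℝ) (contDiff_cutBump R) hh x (n := n)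
      (by exact_mod_cast le_top)
    simp only [norm_iteratedFDeriv_eq_norm_iteratedDeriv] at h1
    refine h1.trans ?_
    rw [Finset.sum_mul]
    refine Finset.sum_le_sum fun i hi => ?_
    gcongr
    · have := hD i; positivity
    · exact hD' i x
    · exact hj _ (by omega) x hx
  · have h0 : iteratedDeriv n (cut R h hh) x = 0 :=
      iteratedDeriv_eq_zero_of_forall_lt (R := |R| + 2)
        (fun y hy => by rw [cut_apply, cutBump_eq_zero hy, zero_mul]) n x (not_le.mp hx)
    rw [h0, norm_zero, mul_zero]
    exact mul_nonneg (mul_nonneg (by positivity)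
      (Finset.sum_nonneg fun i _ => mul_nonneg (by positivity) (hD i).le)) hε

/-- A distribution is of finite order on cut-offs. -/
theorem exists_norm_apply_cut_le (T : 𝓢'(ℝ, ℂ)) (R : ℝ) : ∃ (N : ℕ) (C : ℝ), 0 ≤ C ∧
    ∀ (h : ℝ → ℂ) (hh : ContDiff ℝ (⊤ : ℕ∞) h) (ε : ℝ) (_ : 0 ≤ ε),
    (∀ j ≤ N, ∀ x, |x| ≤ |R| + 2 → ‖iteratedDeriv j h x‖ ≤ ε) → ‖T (cut R h hh)‖ ≤ C * ε := by
  have hc : Continuous fun g : 𝓢(ℝ, ℂ) => T g := T.continuous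
  let q : Seminorm ℂ 𝓢(ℝ, ℂ) := (normSeminorm ℂ ℂ).comp T.toLinearMap
  obtain ⟨s, C, _, hs⟩ := Seminorm.bound_of_continuous (schwartz_withSeminorms ℂ ℝ ℂ) q hc.norm
  choose D hD0 hD using fun p : ℕ × ℕ => exists_seminorm_cut_le R p.1 p.2
  refine ⟨s.sup Prod.snd, C * ∑ p ∈ s, D p,
    mul_nonneg C.2 (Finset.sum_nonneg fun p _ => hD0 p), fun h hh ε hε hj => ?_⟩
  have h1 : ‖T (cut R h hh)‖ ≤ C * (s.sup (schwartzSeminormFamily ℂ ℝ ℂ)) (cut R h hh) := hs _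
  have h2 : (s.sup (schwartzSeminormFamily ℂ ℝ ℂ)) (cut R h hh) ≤ (∑ p ∈ s, D p) * ε := by
    refine Seminorm.finset_sup_apply_le
      (mul_nonneg (Finset.sum_nonneg fun p _ => hD0 p) hε) fun p hp => ?_
    refine (hD p h hh _ (Finset.le_sup (f := Prod.snd) hp) ε hε hj).trans ?_
    gcongr
    exact Finset.single_le_sum (f := D) (fun p _ => hD0 p) hp
  rw [mul_assoc]
  exact h1.trans (mul_le_mul_of_nonneg_left h2 C.2)

/-- The remainder of the Taylor polynomial of the exponential function. -/
def expRem (k : ℕ) (z : ℂ) (x : ℝ) : ℂ :=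
  Complex.exp (z * x) - ∑ i ∈ Finset.range k, (z * x) ^ i / i.factorial

theorem contDiff_expRem (k : ℕ) (z : ℂ) : ContDiff ℝ (⊤ : ℕ∞) (expRem k z) :=
  (contDiff_cexp_mul z).sub (ContDiff.sum fun i _ =>
    ((contDiff_const.mul Complex.ofRealCLM.contDiff).pow i).div_const _)

/-- Truncated subtraction gives the right formula for k = 0 as well, where the remainder is the
exponential itself. -/
theorem hasDerivAt_expRem (k : ℕ) (z : ℂ) (x : ℝ) :
    HasDerivAt (expRem k z) (z * expRem (k - 1) z x) x := by
  have h1 : HasDerivAt (fun x : ℝ => z * (x : ℂ)) z x := by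
    simpa using (Complex.ofRealCLM.hasDerivAt (x := x)).const_mul z
  have h2 : HasDerivAt (fun x : ℝ => ∑ i ∈ Finset.range k, (z * (x : ℂ)) ^ i / (i.factorial : ℂ))
      (z * ∑ i ∈ Finset.range (k - 1), (z * (x : ℂ)) ^ i / (i.factorial : ℂ)) x := by
    cases k with
    | zero => simpa using hasDerivAt_const x (0 : ℂ)
    | succ k =>
      simp only [Finset.sum_range_succ' _ k, Nat.add_sub_cancel, pow_zero]
      refine HasDerivAt.add_const _ ?_
      rw [Finset.mul_sum]
      refine HasDerivAt.fun_sum fun i _ => ?_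
      have h3 := (h1.pow (i + 1)).div_const ((i + 1).factorial : ℂ)
      refine h3.congr_deriv ?_
      rw [Nat.factorial_succ, Nat.add_sub_cancel]
      push_cast
      have : (i.factorial : ℂ) ≠ 0 := by exact_mod_cast i.factorial_ne_zero
      have : (i : ℂ) + 1 ≠ 0 := by exact_mod_cast i.succ_ne_zero
      field_simp
  refine (h1.cexp.sub h2).congr_deriv ?_
  rw [expRem]; ring

theorem iteratedDeriv_expRem (j k : ℕ) (z : ℂ) :
    iteratedDeriv j (expRem k z) = fun x => z ^ j * expRem (k - j) z x := by
  induction j with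
  | zero => simp
  | succ j ih =>
    rw [iteratedDeriv_succ, ih]
    funext x
    rw [((hasDerivAt_expRem (k - j) z x).const_mul (z ^ j)).deriv, Nat.sub_sub]
    ring

/-- Each derivative of the remainder brings out a factor ξ and lowers its order by one, so every
derivative is O(|ξ|^k). For derivatives of order above k this uses |ξ| ≤ 1. -/
theorem exists_norm_apply_cut_expRem_le (T : 𝓢'(ℝ, ℂ)) (R : ℝ) (k : ℕ) : ∃ K, ∀ ξ : ℝ, |ξ| ≤ 1 →
    ‖T (cut R _ (contDiff_expRem k (-Complex.I * ξ)))‖ ≤ K * |ξ| ^ k := by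
  obtain ⟨N, C, hC, hT⟩ := exists_norm_apply_cut_le T R
  refine ⟨C * ((|R| + 2) ^ k * Real.exp (|R| + 2)), fun ξ hξ => ?_⟩
  rw [mul_assoc]
  refine hT _ _ _ (by positivity) fun j _ x hx => ?_
  have hz : ‖-Complex.I * (ξ : ℂ)‖ = |ξ| := by simp
  rw [iteratedDeriv_expRem, norm_mul, norm_pow, hz]
  have h1 := Complex.norm_exp_sub_sum_le_norm_mul_exp (-Complex.I * ξ * x) (k - j)
  rw [norm_mul, hz, Complex.norm_real, Real.norm_eq_abs] at h1
  have h2 : |ξ| * |x| ≤ |R| + 2 := by nlinarith [abs_nonneg x, abs_nonneg ξ]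
  have hL : 1 ≤ |R| + 2 := by linarith [abs_nonneg R]
  calc |ξ| ^ j * ‖expRem (k - j) (-Complex.I * ξ) x‖
      ≤ |ξ| ^ j * ((|ξ| * (|R| + 2)) ^ (k - j) * Real.exp (|R| + 2)) := by
        gcongr
        refine h1.trans ?_
        gcongr
    _ = |ξ| ^ (j + (k - j)) * (|R| + 2) ^ (k - j) * Real.exp (|R| + 2) := by
        rw [mul_pow, pow_add]; ring
    _ ≤ |ξ| ^ k * (|R| + 2) ^ k * Real.exp (|R| + 2) := by
        gcongr ?_ * ?_ * _
        · exact pow_le_pow_of_le_one (abs_nonneg _) hξ (by omega)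
        · exact pow_le_pow_right₀ hL (Nat.sub_le _ _)
    _ = (|R| + 2) ^ k * Real.exp (|R| + 2) * |ξ| ^ k := by ring

theorem tendsto_fourierFn {T : 𝓢'(ℝ, ℂ)} (hT : IsCompactlySupported T) :
    Tendsto (fourierFn T) (𝓝 0) (𝓝 (fourierFn T 0)) := by
  obtain ⟨R, hR⟩ := hT
  obtain ⟨K, hK⟩ := exists_norm_apply_cut_expRem_le T R 1
  rw [tendsto_iff_norm_sub_tendsto_zero]
  have h1 : Tendsto (fun ξ : ℝ => K * |ξ| ^ 1) (𝓝 0) (𝓝 0) := by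
    have : Continuous fun ξ : ℝ => K * |ξ| ^ 1 := by fun_prop
    simpa using this.tendsto 0
  refine squeeze_zero' (Eventually.of_forall fun _ => norm_nonneg _) ?_ h1
  have h2 : ∀ᶠ ξ : ℝ in 𝓝 0, |ξ| ≤ 1 := by
    filter_upwards [Metric.closedBall_mem_nhds (0 : ℝ) one_pos] with ξ hξ
    simpa using hξ
  filter_upwards [h2] with ξ hξ
  refine le_of_eq_of_le (congrArg norm ?_) (hK ξ hξ)
  rw [hR.fourierFn_eq_cut, hR.fourierFn_eq_cut, ← map_sub]
  congr 1
  ext x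
  simp [cut_apply, expRem]
  ring

theorem contDiff_ofReal_pow (k : ℕ) : ContDiff ℝ (⊤ : ℕ∞) fun x : ℝ => (x : ℂ) ^ k :=
  Complex.ofRealCLM.contDiff.pow k

/-- Once the pairings with lower powers are known to vanish, the pairing with the Taylor remainder
of order k + 1 equals -(-iξ)^k/k! times the pairing with x^k. It is also O(|ξ|^{k+1}); dividing by
ξ^k and letting ξ tend to 0 gives the claim. -/
theorem apply_cut_pow_eq_zero {T : 𝓢'(ℝ, ℂ)} {R : ℝ}
    (h : ∀ ξ : ℝ, T (cut R _ (contDiff_cexp_mul (-Complex.I * ξ))) = 0) (k : ℕ) :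
    T (cut R _ (contDiff_ofReal_pow k)) = 0 := by
  induction k using Nat.strong_induction_on with
  | _ k ih =>
    obtain ⟨K, hK⟩ := exists_norm_apply_cut_expRem_le T R (k + 1)
    have h1 : ∀ ξ : ℝ, T (cut R _ (contDiff_expRem (k + 1) (-Complex.I * ξ))) =
        -((-Complex.I * ξ) ^ k / k.factorial * T (cut R _ (contDiff_ofReal_pow k))) := by
      intro ξ
      have h2 : cut R _ (contDiff_expRem (k + 1) (-Complex.I * ξ)) =
          cut R _ (contDiff_cexp_mul (-Complex.I * ξ)) - ∑ i ∈ Finset.range (k + 1),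
            ((-Complex.I * ξ) ^ i / i.factorial) • cut R _ (contDiff_ofReal_pow i) := by
        ext x
        simp only [_root_.sub_apply, _root_.sum_apply, _root_.smul_apply, cut_apply,
          expRem, mul_sub, Finset.mul_sum, smul_eq_mul]
        congr 1
        refine Finset.sum_congr rfl fun i _ => ?_
        rw [mul_pow]; ring
      rw [h2, map_sub, h, zero_sub, map_sum, Finset.sum_range_succ, Finset.sum_eq_zero, zero_add,
        map_smul, smul_eq_mul]
      intro i hi
      rw [map_smul, ih i (Finset.mem_range.mp hi), smul_zero]
    by_contra hne
    have hpos : 0 < ‖T (cut R _ (contDiff_ofReal_pow k))‖ := norm_pos_iff.mpr hne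
    have h3 : ∀ ξ : ℝ, 0 < ξ → ξ ≤ 1 →
        ‖T (cut R _ (contDiff_ofReal_pow k))‖ ≤ K * k.factorial * ξ := by
      intro ξ h0 hξ
      have h4 := hK ξ (by rwa [abs_of_pos h0])
      rw [h1, norm_neg, norm_mul, norm_div, norm_pow, norm_mul, norm_neg, Complex.norm_I, one_mul,
        Complex.norm_real, Real.norm_of_nonneg h0.le, abs_of_pos h0, Complex.norm_natCast,
        div_mul_eq_mul_div, div_le_iff₀ (by positivity), pow_succ] at h4
      have h5 : 0 < ξ ^ k := by positivity
      nlinarith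
    have h6 : Tendsto (fun ξ : ℝ => K * k.factorial * ξ) (𝓝[>] 0) (𝓝 0) := by
      have : Continuous fun ξ : ℝ => K * k.factorial * ξ := by fun_prop
      simpa using (this.tendsto 0).mono_left nhdsWithin_le_nhds
    have h7 := ge_of_tendsto h6 (by
      filter_upwards [Ioc_mem_nhdsGT (one_pos : (0 : ℝ) < 1)] with ξ hξ using h3 ξ hξ.1 hξ.2)
    linarith

/-! ### Polynomial approximation with derivatives, and uniqueness of the Fourier transform. -/

theorem exists_derivative_eq (Q : Polynomial ℂ) : ∃ P : Polynomial ℂ, P.derivative = Q := by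
  induction Q using Polynomial.induction_on' with
  | add p q hp hq =>
    obtain ⟨P, rfl⟩ := hp
    obtain ⟨Q, rfl⟩ := hq
    exact ⟨P + Q, by simp⟩
  | monomial n c =>
    refine ⟨Polynomial.monomial (n + 1) (c / (n + 1)), ?_⟩
    have : (n : ℂ) + 1 ≠ 0 := by exact_mod_cast n.succ_ne_zero
    rw [Polynomial.derivative_monomial, Nat.add_sub_cancel]
    congr 1
    push_cast
    field_simp

theorem hasDerivAt_polynomial (P : Polynomial ℂ) (x : ℝ) :
    HasDerivAt (fun x : ℝ => P.eval (x : ℂ)) (P.derivative.eval (x : ℂ)) x := by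
  simpa using (P.hasDerivAt (x : ℂ)).comp_ofReal

theorem contDiff_polynomial (P : Polynomial ℂ) : ContDiff ℝ (⊤ : ℕ∞) fun x : ℝ => P.eval (x : ℂ) := by
  simp only [Polynomial.eval_eq_sum, Polynomial.sum]
  exact ContDiff.sum fun i _ => contDiff_const.mul (contDiff_ofReal_pow i)

/-- Simultaneous approximation of derivatives by polynomials. -/
theorem exists_polynomial_near (N : ℕ) {g : ℝ → ℂ} (hg : ContDiff ℝ N g) {L ε : ℝ} (hL : 0 ≤ L)
    (hε : 0 < ε) : ∃ P : Polynomial ℂ, ∀ j ≤ N, ∀ x, |x| ≤ L →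
      ‖iteratedDeriv j (fun x : ℝ => g x - P.eval (x : ℂ)) x‖ ≤ ε := by
  induction N generalizing g ε with
  | zero =>
    have hgc := hg.continuous
    obtain ⟨p, hp⟩ := exists_polynomial_near_of_continuousOn (-L) L (fun x => (g x).re)
      (Complex.continuous_re.comp hgc).continuousOn (ε / 2) (by positivity)
    obtain ⟨q, hq⟩ := exists_polynomial_near_of_continuousOn (-L) L (fun x => (g x).im)
      (Complex.continuous_im.comp hgc).continuousOn (ε / 2) (by positivity)
    refine ⟨p.map Complex.ofRealHom + Polynomial.C Complex.I * q.map Complex.ofRealHom,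
      fun j hj x hx => ?_⟩
    have hxI : x ∈ Set.Icc (-L) L := abs_le.mp hx
    obtain rfl : j = 0 := by omega
    have he : ∀ s : Polynomial ℝ, (s.map Complex.ofRealHom).eval (x : ℂ) = ((s.eval x : ℝ) : ℂ) := by
      intro s
      rw [Polynomial.eval_map]
      exact Polynomial.eval₂_at_apply Complex.ofRealHom x
    rw [iteratedDeriv_zero, Polynomial.eval_add, Polynomial.eval_mul, Polynomial.eval_C, he, he]
    have h1 : g x - (((p.eval x : ℝ) : ℂ) + Complex.I * ((q.eval x : ℝ) : ℂ)) =
        -(((p.eval x - (g x).re : ℝ) : ℂ) + Complex.I * ((q.eval x - (g x).im : ℝ) : ℂ)) := by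
      conv_lhs => rw [← Complex.re_add_im (g x)]
      push_cast; ring
    rw [h1, norm_neg]
    refine (norm_add_le _ _).trans ?_
    rw [norm_mul, Complex.norm_I, one_mul, Complex.norm_real, Complex.norm_real, Real.norm_eq_abs,
      Real.norm_eq_abs]
    linarith [hp x hxI, hq x hxI]
  | succ N ih =>
    have hd : ContDiff ℝ N (deriv g) := (contDiff_succ_iff_deriv.mp (by exact_mod_cast hg)).2.2
    have hgd : Differentiable ℝ g := hg.differentiable (by norm_cast)
    -- Approximate the derivative and integrate, matching the value at 0. On [-L, L] integration
    -- costs a factor at most L, which the tolerance ε/(L + 1) absorbs.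
    obtain ⟨Q, hQ⟩ := ih hd (ε := ε / (L + 1)) (by positivity)
    obtain ⟨P₀, hP₀⟩ := exists_derivative_eq Q
    let P := P₀ + Polynomial.C (g 0 - P₀.eval 0)
    have hP : P.derivative = Q := by simp [P, hP₀]
    have hD : ∀ x : ℝ, HasDerivAt (fun x : ℝ => g x - P.eval (x : ℂ)) (deriv g x - Q.eval (x : ℂ)) x :=
      fun x => hP ▸ (hgd x).hasDerivAt.sub (hasDerivAt_polynomial P x)
    have hε' : ε / (L + 1) ≤ ε := div_le_self hε.le (by linarith)
    refine ⟨P, fun j hj x hx => ?_⟩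
    cases j with
    | zero =>
      have h1 := (convex_Icc (-L) L).norm_image_sub_le_of_norm_hasDerivWithin_le (C := ε / (L + 1))
        (fun z _ => (hD z).hasDerivWithinAt) (fun z hz => by
          simpa using hQ 0 (Nat.zero_le _) z (abs_le.mpr hz))
        (⟨by linarith, hL⟩ : (0 : ℝ) ∈ Set.Icc (-L) L) (abs_le.mp hx : x ∈ Set.Icc (-L) L)
      have h2 : g 0 - P.eval ((0 : ℝ) : ℂ) = 0 := by simp [P]
      rw [h2, sub_zero, sub_zero, Real.norm_eq_abs] at h1
      rw [iteratedDeriv_zero]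
      refine h1.trans ?_
      rw [div_mul_eq_mul_div, div_le_iff₀ (by linarith)]
      nlinarith
    | succ j =>
      rw [iteratedDeriv_succ', funext fun x => (hD x).deriv]
      exact (hQ j (by omega) x hx).trans hε'

/-- A compactly supported distribution whose Fourier transform vanishes is zero. -/
theorem eq_zero_of_fourierFn_eq_zero {T : 𝓢'(ℝ, ℂ)} (hT : IsCompactlySupported T)
    (h : ∀ ξ, fourierFn T ξ = 0) (g : 𝓢(ℝ, ℂ)) : T g = 0 := by
  obtain ⟨R, hR⟩ := hT
  have hpow := apply_cut_pow_eq_zero (T := T) (R := R) fun ξ => by rw [← hR.fourierFn_eq_cut, h]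
  have hpoly : ∀ P : Polynomial ℂ, T (cut R _ (contDiff_polynomial P)) = 0 := by
    intro P
    have h1 : cut R _ (contDiff_polynomial P) =
        ∑ i ∈ P.support, P.coeff i • cut R _ (contDiff_ofReal_pow i) := by
      ext x
      simp only [_root_.sum_apply, _root_.smul_apply, cut_apply, smul_eq_mul,
        Polynomial.eval_eq_sum, Polynomial.sum, Finset.mul_sum]
      refine Finset.sum_congr rfl fun i _ => by ring
    rw [h1, map_sum]
    exact Finset.sum_eq_zero fun i _ => by rw [map_smul, hpow, smul_zero]
  obtain ⟨N, C, hC, hT⟩ := exists_norm_apply_cut_le T R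
  rw [← norm_le_zero_iff]
  refine le_of_forall_pos_le_add fun ε hε => ?_
  obtain ⟨P, hP⟩ := exists_polynomial_near N (g.smooth N) (L := |R| + 2) (ε := ε / (C + 1))
    (by positivity) (by positivity)
  -- Since T kills polynomials, g may be replaced by g - P, whose derivatives up to the order of T
  -- are as small as desired.
  have h2 : T g = T (cut R (fun x : ℝ => g x - P.eval (x : ℂ))
      ((g.smooth _).sub (contDiff_polynomial P))) := by
    rw [← hR.apply_cut g, ← sub_zero (T _), ← hpoly P, ← map_sub]
    congr 1
    ext x
    simp only [_root_.sub_apply, cut_apply]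
    ring
  rw [h2, zero_add]
  refine (hT _ _ _ (by positivity) hP).trans ?_
  rw [mul_div_assoc', div_le_iff₀ (by positivity)]
  nlinarith

/-- A compactly supported distribution is determined by its Fourier transform. -/
theorem isGivenBy_of_fourierFn_eq {T : 𝓢'(ℝ, ℂ)} (hT : IsCompactlySupported T) {f : ℝ → ℂ} {R : ℝ}
    (hf : Continuous f) (hR : ∀ x, R < |x| → f x = 0)
    (h : ∀ ξ : ℝ, fourierFn T ξ = ∫ x, f x * Complex.exp (-(Complex.I * (x : ℂ) * (ξ : ℂ)))) :
    IsGivenBy T f := by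
  have hfc := hasCompactSupport_of_forall_lt hR
  have hfL : MemLp f 1 volume := hf.memLp_of_hasCompactSupport hfc
  -- The function is regarded as a distribution U, so that uniqueness can be applied to T - U.
  let U : 𝓢'(ℝ, ℂ) := Lp.toTemperedDistribution (hfL.toLp f)
  have hU : ∀ g : 𝓢(ℝ, ℂ), U g = ∫ x, f x * g x := by
    intro g
    rw [Lp.toTemperedDistribution_apply]
    refine integral_congr_ae ?_
    filter_upwards [hfL.coeFn_toLp] with x hx
    rw [hx, smul_eq_mul, mul_comm]
  obtain ⟨R₁, hR₁⟩ := hT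
  have hUR : SupportedIn U R := by
    intro u hu
    rw [hU]
    refine integral_eq_zero_of_ae (Eventually.of_forall fun x => ?_)
    by_cases hx : R < |x|
    · simp [hR x hx]
    · have : u x = 0 := by
        by_contra hne
        exact hu (subset_tsupport _ hne) (abs_le.mp (not_lt.mp hx))
      simp [this]
  have hUs := hUR.mono (le_max_right R₁ R)
  have hTs := hR₁.mono (le_max_left R₁ R)
  have hD : SupportedIn (T - U) (max R₁ R) := by
    intro u hu
    change T u - U u = 0
    rw [hTs u hu, hUs u hu, sub_zero]
  intro g
  rw [← hU g, ← sub_eq_zero]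
  refine eq_zero_of_fourierFn_eq_zero (T := T - U) ⟨_, hD⟩ (fun ξ => ?_) g
  rw [hD.fourierFn_eq_cut]
  change T _ - U _ = 0
  rw [← hTs.fourierFn_eq_cut, h, hU, sub_eq_zero]
  refine integral_congr_ae (Eventually.of_forall fun x => ?_)
  by_cases hx : R < |x|
  · simp [hR x hx]
  · have : |x| ≤ |max R₁ R| + 1 := by
      linarith [not_lt.mp hx, le_max_right R₁ R, le_abs_self (max R₁ R)]
    simp only [cut_apply, cutBump_eq_one this, Complex.ofReal_one, one_mul]
    congr 2; ring

theorem fourierFn_eq_integral {T : 𝓢'(ℝ, ℂ)} (hT : IsCompactlySupported T) {f : ℝ → ℂ} {R : ℝ}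
    (hR : ∀ x, R < |x| → f x = 0) (h : IsGivenBy T f) (ξ : ℝ) :
    fourierFn T ξ = ∫ x, f x * Complex.exp (-(Complex.I * (x : ℂ) * (ξ : ℂ))) := by
  obtain ⟨R₁, hR₁⟩ := hT
  rw [(hR₁.mono (le_max_left R₁ R)).fourierFn_eq_cut, h]
  refine integral_congr_ae (Eventually.of_forall fun x => ?_)
  by_cases hx : R < |x|
  · simp [hR x hx]
  · have : |x| ≤ |max R₁ R| + 1 := by
      linarith [not_lt.mp hx, le_max_right R₁ R, le_abs_self (max R₁ R)]
    simp only [cut_apply, cutBump_eq_one this, Complex.ofReal_one, one_mul]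
    congr 2; ring

/-- A continuous function with compact support is determined by its Fourier transform. -/
theorem eq_zero_of_integral_exp_eq_zero {f : ℝ → ℂ} {R : ℝ} (hf : Continuous f)
    (hR : ∀ x, R < |x| → f x = 0)
    (h : ∀ ξ : ℝ, ∫ x, f x * Complex.exp (-(Complex.I * (x : ℂ) * (ξ : ℂ))) = 0) : f = 0 := by
  have hi : Integrable f := hf.integrable_of_hasCompactSupport (hasCompactSupport_of_forall_lt hR)
  have hF : FourierTransform.fourier f = (0 : ℝ → ℂ) := by
    funext w
    rw [Real.fourier_eq', Pi.zero_apply, ← h (2 * Real.pi * w)]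
    refine integral_congr_ae (Eventually.of_forall fun x => ?_)
    simp only [smul_eq_mul]
    rw [mul_comm]
    congr 2
    simp
    ring
  have h1 := hf.fourierInv_fourier_eq hi (by rw [hF]; exact integrable_zero _ _ _)
  rw [← h1, hF]
  funext x
  simp [Real.fourierInv_eq']

/-! ### Refinable functions -/

/-- The vector function `∑_b u(b) G(y - b)`. -/
def applySeq {s r : ℕ} (u : FSeq s r) (G : Fin r → ℝ → ℂ) (i : Fin s) (y : ℝ) : ℂ :=
  ∑ b ∈ u.support, ∑ j, u b i j * G j (y - b)

theorem applySeq_eq_sum {s r : ℕ} (u : FSeq s r) (G : Fin r → ℝ → ℂ) (i : Fin s) (y : ℝ)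
    {S : Finset ℤ} (hS : u.support ⊆ S) :
    applySeq u G i y = ∑ b ∈ S, ∑ j, u b i j * G j (y - b) := by
  refine Finset.sum_subset hS fun b _ hb => ?_
  simp [Finsupp.notMem_support_iff.mp hb]

theorem applySeq_comb {s r q : ℕ} (t : ℤ) (u : FSeq s r) (w : FSeq r q) (G : Fin q → ℝ → ℂ)
    (i : Fin s) (y : ℝ) : applySeq (comb t u w) G i y =
      ∑ k ∈ u.support, ∑ j, u k i j * applySeq w G j (y - t * k) := by
  have h : ∀ (v : FSeq s q), applySeq v G i y =
      ∑ l, pairing v (fun b => G l (y - b)) i l := by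
    intro v
    simp only [pairing_entry]
    rw [Finset.sum_comm]
    exact Finset.sum_congr rfl fun b _ => Finset.sum_congr rfl fun l _ => mul_comm _ _
  rw [h]
  simp only [pairing_comb, Finsupp.sum, Matrix.sum_apply, Matrix.smul_apply, smul_eq_mul,
    Matrix.mul_apply]
  rw [Finset.sum_comm]
  refine Finset.sum_congr rfl fun k _ => ?_
  simp only [applySeq, Finset.mul_sum]
  rw [Finset.sum_comm]
  conv_rhs => rw [Finset.sum_comm]
  refine Finset.sum_congr rfl fun b _ => ?_
  rw [Finset.sum_comm]
  refine Finset.sum_congr rfl fun j _ => Finset.sum_congr rfl fun l _ => ?_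
  push_cast
  rw [sub_sub]; ring

/-- The refinement equation `g = 2 ∑_b a(b) g(2 · - b)` in the time domain. -/
def FunRefinable {r : ℕ} (a : FSeq r r) (g : Fin r → ℝ → ℂ) : Prop :=
  ∀ i x, g i x = applySeq (maskIter a 1) g i (2 * x)

theorem FunRefinable.iterate {r : ℕ} {a : FSeq r r} {g : Fin r → ℝ → ℂ} (hg : FunRefinable a g)
    (n : ℕ) (i : Fin r) (x : ℝ) : g i x = applySeq (maskIter a n) g i (2 ^ n * x) := by
  induction n with
  | zero =>
    rw [applySeq_eq_sum (S := {0}) _ _ _ _ (by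
      rw [maskIter_zero]; exact Finsupp.support_single_subset)]
    simp [maskIter_zero, Matrix.one_apply]
  | succ n ih =>
    rw [ih, maskIter_add, applySeq_comb, applySeq]
    refine Finset.sum_congr rfl fun k _ => Finset.sum_congr rfl fun j _ => ?_
    rw [hg j]
    congr 2
    push_cast
    ring

theorem iteratedDeriv_comp_mul_sub {G : ℝ → ℂ} {l : ℕ} (hG : ContDiff ℝ l G) (c b : ℝ) :
    iteratedDeriv l (fun x => G (c * x - b)) = fun x => (c : ℂ) ^ l * iteratedDeriv l G (c * x - b) := by
  induction l with
  | zero => simp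
  | succ l ih =>
    have hl : ContDiff ℝ l G := hG.of_le (by norm_cast; omega)
    rw [iteratedDeriv_succ, ih hl]
    funext x
    have h1 : HasDerivAt (iteratedDeriv l G) (iteratedDeriv (l + 1) G (c * x - b)) (c * x - b) := by
      rw [iteratedDeriv_succ]
      exact ((hG.differentiable_iteratedDeriv l (by norm_cast; omega)) _).hasDerivAt
    have h2 : HasDerivAt (fun x => c * x - b) c x := by
      simpa using ((hasDerivAt_id x).const_mul c).sub_const b
    have h3 := (h1.scomp x h2).const_mul ((c : ℂ) ^ l)
    refine h3.deriv.trans ?_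
    rw [Complex.real_smul, pow_succ, mul_assoc]

theorem FunRefinable.iteratedDeriv {r : ℕ} {a : FSeq r r} {g : Fin r → ℝ → ℂ}
    (hg : FunRefinable a g) {l : ℕ} (hgl : ∀ i, ContDiff ℝ l (g i)) (n : ℕ) (i : Fin r) (x : ℝ) :
    iteratedDeriv l (g i) x = (2 : ℂ) ^ (l * n) *
      applySeq (maskIter a n) (fun j => iteratedDeriv l (g j)) i (2 ^ n * x) := by
  have h1 : g i = fun x => ∑ b ∈ (maskIter a n).support, ∑ j, maskIter a n b i j *
      g j (2 ^ n * x - b) := funext fun x => hg.iterate n i x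
  have h2 : ∀ (b : ℤ) (j : Fin r), ContDiff ℝ l fun x : ℝ => g j (2 ^ n * x - b) := fun b j =>
    (hgl j).comp ((contDiff_const.mul contDiff_id).sub contDiff_const)
  have h3 : ∀ (b : ℤ) (j : Fin r), ContDiff ℝ l fun x : ℝ =>
      maskIter a n b i j * g j (2 ^ n * x - b) := fun b j => contDiff_const.mul (h2 b j)
  conv_lhs => rw [h1]
  rw [iteratedDeriv_fun_sum fun b _ => (ContDiff.sum fun j _ => h3 b j).contDiffAt, applySeq,
    Finset.mul_sum]
  refine Finset.sum_congr rfl fun b _ => ?_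
  rw [iteratedDeriv_fun_sum fun j _ => (h3 b j).contDiffAt, Finset.mul_sum]
  refine Finset.sum_congr rfl fun j _ => ?_
  rw [iteratedDeriv_const_mul _ (h2 b j).contDiffAt, iteratedDeriv_comp_mul_sub (hgl j)]
  push_cast
  rw [← pow_mul, mul_comm n l]
  ring

/-! ### Decay on windows -/

/-- Sequences of vectors supported in `[-N, N]`. -/
abbrev Window (N r : ℕ) : Type := Finset.Icc (-(N : ℤ)) N × Fin r → ℂ

/-- The entry `i` at `k` of the convolution of `A` with a sequence supported in `[-N, N]`. -/
def win {s r : ℕ} (A : FSeq s r) (N : ℕ) (k : ℤ) (i : Fin s) : Window N r →ₗ[ℂ] ℂ :=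
  ∑ p : Finset.Icc (-(N : ℤ)) N × Fin r, A (k - p.1) i p.2 • LinearMap.proj p

theorem win_apply {s r : ℕ} (A : FSeq s r) (N : ℕ) (k : ℤ) (i : Fin s) (w : Window N r) :
    win A N k i w = ∑ j : Finset.Icc (-(N : ℤ)) N, ∑ t, A (k - j) i t * w (j, t) := by
  simp [win, LinearMap.sum_apply, Fintype.sum_prod_type]

theorem exists_entry_bound {s r : ℕ} (A : FSeq s r) : ∃ C, 0 ≤ C ∧ ∀ k i j, ‖A k i j‖ ≤ C := by
  refine ⟨∑ k ∈ A.support, ∑ i, ∑ j, ‖A k i j‖, by positivity, fun k i j => ?_⟩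
  by_cases hk : k ∈ A.support
  · refine le_trans ?_ (Finset.single_le_sum (f := fun k => ∑ i, ∑ j, ‖A k i j‖)
      (fun _ _ => by positivity) hk)
    refine le_trans ?_ (Finset.single_le_sum (f := fun i => ∑ j, ‖A k i j‖)
      (fun _ _ => by positivity) (Finset.mem_univ i))
    exact Finset.single_le_sum (f := fun j => ‖A k i j‖) (fun _ _ => by positivity)
      (Finset.mem_univ j)
  · rw [Finsupp.notMem_support_iff.mp hk, Matrix.zero_apply, norm_zero]
    positivity

theorem exists_win_bound {s r : ℕ} (A : FSeq s r) (N : ℕ) :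
    ∃ C, ∀ k i w, ‖win A N k i w‖ ≤ C * ‖w‖ := by
  obtain ⟨C, _, hC⟩ := exists_entry_bound A
  refine ⟨∑ _j : Finset.Icc (-(N : ℤ)) N, ∑ _t : Fin r, C, fun k i w => ?_⟩
  rw [win_apply, Finset.sum_mul]
  refine norm_sum_le_of_le _ fun j _ => ?_
  rw [Finset.sum_mul]
  refine norm_sum_le_of_le _ fun t _ => ?_
  rw [norm_mul]
  exact mul_le_mul (hC _ _ _) (norm_le_pi_norm w _) (norm_nonneg _) ((norm_nonneg _).trans (hC 0 i t))

/-- The subsampled convolution `j ↦ (A_p * w)(e + 2^p j)`. -/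
def contr {r : ℕ} (a : FSeq r r) (N p : ℕ) (e : ℤ) : Window N r →ₗ[ℂ] Window N r :=
  LinearMap.pi fun q => win (maskIter a p) N (e + 2 ^ p * q.1) q.2

theorem contr_apply {r : ℕ} (a : FSeq r r) (N p : ℕ) (e : ℤ) (w : Window N r)
    (q : Finset.Icc (-(N : ℤ)) N × Fin r) :
    contr a N p e w q = win (maskIter a p) N (e + 2 ^ p * q.1) q.2 w := rfl

/-- The window [-N, N] is stable as soon as N ≥ B: contributions of coarse indices outside it fall
beyond the support radius B(2^p - 1) of A_p. -/
theorem two_pow_mul_gt {N B : ℕ} (hN : B ≤ N) (p : ℕ) {e s j : ℤ} (he : 0 ≤ e) (he' : e < 2 ^ p)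
    (hs : (N : ℤ) < |s|) (hj : |j| ≤ N) : B * (2 ^ p - 1) < |e + 2 ^ p * s - j| := by
  have h2 : (1 : ℤ) ≤ 2 ^ p := one_le_pow₀ (by norm_num)
  have h3 : (B : ℤ) ≤ N := by exact_mod_cast hN
  have hj' := abs_le.mp hj
  rcases lt_abs.mp hs with h | h
  · exact lt_of_lt_of_le (by nlinarith) (le_abs_self _)
  · exact lt_of_lt_of_le (by nlinarith) (neg_le_abs _)

theorem maskIter_add_apply {r : ℕ} {a : FSeq r r} {B N : ℕ}
    (hB : ∀ k : ℤ, (B : ℤ) < |k| → a k = 0) (hN : B ≤ N) (n p : ℕ) {e k j : ℤ} (he : 0 ≤ e)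
    (he' : e < 2 ^ p) (hj : |j| ≤ N) : maskIter a (n + p) (e + 2 ^ p * k - j) =
      ∑ s : Finset.Icc (-(N : ℤ)) N, maskIter a n (k - s) * maskIter a p (e + 2 ^ p * s - j) := by
  rw [maskIter_add, comb_apply_apply, Finsupp.sum,
    Finset.sum_coe_sort _ fun s => maskIter a n (k - s) * maskIter a p (e + 2 ^ p * s - j)]
  let F : ℤ → Matrix (Fin r) (Fin r) ℂ := fun s =>
    maskIter a n s * maskIter a p (e + 2 ^ p * k - j - 2 ^ p * s)
  have h1 : ∑ᶠ s, F s = ∑ s ∈ (maskIter a n).support, F s := by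
    refine finsum_eq_sum_of_support_subset _ fun s hs => ?_
    rw [Function.mem_support] at hs
    exact Finsupp.mem_support_iff.mpr fun h => hs (by simp only [F]; rw [h, Matrix.zero_mul])
  have h2 : ∑ᶠ s, F (Equiv.subLeft k s) = ∑ᶠ s, F s := finsum_comp_equiv (Equiv.subLeft k)
  have h3 : ∀ s, F (Equiv.subLeft k s) =
      maskIter a n (k - s) * maskIter a p (e + 2 ^ p * s - j) := by
    intro s
    simp only [F, Equiv.subLeft_apply]
    congr 2; ring
  rw [← h1, ← h2]
  simp only [h3]
  refine finsum_eq_sum_of_support_subset _ fun s hs => ?_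
  rw [Function.mem_support] at hs
  rw [Finset.mem_coe, Finset.mem_Icc, ← abs_le]
  by_contra! hc
  exact hs (by rw [maskIter_apply_eq_zero hB p (two_pow_mul_gt hN p he he' hc hj), Matrix.mul_zero])

/-- The cocycle identity on windows. The lowest p binary digits e of the index are spent on
transforming the window, and the remaining digits k are left for A_n. -/
theorem win_add {r : ℕ} {a : FSeq r r} {B N : ℕ} (hB : ∀ k : ℤ, (B : ℤ) < |k| → a k = 0)
    (hN : B ≤ N) (n p : ℕ) {e k : ℤ} (he : 0 ≤ e) (he' : e < 2 ^ p) (i : Fin r)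
    (w : Window N r) :
    win (maskIter a (n + p)) N (e + 2 ^ p * k) i w =
      win (maskIter a n) N k i (contr a N p e w) := by
  simp only [win_apply, contr_apply]
  have h1 : ∀ (j : Finset.Icc (-(N : ℤ)) N) (t : Fin r),
      maskIter a (n + p) (e + 2 ^ p * k - j) i t = ∑ s : Finset.Icc (-(N : ℤ)) N, ∑ t',
        maskIter a n (k - s) i t' * maskIter a p (e + 2 ^ p * s - j) t' t := by
    intro j t
    rw [maskIter_add_apply hB hN n p he he' (abs_le.mpr (Finset.mem_Icc.mp j.2)),
      Matrix.sum_apply]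
    simp only [Matrix.mul_apply]
  simp only [h1, Finset.sum_mul, Finset.mul_sum]
  calc _ = ∑ j : Finset.Icc (-(N : ℤ)) N, ∑ s : Finset.Icc (-(N : ℤ)) N, ∑ t, ∑ t',
        maskIter a n (k - s) i t' * maskIter a p (e + 2 ^ p * s - j) t' t * w (j, t) :=
        Finset.sum_congr rfl fun j _ => Finset.sum_comm
    _ = ∑ s : Finset.Icc (-(N : ℤ)) N, ∑ j : Finset.Icc (-(N : ℤ)) N, ∑ t, ∑ t',
        maskIter a n (k - s) i t' * maskIter a p (e + 2 ^ p * s - j) t' t * w (j, t) :=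
        Finset.sum_comm
    _ = _ := by
        refine Finset.sum_congr rfl fun s _ => ?_
        rw [Finset.sum_congr rfl fun j _ => Finset.sum_comm, Finset.sum_comm]
        simp only [mul_assoc]

/-- The abstract decay principle applied to an invariant subspace W of the window space. The scalar
c (a power of 2 when derivatives are estimated) compensates for the decay caused by differentiation.
-/
theorem exists_decay_on_window {r : ℕ} {a : FSeq r r} {B N : ℕ}
    (hB : ∀ k : ℤ, (B : ℤ) < |k| → a k = 0) (hN : B ≤ N) (c : ℂ) (W : Submodule ℂ (Window N r))
    (hW : ∀ p e, 0 ≤ e → e < 2 ^ p → ∀ w ∈ W, c ^ p • contr a N p e w ∈ W)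
    (h0 : ∀ w ∈ W, ∀ ε > 0, ∃ n₀, ∀ n ≥ n₀, ∀ k i, ‖c ^ n * win (maskIter a n) N k i w‖ ≤ ε) :
    ∃ C q : ℝ, 0 ≤ C ∧ 1 / 2 ≤ q ∧ q < 1 ∧
      ∀ n k i, ∀ w ∈ W, ‖c ^ n * win (maskIter a n) N k i w‖ ≤ C * q ^ n * ‖w‖ := by
  let Λ : ℕ → ℤ × Fin r → W →ₗ[ℂ] ℂ := fun n k =>
    (c ^ n • win (maskIter a n) N k.1 k.2) ∘ₗ W.subtype
  have hΛ : ∀ n k w, Λ n k w = c ^ n * win (maskIter a n) N k.1 k.2 w := fun n k w => rfl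
  have e1 : ∀ n, ∃ C, ∀ k w, ‖Λ n k w‖ ≤ C * ‖w‖ := by
    intro n
    obtain ⟨D, hD⟩ := exists_win_bound (maskIter a n) N
    refine ⟨‖c ^ n‖ * D, fun k w => ?_⟩
    rw [hΛ, norm_mul, mul_assoc]
    exact mul_le_mul_of_nonneg_left (hD _ _ _) (norm_nonneg _)
  have e2 : ∀ w, ∀ ε > 0, ∃ n₀, ∀ n ≥ n₀, ∀ k, ‖Λ n k w‖ ≤ ε := by
    intro w ε hε
    obtain ⟨n₀, hn₀⟩ := h0 w w.2 ε hε
    exact ⟨n₀, fun n hn k => hn₀ n hn k.1 k.2⟩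
  have e3 : ∀ n p k w, ∃ k' w', Λ (n + p) k w = Λ n k' w' ∧
      ∀ d, 0 ≤ d → (∀ i, ‖Λ p i w‖ ≤ d) → ‖w'‖ ≤ d := by
    rintro n p ⟨k, i⟩ w
    have h2p : (0 : ℤ) < 2 ^ p := by positivity
    have he := Int.emod_nonneg k h2p.ne'
    have he' := Int.emod_lt_of_pos k h2p
    refine ⟨(k / 2 ^ p, i), ⟨c ^ p • contr a N p (k % 2 ^ p) w, hW p _ he he' w w.2⟩, ?_, ?_⟩
    · rw [hΛ, hΛ]
      simp only [map_smul, smul_eq_mul]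
      rw [← win_add hB hN n p he he' i, Int.emod_add_mul_ediv, pow_add, mul_assoc]
    · intro d hd hdw
      change ‖c ^ p • contr a N p (k % 2 ^ p) (w : Window N r)‖ ≤ d
      rw [pi_norm_le_iff_of_nonneg hd]
      rintro ⟨j, t⟩
      exact hdw (k % 2 ^ p + 2 ^ p * j, t)
  obtain ⟨C, q, hC, hq, hq1, h⟩ := exists_exponential_decay Λ e1 e2 e3
  exact ⟨C, q, hC, hq, hq1, fun n k i w hw => h n (k, i) ⟨w, hw⟩⟩

/-! ### Hölder continuity of refinable functions -/

/-- The samples `j ↦ f(x + j)`, `|j| ≤ N`. -/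
def sampleWin {r : ℕ} (N : ℕ) (f : Fin r → ℝ → ℂ) (x : ℝ) : Window N r := fun q => f q.2 (x + q.1)

theorem win_sampleWin {s r : ℕ} (A : FSeq s r) {N : ℕ} {f : Fin r → ℝ → ℂ} {R x : ℝ}
    (hR : ∀ i x, R < |x| → f i x = 0) (hN : R + 1 ≤ N) (hx : x ∈ Set.Icc (0 : ℝ) 1) (k : ℤ)
    (i : Fin s) : win A N k i (sampleWin N f x) = applySeq A f i (x + k) := by
  rw [win_apply]
  simp only [sampleWin]
  rw [Finset.sum_coe_sort _ fun j : ℤ => ∑ t, A (k - j) i t * f t (x + j)]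
  let F : ℤ → ℂ := fun b => ∑ t, A b i t * f t (x + k - b)
  have h1 : ∑ᶠ b, F b = applySeq A f i (x + k) := by
    refine finsum_eq_sum_of_support_subset _ fun s hs => ?_
    rw [Function.mem_support] at hs
    exact Finsupp.mem_support_iff.mpr fun h => hs (by simp [F, h])
  have h2 : ∑ᶠ j, F (Equiv.subLeft k j) = ∑ᶠ b, F b := finsum_comp_equiv (Equiv.subLeft k)
  have h3 : ∀ j, F (Equiv.subLeft k j) = ∑ t, A (k - j) i t * f t (x + j) := by
    intro j
    simp only [F, Equiv.subLeft_apply]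
    push_cast
    refine Finset.sum_congr rfl fun t _ => ?_
    congr 2; ring
  rw [← h1, ← h2]
  simp only [h3]
  symm
  refine finsum_eq_sum_of_support_subset _ fun j hj => ?_
  rw [Function.mem_support] at hj
  rw [Finset.mem_coe, Finset.mem_Icc, ← abs_le]
  by_contra! hc
  refine hj (Finset.sum_eq_zero fun t _ => ?_)
  rw [hR, mul_zero]
  have h4 : (N : ℝ) + 1 ≤ |(j : ℝ)| := by exact_mod_cast hc
  have h5 : |(j : ℝ)| ≤ |x + j| + |x| := by
    have := abs_sub (x + j) x
    rwa [add_sub_cancel_left] at this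
  have h6 : |x| ≤ 1 := abs_le.mpr ⟨by linarith [hx.1], hx.2⟩
  linarith

/-- Windows of samples of f = g^{(m)} at x + j, scaled by 2^{mp}, are sent by the contractions to
windows of samples at (x + e)/2^p + j. The span of differences of two such windows is therefore
invariant, and uniform continuity gives pointwise decay on it. -/
theorem exists_decay_of_refinable {r m : ℕ} {a : FSeq r r} {g : Fin r → ℝ → ℂ} {R : ℝ}
    (hg : FunRefinable a g) (hgm : ∀ i, ContDiff ℝ m (g i)) (hR : ∀ i x, R < |x| → g i x = 0) :
    ∃ C q : ℝ, 0 ≤ C ∧ 1 / 2 ≤ q ∧ q < 1 ∧ ∀ (n : ℕ) (k : ℤ) i,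
      ∀ x ∈ Set.Icc (0 : ℝ) 1, ∀ y ∈ Set.Icc (0 : ℝ) 1,
      ‖iteratedDeriv m (g i) ((x + k) / 2 ^ n) - iteratedDeriv m (g i) ((y + k) / 2 ^ n)‖
        ≤ C * q ^ n := by
  set f : Fin r → ℝ → ℂ := fun i => iteratedDeriv m (g i) with hf
  have hfR : ∀ i x, R < |x| → f i x = 0 := fun i => iteratedDeriv_eq_zero_of_forall_lt (hR i) m
  have hfc : ∀ i, Continuous (f i) := fun i => (hgm i).continuous_iteratedDeriv m le_rfl
  obtain ⟨B, hB⟩ := exists_support_bound a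
  -- The bound B makes the window stable; the bound R + 1 makes it contain all nonzero samples f(x +
  -- j) for x in [0, 1].
  obtain ⟨N, hN⟩ := exists_nat_ge (max (R + 1) B)
  have hNR := (le_max_left _ _).trans hN
  have hNB : B ≤ N := by exact_mod_cast (le_max_right _ _).trans hN
  have hs : ∀ x ∈ Set.Icc (0 : ℝ) 1, ∀ (n : ℕ) (k : ℤ) i,
      ((2 : ℂ) ^ m) ^ n * win (maskIter a n) N k i (sampleWin N f x) = f i ((x + k) / 2 ^ n) := by
    intro x hx n k i
    rw [win_sampleWin _ hfR hNR hx, ← pow_mul]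
    have h := hg.iteratedDeriv hgm n i ((x + k) / 2 ^ n)
    rw [mul_div_cancel₀ _ (by positivity)] at h
    exact h.symm
  let S : Set (Window N r) := {w | ∃ x ∈ Set.Icc (0 : ℝ) 1, ∃ y ∈ Set.Icc (0 : ℝ) 1,
    w = sampleWin N f x - sampleWin N f y}
  have hcontr : ∀ p e, 0 ≤ e → e < 2 ^ p → ∀ x ∈ Set.Icc (0 : ℝ) 1,
      ∃ x' ∈ Set.Icc (0 : ℝ) 1, ((2 : ℂ) ^ m) ^ p • contr a N p e (sampleWin N f x) =
        sampleWin N f x' := by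
    intro p e he he' x hx
    have he0 : (0 : ℝ) ≤ e := by exact_mod_cast he
    have he1 : (e : ℝ) + 1 ≤ 2 ^ p := by exact_mod_cast he'
    refine ⟨(x + e) / 2 ^ p, ⟨div_nonneg (by linarith [hx.1]) (by positivity), ?_⟩, ?_⟩
    · rw [div_le_one (by positivity)]; linarith [hx.2]
    · funext q
      rw [Pi.smul_apply, smul_eq_mul, contr_apply, hs x hx, sampleWin]
      congr 1
      push_cast
      field_simp
      ring
  obtain ⟨C, q, hC, hq, hq1, h⟩ := exists_decay_on_window hB hNB ((2 : ℂ) ^ m)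
    (Submodule.span ℂ S) (by
      intro p e he he' w hw
      have hle : Submodule.span ℂ S ≤
          (Submodule.span ℂ S).comap (((2 : ℂ) ^ m) ^ p • contr a N p e) := by
        rw [Submodule.span_le]
        rintro _ ⟨x, hx, y, hy, rfl⟩
        obtain ⟨x', hx', hxx⟩ := hcontr p e he he' x hx
        obtain ⟨y', hy', hyy⟩ := hcontr p e he he' y hy
        refine Submodule.subset_span ⟨x', hx', y', hy', ?_⟩
        rw [LinearMap.smul_apply, map_sub, smul_sub, hxx, hyy]
      exact hle hw) (by
      intro w hw
      induction hw using Submodule.span_induction with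
      | mem w hw =>
        obtain ⟨x, hx, y, hy, rfl⟩ := hw
        intro ε hε
        choose δ hδ hu using fun i => exists_dist_le_of_forall_lt (hfc i) (hfR i) hε
        obtain ⟨δ₀, hδ₀, hle⟩ : ∃ δ₀ > 0, ∀ i, δ₀ ≤ δ i := by
          rcases isEmpty_or_nonempty (Fin r) with hE | hE
          · exact ⟨1, one_pos, fun i => (hE.false i).elim⟩
          · obtain ⟨i₀, hi₀⟩ := Finite.exists_min δ
            exact ⟨δ i₀, hδ i₀, hi₀⟩
        obtain ⟨n₀, hn₀⟩ := exists_pow_lt_of_lt_one hδ₀ (by norm_num : (1 / 2 : ℝ) < 1)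
        refine ⟨n₀, fun n hn k i => ?_⟩
        rw [map_sub, mul_sub, hs x hx, hs y hy]
        refine hu i _ _ ?_
        rw [← sub_div, add_sub_add_right_eq_sub, abs_div, abs_of_pos (by positivity : (0 : ℝ) < 2 ^ n)]
        have h1 : |x - y| ≤ 1 := by
          rw [abs_le]; constructor <;> linarith [hx.1, hx.2, hy.1, hy.2]
        calc |x - y| / 2 ^ n ≤ 1 / 2 ^ n := by gcongr
          _ = (1 / 2) ^ n := by rw [_root_.one_div_pow]
          _ ≤ (1 / 2) ^ n₀ := pow_le_pow_of_le_one (by norm_num) (by norm_num) hn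
          _ < δ i := hn₀.trans_le (hle i)
      | zero => intro ε hε; exact ⟨0, fun n _ k i => by simpa using hε.le⟩
      | add v w _ _ hv hw =>
        intro ε hε
        obtain ⟨n₁, h₁⟩ := hv (ε / 2) (by positivity)
        obtain ⟨n₂, h₂⟩ := hw (ε / 2) (by positivity)
        refine ⟨max n₁ n₂, fun n hn k i => ?_⟩
        rw [map_add, mul_add]
        refine (norm_add_le _ _).trans ?_
        linarith [h₁ n (le_of_max_le_left hn) k i, h₂ n (le_of_max_le_right hn) k i]
      | smul c w _ hw =>
        intro ε hε
        obtain ⟨n₁, h₁⟩ := hw (ε / (‖c‖ + 1)) (by positivity)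
        refine ⟨n₁, fun n hn k i => ?_⟩
        rw [map_smul, smul_eq_mul, mul_left_comm, norm_mul]
        have h2 := h₁ n hn k i
        calc ‖c‖ * _ ≤ ‖c‖ * (ε / (‖c‖ + 1)) := by gcongr
          _ ≤ ε := by
            rw [mul_div_assoc', div_le_iff₀ (by positivity)]
            nlinarith [norm_nonneg c])
  choose M hM0 hM using fun i => exists_bound_of_forall_lt (hfc i) (hfR i)
  have hMs : 0 ≤ ∑ i, M i := Finset.sum_nonneg fun i _ => (hM0 i).le
  refine ⟨C * (2 * ∑ i, M i), q, by positivity, hq, hq1, fun n k i x hx y hy => ?_⟩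
  have h1 := h n k i _ (Submodule.subset_span ⟨x, hx, y, hy, rfl⟩)
  rw [map_sub, mul_sub, hs x hx, hs y hy] at h1
  refine h1.trans ?_
  rw [mul_right_comm]
  have hq0 : 0 < q := by linarith
  gcongr
  rw [pi_norm_le_iff_of_nonneg (by positivity)]
  intro p
  have h2 : ∀ z, ‖f p.2 z‖ ≤ ∑ i, M i := fun z =>
    (hM p.2 z).trans (Finset.single_le_sum (f := M) (fun i _ => (hM0 i).le) (Finset.mem_univ _))
  rw [Pi.sub_apply, two_mul]
  exact (norm_sub_le _ _).trans (add_le_add (h2 _) (h2 _))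

/-- A geometric rate q^n for oscillation over dyadic cells of length 2^{-n} is a Hölder estimate,
with exponent read off from q ≤ 2^{-τ}. -/
theorem exists_holder_of_refinable {r m : ℕ} {a : FSeq r r} {g : Fin r → ℝ → ℂ} {R : ℝ}
    (hg : FunRefinable a g) (hgm : ∀ i, ContDiff ℝ m (g i)) (hR : ∀ i x, R < |x| → g i x = 0) :
    ∃ τ : ℝ, 0 < τ ∧ τ < 1 ∧ ∀ i, ∃ C, 0 < C ∧ ∀ x y,
      ‖iteratedDeriv m (g i) x - iteratedDeriv m (g i) y‖ ≤ C * |x - y| ^ τ := by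
  obtain ⟨C, q, hC, hq, hq1, h⟩ := exists_decay_of_refinable hg hgm hR
  have hq0 : 0 < q := by linarith
  have hnear : ∀ (n : ℕ) i (x y : ℝ), x ≤ y → y - x ≤ (1 / 2) ^ n →
      ‖iteratedDeriv m (g i) x - iteratedDeriv m (g i) y‖ ≤ 2 * C * q ^ n := by
    intro n i x y hxy hyx
    have h2n : (0 : ℝ) < 2 ^ n := by positivity
    set k := ⌊2 ^ n * x⌋ with hk
    have hk1 := Int.floor_le (2 ^ n * x)
    have hk2 := Int.lt_floor_add_one (2 ^ n * x)
    rw [← hk] at hk1 hk2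
    have hy1 : 2 ^ n * y ≤ 2 ^ n * x + 1 := by
      have h3 : 2 ^ n * (y - x) ≤ 1 := by
        calc 2 ^ n * (y - x) ≤ 2 ^ n * (1 / 2) ^ n := by gcongr
          _ = 1 := by rw [← mul_pow]; norm_num
      linarith
    have hy0 : 2 ^ n * x ≤ 2 ^ n * y := by gcongr
    have hrep : ∀ (z : ℝ) (j : ℤ), (2 ^ n * z - j + j) / 2 ^ n = z := fun z j => by
      rw [sub_add_cancel, mul_div_cancel_left₀ _ h2n.ne']
    have hCq : 0 ≤ C * q ^ n := by positivity
    rcases le_total (2 ^ n * y) (k + 1) with hc | hc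
    · have h3 := h n k i (2 ^ n * x - k) ⟨by linarith, by linarith⟩ (2 ^ n * y - k)
        ⟨by linarith, by linarith⟩
      rw [hrep, hrep] at h3
      linarith
    -- The points lie in neighbouring cells and are compared through the common endpoint, which is 1
    -- in cell k and 0 in cell k + 1.
    · have h3 := h n k i (2 ^ n * x - k) ⟨by linarith, by linarith⟩ 1 ⟨by norm_num, le_rfl⟩
      have h4 := h n (k + 1) i 0 ⟨le_rfl, by norm_num⟩ (2 ^ n * y - (k + 1 : ℤ))
        ⟨by push_cast; linarith, by push_cast; linarith⟩
      rw [hrep] at h3 h4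
      have h5 : ((0 : ℝ) + (k + 1 : ℤ)) / 2 ^ n = (1 + k) / 2 ^ n := by push_cast; ring
      rw [h5] at h4
      have h6 := norm_sub_le_norm_sub_add_norm_sub (iteratedDeriv m (g i) x)
        (iteratedDeriv m (g i) ((1 + k) / 2 ^ n)) (iteratedDeriv m (g i) y)
      linarith
  -- Since q ≥ 1/2, the exponent without the last division is at most 1. Halving it keeps τ strictly
  -- below 1, as the smoothness exponent demands.
  set τ : ℝ := -Real.log q / Real.log 2 / 2 with hτ
  have hl2 : 0 < Real.log 2 := Real.log_pos (by norm_num)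
  have hlq : Real.log q < 0 := Real.log_neg hq0 hq1
  have hlq' : -Real.log 2 ≤ Real.log q := by
    rw [← Real.log_inv]
    exact Real.log_le_log (by norm_num) (by linarith)
  have hτ0 : 0 < τ := by
    have : 0 < -Real.log q := by linarith
    positivity
  have hτ1 : τ < 1 := by
    rw [hτ, div_div, div_lt_one (by positivity)]
    linarith
  have hqτ : q ≤ (1 / 2 : ℝ) ^ τ := by
    rw [← Real.log_le_log_iff hq0 (by positivity), Real.log_rpow (by norm_num), one_div,
      Real.log_inv, hτ]
    have : -Real.log q / Real.log 2 / 2 * -Real.log 2 = Real.log q / 2 := by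
      field_simp
    rw [this]
    linarith
  refine ⟨τ, hτ0, hτ1, fun i => ?_⟩
  obtain ⟨M, hM0, hM⟩ := exists_bound_of_forall_lt ((hgm i).continuous_iteratedDeriv m le_rfl)
    (iteratedDeriv_eq_zero_of_forall_lt (hR i) m)
  have key : ∀ x y, x < y → ‖iteratedDeriv m (g i) x - iteratedDeriv m (g i) y‖ ≤
      (4 * C + 2 * M) * (y - x) ^ τ := by
    intro x y hxy
    have hd : 0 < y - x := by linarith
    rcases le_or_gt (y - x) 1 with hle | hgt
    · obtain ⟨n, hn1, hn2⟩ := exists_nat_pow_near_of_lt_one hd hle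
        (by norm_num : (0 : ℝ) < 1 / 2) (by norm_num)
      have h2 := hnear n i x y hxy.le hn2
      have h3 : q ^ n ≤ 2 * (y - x) ^ τ := by
        calc q ^ n ≤ ((1 / 2 : ℝ) ^ τ) ^ n := by gcongr
          _ = ((1 / 2 : ℝ) ^ n) ^ τ := by
            rw [← Real.rpow_natCast, ← Real.rpow_mul (by norm_num), mul_comm,
              Real.rpow_mul (by norm_num), Real.rpow_natCast]
          _ ≤ (2 * (y - x)) ^ τ := by
            refine Real.rpow_le_rpow (by positivity) ?_ hτ0.le
            rw [pow_succ] at hn1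
            linarith
          _ = 2 ^ τ * (y - x) ^ τ := Real.mul_rpow (by norm_num) hd.le
          _ ≤ 2 * (y - x) ^ τ := by
            gcongr
            calc (2 : ℝ) ^ τ ≤ 2 ^ (1 : ℝ) := Real.rpow_le_rpow_of_exponent_le (by norm_num) hτ1.le
              _ = 2 := Real.rpow_one 2
      have h4 : 0 ≤ (y - x) ^ τ := by positivity
      nlinarith
    · have h4 : 1 ≤ (y - x) ^ τ := Real.one_le_rpow hgt.le hτ0.le
      refine ((norm_sub_le _ _).trans (add_le_add (hM x) (hM y))).trans ?_
      nlinarith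
  refine ⟨4 * C + 2 * M, by positivity, fun x y => ?_⟩
  rcases lt_trichotomy x y with hxy | rfl | hxy
  · rw [abs_sub_comm, abs_of_pos (by linarith)]; exact key x y hxy
  · simp [Real.zero_rpow hτ0.ne']
  · rw [norm_sub_rev, abs_of_pos (by linarith)]; exact key y x hxy

/-- Smooth refinable functions are slightly smoother. -/
theorem lt_smVector_of_refinable {r m : ℕ} {a : FSeq r r} {g : Fin r → ℝ → ℂ} {R : ℝ}
    (hg : FunRefinable a g) (hgm : ∀ i, ContDiff ℝ m (g i)) (hR : ∀ i x, R < |x| → g i x = 0)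
    {φ : Fin r → 𝓢'(ℝ, ℂ)} (hφ : ∀ i, IsGivenBy (φ i) (g i)) :
    ((m : ℝ) : EReal) < smVector φ := by
  obtain ⟨τ, hτ0, hτ1, hτ⟩ := exists_holder_of_refinable hg hgm hR
  have h1 : ((m : ℝ) : EReal) < (((m : ℝ) + τ : ℝ) : EReal) := by
    exact_mod_cast (lt_add_of_pos_right _ hτ0)
  refine h1.trans_le (le_iInf fun i => le_sSup ⟨m, τ, g i, hτ0.le, hτ1, hφ i, ⟨?_, ?_⟩, ?_, rfl⟩)
  · intro j hj x y
    refine ContDiffOn.absolutelyContinuousOnInterval (ContDiff.contDiffOn ?_)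
    have h2 : ContDiff ℝ ((1 : ℕ) + j : ℕ) (g i) := (hgm i).of_le (by norm_cast; omega)
    have := h2.iterate_deriv' 1 j
    rw [← iteratedDeriv_eq_iterate] at this
    exact_mod_cast this
  · intro j hj
    have hc : Continuous (iteratedDeriv j (g i)) :=
      (hgm i).continuous_iteratedDeriv j (by exact_mod_cast hj)
    exact hc.memLp_of_hasCompactSupport
      (hasCompactSupport_of_forall_lt (iteratedDeriv_eq_zero_of_forall_lt (hR i) j))
  · obtain ⟨C, hC, h⟩ := hτ i
    refine ⟨C, hC, fun t => ?_⟩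
    rw [eLpNorm_exponent_top]
    refine eLpNormEssSup_le_of_ae_bound (Eventually.of_forall fun x => ?_)
    have := h x (x - t)
    rwa [sub_sub_cancel] at this

/-! ### Limits of the iterated masks -/

/-- The row `i` of `2^{ln} A_n` (with entries numbered by `l`) converges uniformly to the
derivatives of `g i` on the refined grid. -/
def IsMaskLimit {r : ℕ} (a : FSeq r r) (g : Fin r → ℝ → ℂ) : Prop :=
  ∀ i l : Fin r, ∀ ε > 0, ∃ n₀, ∀ n ≥ n₀, ∀ k : ℤ,
    ‖maskIter a n k i l * 2 ^ ((l : ℕ) * n) - iteratedDeriv (l : ℕ) (g i) ((k : ℝ) / 2 ^ n)‖ ≤ ε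

theorem tendsto_floor_div (x : ℝ) :
    Tendsto (fun n : ℕ => ((⌊2 ^ n * x⌋ : ℤ) : ℝ) / 2 ^ n) atTop (𝓝 x) := by
  have h1 : Tendsto (fun n : ℕ => (2 : ℝ) ^ n) atTop atTop :=
    tendsto_pow_atTop_atTop_of_one_lt (by norm_num)
  have h2 := (tendsto_nat_floor_mul_div_atTop (R := ℝ) (a := 1) zero_le_one)
  have h3 : Tendsto (fun n : ℕ => ((2 : ℝ) ^ n)⁻¹) atTop (𝓝 0) := h1.inv_tendsto_atTop
  have h4 : Tendsto (fun n : ℕ => x - ((2 : ℝ) ^ n)⁻¹) atTop (𝓝 x) := by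
    simpa using tendsto_const_nhds.sub h3
  refine tendsto_of_tendsto_of_tendsto_of_le_of_le h4 tendsto_const_nhds (fun n => ?_) fun n => ?_
  · have h5 : (0 : ℝ) < 2 ^ n := by positivity
    simp only
    rw [le_div_iff₀ h5, sub_mul, inv_mul_cancel₀ h5.ne']
    have := Int.lt_floor_add_one (2 ^ n * x)
    linarith
  · have h5 : (0 : ℝ) < 2 ^ n := by positivity
    simp only
    rw [div_le_iff₀ h5, mul_comm x]
    exact Int.floor_le _

theorem IsMaskLimit.tendsto {r m : ℕ} {a : FSeq r r} {g : Fin r → ℝ → ℂ} (h : IsMaskLimit a g)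
    (hgm : ∀ i, ContDiff ℝ m (g i)) (hm : r ≤ m + 1) {k : ℕ → ℤ} {x : ℝ}
    (hk : Tendsto (fun n : ℕ => (k n : ℝ) / 2 ^ n) atTop (𝓝 x)) (i l : Fin r) :
    Tendsto (fun n : ℕ => maskIter a n (k n) i l * 2 ^ ((l : ℕ) * n)) atTop
      (𝓝 (iteratedDeriv (l : ℕ) (g i) x)) := by
  have hc : Continuous (iteratedDeriv (l : ℕ) (g i)) :=
    (hgm i).continuous_iteratedDeriv l (by norm_cast; omega)
  have h1 := (hc.tendsto x).comp hk
  have h2 : Tendsto (fun n : ℕ => maskIter a n (k n) i l * 2 ^ ((l : ℕ) * n) -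
      iteratedDeriv (l : ℕ) (g i) ((k n : ℝ) / 2 ^ n)) atTop (𝓝 0) := by
    rw [Metric.tendsto_atTop]
    intro ε hε
    obtain ⟨n₀, hn₀⟩ := h i l (ε / 2) (by positivity)
    refine ⟨n₀, fun n hn => ?_⟩
    rw [dist_zero_right]
    exact (hn₀ n hn _).trans_lt (by linarith)
  have h3 := h2.add h1
  rw [zero_add] at h3
  refine h3.congr fun n => ?_
  simp

/-- Column 0 of A_{1+n} carries no scaling factor, so the limit can be taken on both sides of
A_{1+n} = A_1 combined with A_n. -/
theorem IsMaskLimit.funRefinable {r m : ℕ} {a : FSeq r r} {g : Fin r → ℝ → ℂ}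
    (h : IsMaskLimit a g) (hgm : ∀ i, ContDiff ℝ m (g i)) (hr : 0 < r) (hm : r ≤ m + 1) :
    FunRefinable a g := by
  intro i x
  have h1 : Tendsto (fun n : ℕ => maskIter a (1 + n) ⌊2 ^ (1 + n) * x⌋ i ⟨0, hr⟩) atTop
      (𝓝 (g i x)) := by
    have h2 := h.tendsto hgm hm (tendsto_floor_div x) i ⟨0, hr⟩
    simp only [zero_mul, pow_zero, mul_one, iteratedDeriv_zero] at h2
    have h3 := (tendsto_add_atTop_iff_nat 1).mpr h2
    simpa only [add_comm] using h3
  refine tendsto_nhds_unique h1 ?_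
  have h4 : ∀ n : ℕ, maskIter a (1 + n) ⌊2 ^ (1 + n) * x⌋ i ⟨0, hr⟩ =
      ∑ b ∈ (maskIter a 1).support, ∑ j, maskIter a 1 b i j *
        maskIter a n (⌊2 ^ (1 + n) * x⌋ - 2 ^ n * b) j ⟨0, hr⟩ := by
    intro n
    rw [maskIter_add, comb_apply_apply, Finsupp.sum, Matrix.sum_apply]
    simp only [Matrix.mul_apply]
  simp only [h4, applySeq]
  refine tendsto_finsetSum _ fun b _ => tendsto_finsetSum _ fun j _ => ?_
  have h5 : Tendsto (fun n : ℕ => ((⌊2 ^ (1 + n) * x⌋ - 2 ^ n * b : ℤ) : ℝ) / 2 ^ n) atTop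
      (𝓝 (2 * x - b)) := by
    have h6 := (tendsto_floor_div (2 * x)).sub_const (b : ℝ)
    refine h6.congr fun n => ?_
    have h7 : (2 : ℝ) ^ n * (2 * x) = 2 ^ (1 + n) * x := by ring
    rw [h7]
    push_cast
    rw [sub_div, mul_div_cancel_left₀ _ (by positivity : (2 : ℝ) ^ n ≠ 0)]
  have h8 := h.tendsto hgm hm h5 j ⟨0, hr⟩
  simp only [zero_mul, pow_zero, mul_one, iteratedDeriv_zero] at h8
  exact h8.const_mul _

theorem subdiv_iterate_row {r : ℕ} (a : FSeq r r) (n : ℕ) (i : Fin r) (k : ℤ) (l : Fin r) :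
    ((subdiv a)^[n] ⇑(Finsupp.single (0 : ℤ) (Matrix.single (0 : Fin 1) i (1 : ℂ)) : FSeq 1 r))
      k 0 l = maskIter a n k i l := by
  rw [subdiv_iterate_coe, comb_apply_apply, Finsupp.sum_single_index (by simp)]
  simp

theorem HermiteConvergent.eventually_le {r m : ℕ} {a : FSeq r r} (h : HermiteConvergent a m)
    (i : Fin r) : ∃ η : ℝ → ℂ, ContDiff ℝ m η ∧ ∀ K : ℝ, 0 < K → ∀ l : Fin r, ∀ ε > 0, ∃ n₀,
      ∀ n ≥ n₀, ∀ k : ℤ, |(k : ℝ)| ≤ 2 ^ n * K →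
        ‖maskIter a n k i l * 2 ^ ((l : ℕ) * n) - iteratedDeriv (l : ℕ) η ((k : ℝ) / 2 ^ n)‖ ≤ ε := by
  obtain ⟨η, hη, hc⟩ := h ⇑(Finsupp.single (0 : ℤ) (Matrix.single (0 : Fin 1) i (1 : ℂ)) : FSeq 1 r)
  refine ⟨η, hη, fun K hK l ε hε => ?_⟩
  have h1 := ENNReal.tendsto_nhds_zero.mp (hc K hK l) (ENNReal.ofReal ε) (by simpa using hε)
  obtain ⟨n₀, hn₀⟩ := eventually_atTop.mp h1
  refine ⟨n₀, fun n hn k hk => ?_⟩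
  have h2 := iSup₂_le_iff.mp (hn₀ n hn) k hk
  rw [subdiv_iterate_row, ← ofReal_norm] at h2
  exact (ENNReal.ofReal_le_ofReal_iff hε.le).mp h2

/-- A convergent Hermite scheme has compactly supported basic limit functions. -/
theorem HermiteConvergent.exists_isMaskLimit {r m : ℕ} {a : FSeq r r} (h : HermiteConvergent a m)
    (hr : 0 < r) {B : ℕ} (hB : ∀ k : ℤ, (B : ℤ) < |k| → a k = 0) :
    ∃ g : Fin r → ℝ → ℂ, (∀ i, ContDiff ℝ m (g i)) ∧ (∀ i x, (B : ℝ) < |x| → g i x = 0) ∧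
      IsMaskLimit a g := by
  choose g hg hc using h.eventually_le
  -- Rescaled by 2^{-n}, the support of A_n lies in [-B, B], so the values approximating g_i outside
  -- it are zero.
  have hsupp : ∀ i x, (B : ℝ) < |x| → g i x = 0 := by
    intro i x hx
    have h1 := tendsto_floor_div x
    have h2 := ((hg i).continuous.tendsto x).comp h1
    refine tendsto_nhds_unique h2 ?_
    rw [Metric.tendsto_atTop]
    intro ε hε
    obtain ⟨n₁, hn₁⟩ := hc i (|x| + 1) (by positivity) ⟨0, hr⟩ (ε / 2) (by positivity)
    have h3 : ∀ᶠ n : ℕ in atTop, (B : ℝ) < |((⌊2 ^ n * x⌋ : ℤ) : ℝ) / 2 ^ n| :=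
      h1.abs.eventually (lt_mem_nhds hx)
    have h4 : ∀ᶠ n : ℕ in atTop, |((⌊2 ^ n * x⌋ : ℤ) : ℝ) / 2 ^ n| < |x| + 1 :=
      h1.abs.eventually (gt_mem_nhds (by linarith))
    obtain ⟨n₂, hn₂⟩ := eventually_atTop.mp (h3.and h4)
    refine ⟨max n₁ n₂, fun n hn => ?_⟩
    obtain ⟨h5, h6⟩ := hn₂ n (le_of_max_le_right hn)
    have hp : (0 : ℝ) < 2 ^ n := by positivity
    rw [abs_div, abs_of_pos hp] at h5 h6
    have h7 := hn₁ n (le_of_max_le_left hn) ⌊2 ^ n * x⌋ (by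
      rw [div_lt_iff₀ hp] at h6
      linarith)
    rw [lt_div_iff₀ hp] at h5
    have h8 : (B : ℤ) * (2 ^ n - 1) < |⌊2 ^ n * x⌋| := by
      have h9 : ((B : ℤ) * 2 ^ n : ℤ) < |⌊2 ^ n * x⌋| := by exact_mod_cast h5
      have h10 : (0 : ℤ) ≤ B := by positivity
      linarith
    rw [maskIter_apply_eq_zero hB n h8] at h7
    simp only [Matrix.zero_apply, zero_mul, zero_sub, norm_neg, iteratedDeriv_zero] at h7
    rw [dist_zero_right]
    exact h7.trans_lt (by linarith)
  refine ⟨g, hg, hsupp, fun i l ε hε => ?_⟩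
  -- Convergence on [-(B + 1), B + 1] is enough: for larger |k|/2^n both the mask entry and the
  -- derivative vanish.
  obtain ⟨n₀, hn₀⟩ := hc i (B + 1) (by positivity) l ε hε
  refine ⟨n₀, fun n hn k => ?_⟩
  rcases le_or_gt |(k : ℝ)| (2 ^ n * (B + 1)) with hk | hk
  · exact hn₀ n hn k hk
  · have hp : (0 : ℝ) < 2 ^ n := by positivity
    have h8 : (B : ℤ) * (2 ^ n - 1) < |k| := by
      have h9 : (2 ^ n * (B + 1) : ℤ) < |k| := by exact_mod_cast hk
      have h10 : (0 : ℤ) < 2 ^ n := by positivity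
      have h11 : (0 : ℤ) ≤ B := by positivity
      linarith
    rw [maskIter_apply_eq_zero hB n h8, iteratedDeriv_eq_zero_of_forall_lt (hsupp i)]
    · simpa using hε.le
    · rw [abs_div, abs_of_pos hp, lt_div_iff₀ hp]
      linarith

/-! ### Moments of the limit functions -/

/-- Replacing the scaled mask entries by samples of the derivative changes the normalized sum by a
uniformly small amount, because about 2(B + 1)2^n terms carry weight 2^{-n}. What remains is a
Riemann sum. -/
theorem IsMaskLimit.tendsto_pairing {r m : ℕ} {a : FSeq r r} {g : Fin r → ℝ → ℂ}
    (h : IsMaskLimit a g) (hgm : ∀ i, ContDiff ℝ m (g i)) (hm : r ≤ m + 1) {B : ℕ}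
    (hB : ∀ k : ℤ, (B : ℤ) < |k| → a k = 0) (hg : ∀ i x, (B : ℝ) < |x| → g i x = 0)
    {G : ℝ → ℂ} (hG : Continuous G) (i l : Fin r) :
    Tendsto (fun n : ℕ => ((2 : ℂ) ^ n)⁻¹ * 2 ^ ((l : ℕ) * n) *
      pairing (maskIter a n) (fun b => G ((b : ℝ) / 2 ^ n)) i l) atTop
      (𝓝 (∫ x, G x * iteratedDeriv (l : ℕ) (g i) x)) := by
  have hc : Continuous (iteratedDeriv (l : ℕ) (g i)) :=
    (hgm i).continuous_iteratedDeriv l (by norm_cast; omega)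
  have h0 := iteratedDeriv_eq_zero_of_forall_lt (hg i) l
  have h1 := tendsto_riemann_sum (hG.mul hc) (M := B) fun x hx => by
    rw [Pi.mul_apply, h0 x hx, mul_zero]
  simp only [Pi.mul_apply] at h1
  obtain ⟨D, hD⟩ := (isCompact_Icc (a := -((B : ℝ) + 1)) (b := B + 1)).exists_bound_of_continuousOn
    hG.continuousOn
  have hD0 : 0 ≤ D := (norm_nonneg _).trans (hD 0 ⟨by linarith [Nat.cast_nonneg (α := ℝ) B], by positivity⟩)
  have h2 : ∀ n : ℕ, pairing (maskIter a n) (fun b => G ((b : ℝ) / 2 ^ n)) i l =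
      ∑ b ∈ Finset.Ico (-((B + 1) * 2 ^ n : ℤ)) ((B + 1) * 2 ^ n),
        G ((b : ℝ) / 2 ^ n) * maskIter a n b i l := by
    intro n
    rw [pairing_entry]
    refine Finset.sum_subset (fun b hb => ?_) fun b _ hb => by
      rw [Finsupp.notMem_support_iff.mp hb, Matrix.zero_apply, mul_zero]
    by_contra hc
    refine Finsupp.mem_support_iff.mp hb (maskIter_apply_eq_zero hB n ?_)
    have h10 : (0 : ℤ) < 2 ^ n := by positivity
    have h11 : (0 : ℤ) ≤ B := by positivity
    rw [Finset.mem_Ico, not_and_or, not_le, not_lt] at hc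
    rw [lt_abs]
    rcases hc with hc | hc
    · right; linarith
    · left; linarith
  have h3 : Tendsto (fun n : ℕ => ((2 : ℂ) ^ n)⁻¹ *
      ∑ b ∈ Finset.Ico (-((B + 1) * 2 ^ n : ℤ)) ((B + 1) * 2 ^ n), G ((b : ℝ) / 2 ^ n) *
        (maskIter a n b i l * 2 ^ ((l : ℕ) * n) -
          iteratedDeriv (l : ℕ) (g i) ((b : ℝ) / 2 ^ n))) atTop (𝓝 0) := by
    rw [Metric.tendsto_atTop]
    intro ε hε
    obtain ⟨n₀, hn₀⟩ := h i l (ε / (2 * (B + 1) * D + 1) / 2) (by positivity)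
    refine ⟨n₀, fun n hn => ?_⟩
    have hp : (0 : ℝ) < 2 ^ n := by positivity
    rw [dist_zero_right, norm_mul, norm_inv, norm_pow, Complex.norm_ofNat,
      inv_mul_lt_iff₀ hp]
    have h5 : ∀ b ∈ Finset.Ico (-((B + 1) * 2 ^ n : ℤ)) ((B + 1) * 2 ^ n),
        ‖G ((b : ℝ) / 2 ^ n) * (maskIter a n b i l * 2 ^ ((l : ℕ) * n) -
          iteratedDeriv (l : ℕ) (g i) ((b : ℝ) / 2 ^ n))‖ ≤
          D * (ε / (2 * (B + 1) * D + 1) / 2) := by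
      intro b hb
      rw [norm_mul]
      refine mul_le_mul (hD _ ?_) (hn₀ n hn b) (norm_nonneg _) hD0
      rw [Finset.mem_Ico] at hb
      constructor
      · rw [le_div_iff₀ hp]
        have : ((-((B + 1) * 2 ^ n) : ℤ) : ℝ) ≤ b := by exact_mod_cast hb.1
        push_cast at this
        linarith
      · rw [div_le_iff₀ hp]
        have : (b : ℝ) ≤ (((B + 1) * 2 ^ n : ℤ) : ℝ) := by exact_mod_cast hb.2.le
        push_cast at this
        linarith
    refine (norm_sum_le_of_le _ h5).trans_lt ?_
    rw [Finset.sum_const, Int.card_Ico, nsmul_eq_mul]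
    have h6 : (((((B + 1) * 2 ^ n : ℤ) - -((B + 1) * 2 ^ n : ℤ)).toNat : ℕ) : ℝ) =
        2 * (B + 1) * 2 ^ n := by
      have h7 : (0 : ℤ) ≤ ((B + 1) * 2 ^ n : ℤ) - -((B + 1) * 2 ^ n : ℤ) := by
        have : (0 : ℤ) ≤ ((B : ℤ) + 1) * 2 ^ n := by positivity
        linarith
      have h8 := Int.toNat_of_nonneg h7
      have h9 : ((((((B + 1) * 2 ^ n : ℤ) - -((B + 1) * 2 ^ n : ℤ)).toNat : ℕ) : ℤ) : ℝ) =
        (((B + 1) * 2 ^ n : ℤ) - -((B + 1) * 2 ^ n : ℤ) : ℤ) := by rw [h8]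
      rw [Int.cast_natCast] at h9
      rw [h9]; push_cast; ring
    rw [h6]
    have h7 : 2 * ((B : ℝ) + 1) * D * (ε / (2 * (B + 1) * D + 1)) ≤ ε := by
      rw [mul_div_assoc', div_le_iff₀ (by positivity)]
      nlinarith
    nlinarith
  have h4 := h3.add h1
  rw [zero_add] at h4
  refine h4.congr fun n => ?_
  rw [h2, ← mul_add, ← Finset.sum_add_distrib, mul_assoc]
  congr 1
  rw [Finset.mul_sum]
  refine Finset.sum_congr rfl fun b _ => ?_
  ring

/-- The iterated matching relation, tested on (x/2^N)^j, expresses the fixed j-th moment of v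
through scaled sums over A_N. These converge by `tendsto_pairing`, while the prefactor 2^{(l-j)N}
records the mismatch of scales. -/
theorem IsMaskLimit.tendsto_moment {r m n : ℕ} {a : FSeq r r} {g : Fin r → ℝ → ℂ} {v : FSeq 1 r}
    (h : IsMaskLimit a g) (hgm : ∀ i, ContDiff ℝ m (g i)) (hm : r ≤ m + 1) {B : ℕ}
    (hB : ∀ k : ℤ, (B : ℤ) < |k| → a k = 0) (hg : ∀ i x, (B : ℝ) < |x| → g i x = 0)
    (hv : IsMatchingFilter a v n) {j : ℕ} (hj : j < n) (l : Fin r) :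
    Tendsto (fun N : ℕ => (2 : ℂ) ^ ((l : ℕ) * N) * ((2 ^ N)⁻¹) ^ j *
      pairing v (fun k => (k : ℂ) ^ j) 0 l) atTop
      (𝓝 (∑ k ∈ v.support, ∑ i, v k 0 i *
        ∫ x : ℝ, ((k : ℂ) + x) ^ j * iteratedDeriv (l : ℕ) (g i) x)) := by
  have h1 : ∀ k : ℤ, ∀ i, Tendsto (fun N : ℕ => ((2 : ℂ) ^ N)⁻¹ * 2 ^ ((l : ℕ) * N) *
      pairing (maskIter a N) (fun b => ((k : ℂ) + ((b : ℝ) / 2 ^ N : ℝ)) ^ j) i l) atTop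
      (𝓝 (∫ x : ℝ, ((k : ℂ) + x) ^ j * iteratedDeriv (l : ℕ) (g i) x)) := fun k i =>
    h.tendsto_pairing hgm hm hB hg (G := fun x : ℝ => ((k : ℂ) + x) ^ j)
      ((continuous_const.add Complex.continuous_ofReal).pow j) i l
  have h2 := tendsto_finsetSum v.support fun k _ =>
    tendsto_finsetSum (Finset.univ : Finset (Fin r)) fun i _ => (h1 k i).const_mul (v k 0 i)
  refine h2.congr fun N => ?_
  have hp : (2 : ℂ) ^ N ≠ 0 := pow_ne_zero _ two_ne_zero
  have h3 := congrFun₂ (pairing_comb_maskIter hv N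
    (P := Polynomial.C (((2 : ℂ) ^ N)⁻¹ ^ j) * Polynomial.X ^ j)
    ((Polynomial.degree_C_mul_X_pow_le _ _).trans_lt (by exact_mod_cast hj))) 0 l
  simp only [Polynomial.eval_mul, Polynomial.eval_C, Polynomial.eval_pow, Polynomial.eval_X] at h3
  rw [pairing_comb_left, Finsupp.sum, Matrix.sum_apply] at h3
  have h4 : pairing v (fun k : ℤ => ((2 : ℂ) ^ N)⁻¹ ^ j * (k : ℂ) ^ j) =
      ((2 : ℂ) ^ N)⁻¹ ^ j • pairing v fun k => (k : ℂ) ^ j := (pairing v).map_smul _ _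
  rw [h4, Matrix.smul_apply, Matrix.smul_apply, smul_eq_mul, smul_eq_mul] at h3
  have h5 : ∀ k : ℤ, (fun b : ℤ => (((2 : ℂ) ^ N)⁻¹) ^ j * (((2 ^ N * k + b : ℤ) : ℂ)) ^ j) =
      fun b : ℤ => ((k : ℂ) + ((b : ℝ) / 2 ^ N : ℝ)) ^ j := by
    intro k
    funext b
    rw [← mul_pow]
    push_cast
    congr 1
    field_simp
  simp only [h5] at h3
  have h6 : (2 : ℂ) ^ ((l : ℕ) * N) * (((2 : ℂ) ^ N)⁻¹) ^ j * pairing v (fun k => (k : ℂ) ^ j) 0 l =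
      ((2 : ℂ) ^ N)⁻¹ * 2 ^ ((l : ℕ) * N) *
        ((2 : ℂ) ^ N * (((2 ^ N)⁻¹) ^ j * pairing v (fun k => (k : ℂ) ^ j) 0 l)) := by
    field_simp
  rw [h6, ← h3, Finset.mul_sum]
  refine Finset.sum_congr rfl fun k _ => ?_
  rw [Matrix.mul_apply, Finset.mul_sum]
  refine Finset.sum_congr rfl fun i _ => ?_
  ring

theorem eq_zero_of_tendsto_two_pow_mul {c L : ℂ}
    (h : Tendsto (fun N : ℕ => (2 : ℂ) ^ N * c) atTop (𝓝 L)) : c = 0 := by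
  have h1 : Tendsto (fun N : ℕ => ((2 : ℂ)⁻¹) ^ N * (2 ^ N * c)) atTop (𝓝 (0 * L)) :=
    (tendsto_pow_atTop_nhds_zero_of_norm_lt_one (by norm_num)).mul h
  rw [zero_mul] at h1
  refine tendsto_nhds_unique (tendsto_const_nhds.congr fun N => ?_) h1
  rw [← mul_assoc, ← mul_pow]
  norm_num

theorem eq_zero_of_tendsto_two_pow_mul_inv {c L : ℂ} {l j : ℕ} (hjl : j < l)
    (h : Tendsto (fun N : ℕ => (2 : ℂ) ^ (l * N) * ((2 ^ N)⁻¹) ^ j * c) atTop (𝓝 L)) : c = 0 := by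
  obtain ⟨d, rfl⟩ := Nat.exists_eq_add_of_lt hjl
  -- Of the growth 2^{(l-j)N} with l - j = d + 1, all but one factor 2^N is divided out; the limit
  -- stays finite.
  have h1 : Tendsto (fun N : ℕ => ((2 : ℂ)⁻¹ ^ d) ^ N *
      ((2 : ℂ) ^ ((j + d + 1) * N) * ((2 ^ N)⁻¹) ^ j * c)) atTop
      (𝓝 ((if d = 0 then 1 else 0) * L)) := by
    refine Tendsto.mul ?_ h
    split_ifs with hd
    · subst hd
      exact tendsto_const_nhds.congr fun N => by rw [pow_zero, one_pow]
    · refine tendsto_pow_atTop_nhds_zero_of_norm_lt_one ?_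
      rw [norm_pow]
      exact pow_lt_one₀ (norm_nonneg _) (by norm_num) hd
  refine eq_zero_of_tendsto_two_pow_mul (h1.congr fun N => ?_)
  have hp : (2 : ℂ) ^ N ≠ 0 := pow_ne_zero _ two_ne_zero
  rw [inv_pow, inv_pow, add_mul, add_mul, one_mul, pow_add, pow_add, inv_pow, ← pow_mul, ← pow_mul,
    mul_comm N j]
  field_simp

/-- Integration by parts l times; the power is differentiated down to the constant l!, so the shift
c disappears. -/
theorem integral_iteratedDeriv_pow_mul {G : ℝ → ℂ} {R : ℝ} {l : ℕ} (hG : ContDiff ℝ l G)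
    (hR : ∀ x, R < |x| → G x = 0) (c : ℂ) :
    ∫ x : ℝ, (c + x) ^ l * iteratedDeriv l G x = (-1) ^ l * (Nat.factorial l) * ∫ x, G x := by
  induction l with
  | zero => simp
  | succ l ih =>
    have hl : ContDiff ℝ l G := hG.of_le (by norm_cast; omega)
    have hc0 : ∀ j ≤ l + 1, Continuous (iteratedDeriv j G) := fun j hj =>
      hG.continuous_iteratedDeriv j (by exact_mod_cast hj)
    have hcs : ∀ j, HasCompactSupport (iteratedDeriv j G) := fun j =>
      hasCompactSupport_of_forall_lt (iteratedDeriv_eq_zero_of_forall_lt hR j)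
    have hp : ∀ j, Continuous fun x : ℝ => (c + x) ^ j := fun j =>
      (continuous_const.add Complex.continuous_ofReal).pow j
    have hu : ∀ x : ℝ, HasDerivAt (fun x : ℝ => (c + x) ^ (l + 1))
        (((l + 1 : ℕ) : ℂ) * (c + x) ^ l) x := by
      intro x
      have h1 : HasDerivAt (fun x : ℝ => c + (x : ℂ)) 1 x :=
        (Complex.ofRealCLM.hasDerivAt (x := x)).const_add c
      have h2 := h1.pow (l + 1)
      simp only [Nat.add_sub_cancel, mul_one] at h2
      exact h2
    have hd : ∀ x : ℝ, HasDerivAt (iteratedDeriv l G) (iteratedDeriv (l + 1) G x) x := by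
      intro x
      rw [iteratedDeriv_succ]
      exact ((hG.differentiable_iteratedDeriv l (by norm_cast; omega)) _).hasDerivAt
    have key := integral_mul_deriv_eq_deriv_mul_of_integrable (fun x _ => hu x)
      (fun x _ => hd x)
      (((hp (l + 1)).mul (hc0 (l + 1) le_rfl)).integrable_of_hasCompactSupport (hcs _).mul_left)
      (((continuous_const.mul (hp l)).mul (hc0 l (by omega))).integrable_of_hasCompactSupport
        (hcs _).mul_left)
      (((hp (l + 1)).mul (hc0 l (by omega))).integrable_of_hasCompactSupport (hcs _).mul_left)
    rw [key]
    simp only [mul_assoc]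
    rw [integral_const_mul, ih hl, Nat.factorial_succ]
    push_cast
    ring

/-- The entries of a matching filter of a mask with limit functions vanish to high order, and the
diagonal moments are determined. -/
theorem IsMaskLimit.moments {r m n : ℕ} {a : FSeq r r} {g : Fin r → ℝ → ℂ} {v : FSeq 1 r}
    (h : IsMaskLimit a g) (hgm : ∀ i, ContDiff ℝ m (g i)) (hm : r ≤ m + 1) {B : ℕ}
    (hB : ∀ k : ℤ, (B : ℤ) < |k| → a k = 0) (hg : ∀ i x, (B : ℝ) < |x| → g i x = 0)
    (hv : IsMatchingFilter a v n) {j : ℕ} (hj : j < n) (l : Fin r) (hjl : j ≤ l) :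
    pairing v (fun k => (k : ℂ) ^ j) 0 l = if j = l then (-1) ^ (l : ℕ) * (Nat.factorial l) *
      ∑ i, pairing v (fun _ => 1) 0 i * ∫ x, g i x else 0 := by
  have h1 := h.tendsto_moment hgm hm hB hg hv hj l
  split_ifs with hjl'
  · subst hjl'
    have h2 : ∀ N : ℕ, (2 : ℂ) ^ ((l : ℕ) * N) * ((2 ^ N)⁻¹) ^ (l : ℕ) = 1 := by
      intro N
      rw [inv_pow, ← pow_mul, mul_comm N, mul_inv_cancel₀ (pow_ne_zero _ two_ne_zero)]
    simp only [h2, one_mul] at h1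
    rw [tendsto_nhds_unique tendsto_const_nhds h1]
    have h3 : ∀ k : ℤ, ∀ i, ∫ x : ℝ, ((k : ℂ) + x) ^ (l : ℕ) * iteratedDeriv (l : ℕ) (g i) x =
        (-1) ^ (l : ℕ) * (Nat.factorial l) * ∫ x, g i x := fun k i =>
      integral_iteratedDeriv_pow_mul ((hgm i).of_le (by norm_cast; omega)) (hg i) _
    simp only [h3, pairing_entry, one_mul, Finset.sum_mul, Finset.mul_sum]
    rw [Finset.sum_comm]
    refine Finset.sum_congr rfl fun i _ => Finset.sum_congr rfl fun k _ => ?_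
    ring
  -- Off the diagonal a constant multiplied by an unbounded factor converges, so the constant is
  -- zero.
  · exact eq_zero_of_tendsto_two_pow_mul_inv (lt_of_le_of_ne hjl hjl') h1

/-- The mass of a matching filter is concentrated in its first entry, and the first limit function
has integral one. -/
theorem IsMaskLimit.mass {r m n : ℕ} {a : FSeq r r} {g : Fin r → ℝ → ℂ} {v : FSeq 1 r}
    (h : IsMaskLimit a g) (hgm : ∀ i, ContDiff ℝ m (g i)) (hr : 0 < r) (hm : r ≤ m + 1) {B : ℕ}
    (hB : ∀ k : ℤ, (B : ℤ) < |k| → a k = 0) (hg : ∀ i x, (B : ℝ) < |x| → g i x = 0)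
    (hv : IsMatchingFilter a v n) (hn : 0 < n) :
    (∀ l : Fin r, (l : ℕ) ≠ 0 → pairing v (fun _ => 1) 0 l = 0) ∧
      pairing v (fun _ => 1) 0 ⟨0, hr⟩ ≠ 0 ∧ ∫ x, g ⟨0, hr⟩ x = 1 := by
  have h1 : ∀ l : Fin r, (l : ℕ) ≠ 0 → pairing v (fun _ => 1) 0 l = 0 := by
    intro l hl
    have h2 := h.moments hgm hm hB hg hv hn l (Nat.zero_le _)
    rw [if_neg (Ne.symm hl)] at h2
    simpa using h2
  have h3 : pairing v (fun _ => 1) 0 ⟨0, hr⟩ ≠ 0 := by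
    intro h0
    refine (isMatchingFilter_iff.mp hv).1 ?_
    ext i l
    rw [Subsingleton.elim i 0, Matrix.zero_apply]
    by_cases hl : (l : ℕ) = 0
    · rw [show l = ⟨0, hr⟩ from Fin.ext hl, h0]
    · exact h1 l hl
  refine ⟨h1, h3, ?_⟩
  -- The diagonal moment for l = 0 reads v̂_0(0) = v̂_0(0) ∫ g_0, and v̂_0(0) is nonzero since the
  -- other entries of v̂(0) vanish.
  have h2 := h.moments hgm hm hB hg hv hn ⟨0, hr⟩ (Nat.zero_le _)
  rw [if_pos rfl, Finset.sum_eq_single ⟨0, hr⟩] at h2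
  · simp only [pow_zero, Nat.factorial_zero, Nat.cast_one, one_mul] at h2
    exact mul_left_cancel₀ h3 (by rw [mul_one]; exact h2.symm)
  · intro l _ hl
    rw [h1 l fun h => hl (Fin.ext h), zero_mul]
  · simp

theorem iteratedDeriv_I_mul_pow (l : ℕ) : ∀ j ≤ l,
    iteratedDeriv j (fun ξ : ℝ => (Complex.I * (ξ : ℂ)) ^ l) =
      fun ξ : ℝ => Complex.I ^ j * (l.descFactorial j) * (Complex.I * (ξ : ℂ)) ^ (l - j) := by
  intro j hj
  induction j with
  | zero => simp
  | succ j ih =>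
    rw [iteratedDeriv_succ, ih (by omega)]
    funext ξ
    have h1 : HasDerivAt (fun ξ : ℝ => Complex.I * (ξ : ℂ)) Complex.I ξ := by
      have := (Complex.ofRealCLM.hasDerivAt (x := ξ)).const_mul Complex.I
      simpa using this
    have h2 := (h1.pow (l - j)).const_mul (Complex.I ^ j * (l.descFactorial j : ℂ))
    refine h2.deriv.trans ?_
    rw [Nat.descFactorial_succ, show l - (j + 1) = l - j - 1 by omega]
    push_cast
    ring

theorem isHermiteFilter_iff {r : ℕ} {v : FSeq 1 r} :
    IsHermiteFilter v ↔ ∀ l : Fin r, ∀ j ≤ (l : ℕ), pairing v (fun k => (k : ℂ) ^ j) 0 l =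
      if j = l then (-1) ^ (l : ℕ) * (Nat.factorial l : ℂ) else 0 := by
  refine forall_congr' fun l => forall_congr' fun j => ?_
  rw [Nat.lt_succ_iff]
  refine forall_congr' fun hj => ?_
  rw [iteratedDeriv_symbol_zero, iteratedDeriv_I_mul_pow _ _ hj]
  have hI : (-Complex.I) ^ j ≠ 0 := neg_I_pow_ne_zero j
  have h1 : Complex.I ^ j = (-Complex.I) ^ j * (-1) ^ j := by rw [← mul_pow]; simp
  split_ifs with h
  · subst h
    simp only [Nat.sub_self, pow_zero, mul_one, Nat.descFactorial_self]
    rw [h1, mul_assoc]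
    exact mul_right_inj' hI
  · have h2 : (l : ℕ) - j ≠ 0 := by omega
    simp [h2]

theorem IsMaskLimit.isHermiteFilter {r m : ℕ} {a : FSeq r r} {g : Fin r → ℝ → ℂ} {v : FSeq 1 r}
    (h : IsMaskLimit a g) (hgm : ∀ i, ContDiff ℝ m (g i)) (hr : 0 < r) (hm : r ≤ m + 1) {B : ℕ}
    (hB : ∀ k : ℤ, (B : ℤ) < |k| → a k = 0) (hg : ∀ i x, (B : ℝ) < |x| → g i x = 0)
    (hv : IsMatchingFilter a v r) (hv1 : pairing v (fun _ => 1) 0 ⟨0, hr⟩ = 1) :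
    IsHermiteFilter v := by
  obtain ⟨h1, -, h3⟩ := h.mass hgm hr hm hB hg hv hr
  rw [isHermiteFilter_iff]
  intro l j hj
  rw [h.moments hgm hm hB hg hv (by omega) l hj, Finset.sum_eq_single ⟨0, hr⟩, h3, hv1]
  · simp
  · intro l _ hl
    rw [h1 l fun h => hl (Fin.ext h), zero_mul]
  · simp

/-! ### Identification of the refinable distributions with the limit functions. -/

theorem IsRefinable.iterate {r : ℕ} {a : FSeq r r} {φ : Fin r → 𝓢'(ℝ, ℂ)} (hφ : IsRefinable a φ)
    (n : ℕ) (i : Fin r) (ξ : ℝ) : (2 : ℂ) ^ n * fourierFn (φ i) (2 ^ n * ξ) =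
      ∑ l, symbol (maskIter a n) ξ i l * fourierFn (φ l) ξ := by
  suffices h : (2 : ℂ) ^ n • (fun i => fourierFn (φ i) (2 ^ n * ξ)) =
      symbol (maskIter a n) ξ *ᵥ fun i => fourierFn (φ i) ξ by
    exact congrFun h i
  induction n generalizing ξ with
  | zero =>
    have h1 : symbol (maskIter a 0) ξ = 1 := by
      rw [maskIter_zero, symbol_eq_pairing, pairing_single]; simp
    simp [h1]
  | succ n ih =>
    have h1 : symbol (maskIter a (n + 1)) ξ = (2 : ℂ) • (symbol (maskIter a n) (2 * ξ) * symbol a ξ) := by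
      rw [maskIter_succ, symbol_eq_pairing, map_smul, LinearMap.smul_apply, ← symbol_eq_pairing,
        symbol_comb]
      push_cast
      rfl
    have h2 := ih (2 * ξ)
    rw [h1, Matrix.smul_mulVec, ← Matrix.mulVec_mulVec, ← hφ ξ, ← h2, smul_smul, ← pow_succ',
      pow_succ (2 : ℝ), mul_assoc]

/-- Iterate the refinement equation at ξ/2^n. The symbol of A_n divided by 2^n is a Riemann sum;
column l comes with an extra factor 2^{-ln}, so only column 0 survives in the limit and yields the
Fourier transform of g_i. -/
theorem IsMaskLimit.isGivenBy {r m : ℕ} {a : FSeq r r} {g : Fin r → ℝ → ℂ}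
    (h : IsMaskLimit a g) (hgm : ∀ i, ContDiff ℝ m (g i)) (hr : 0 < r) (hm : r ≤ m + 1) {B : ℕ}
    (hB : ∀ k : ℤ, (B : ℤ) < |k| → a k = 0) (hg : ∀ i x, (B : ℝ) < |x| → g i x = 0)
    {φ : Fin r → 𝓢'(ℝ, ℂ)} (hφc : ∀ i, IsCompactlySupported (φ i)) (hφ : IsRefinable a φ)
    (hφ1 : fourierFn (φ ⟨0, hr⟩) 0 = 1) (i : Fin r) : IsGivenBy (φ i) (g i) := by
  refine isGivenBy_of_fourierFn_eq (hφc i) (hgm i).continuous (hg i) fun ξ => ?_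
  set G : ℝ → ℂ := fun x => Complex.exp (-(Complex.I * (x : ℂ) * (ξ : ℂ))) with hGdef
  have hG : Continuous G := by fun_prop
  have h1 : ∀ l : Fin r, Tendsto (fun n : ℕ => (((2 : ℂ) ^ n)⁻¹ * 2 ^ ((l : ℕ) * n) *
      pairing (maskIter a n) (fun b => G ((b : ℝ) / 2 ^ n)) i l) *
        (((2 : ℂ) ^ ((l : ℕ) * n))⁻¹ * fourierFn (φ l) (ξ / 2 ^ n))) atTop
      (𝓝 ((∫ x, G x * iteratedDeriv (l : ℕ) (g i) x) *
        ((if (l : ℕ) = 0 then 1 else 0) * fourierFn (φ l) 0))) := by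
    intro l
    refine (h.tendsto_pairing hgm hm hB hg hG i l).mul (Tendsto.mul ?_ ?_)
    · split_ifs with hl
      · simp [hl]
      · simp only [pow_mul, ← inv_pow]
        refine tendsto_pow_atTop_nhds_zero_of_norm_lt_one ?_
        rw [norm_pow]
        exact pow_lt_one₀ (norm_nonneg _) (by norm_num) hl
    · refine (tendsto_fourierFn (hφc l)).comp ?_
      have h2 : Tendsto (fun n : ℕ => ξ * (1 / 2 : ℝ) ^ n) atTop (𝓝 (ξ * 0)) :=
        (tendsto_pow_atTop_nhds_zero_of_lt_one (by norm_num) (by norm_num)).const_mul ξ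
      rw [mul_zero] at h2
      refine h2.congr fun n => ?_
      rw [_root_.one_div_pow, mul_one_div]
  have h2 := tendsto_finsetSum (Finset.univ : Finset (Fin r)) fun l _ => h1 l
  rw [Finset.sum_eq_single ⟨0, hr⟩ (fun l _ hl => by
    rw [if_neg fun h => hl (Fin.ext h), zero_mul, mul_zero]) (by simp), if_pos rfl, hφ1] at h2
  simp only [iteratedDeriv_zero, mul_one] at h2
  simp only [mul_comm (g i _)]
  refine tendsto_nhds_unique (tendsto_const_nhds.congr fun n => ?_) h2
  have hp : (2 : ℂ) ^ n ≠ 0 := pow_ne_zero _ two_ne_zero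
  have h3 := hφ.iterate n i (ξ / 2 ^ n)
  rw [mul_div_cancel₀ _ (by positivity)] at h3
  rw [← mul_right_inj' hp, h3, Finset.mul_sum]
  refine Finset.sum_congr rfl fun l _ => ?_
  have h4 : symbol (maskIter a n) (ξ / 2 ^ n) =
      pairing (maskIter a n) fun b => G ((b : ℝ) / 2 ^ n) := by
    rw [symbol_eq_pairing]
    congr 1
    funext b
    simp only [hGdef]
    push_cast
    congr 1
    ring
  rw [h4]
  have hq : (2 : ℂ) ^ ((l : ℕ) * n) ≠ 0 := pow_ne_zero _ two_ne_zero
  field_simp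

/-! ### Smoothness exponents of masks with limit functions -/

/-- For t ≥ 1 the numbers 2^{tn} A_n(·)_{it} stay bounded, so these columns are O(2^{-n}). Hence
only column 0 contributes to limits of A_n * u without scaling. -/
theorem IsMaskLimit.eventually_entry {r m : ℕ} {a : FSeq r r} {g : Fin r → ℝ → ℂ}
    (h : IsMaskLimit a g) (hgm : ∀ i, ContDiff ℝ m (g i)) (hm : r ≤ m + 1) {R : ℝ}
    (hg : ∀ i x, R < |x| → g i x = 0) (j : ℤ) (t i : Fin r) {ε : ℝ} (hε : 0 < ε) :
    ∀ᶠ n in atTop, ∀ k : ℤ, ‖maskIter a n (k - j) i t -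
      (if (t : ℕ) = 0 then g i ((k : ℝ) / 2 ^ n) else 0)‖ ≤ ε := by
  split_ifs with ht
  · obtain ⟨n₁, h₁⟩ := h i t (ε / 2) (by positivity)
    obtain ⟨δ, hδ, hu⟩ := exists_dist_le_of_forall_lt (hgm i).continuous (hg i)
      (by positivity : 0 < ε / 2)
    have h3 : Tendsto (fun n : ℕ => |(j : ℝ)| * (1 / 2) ^ n) atTop (𝓝 (|(j : ℝ)| * 0)) :=
      (tendsto_pow_atTop_nhds_zero_of_lt_one (by norm_num) (by norm_num)).const_mul _
    rw [mul_zero] at h3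
    filter_upwards [eventually_ge_atTop n₁, h3.eventually (gt_mem_nhds hδ)] with n hn hn2 k
    have h4 := h₁ n hn (k - j)
    rw [ht, zero_mul, pow_zero, mul_one, iteratedDeriv_zero] at h4
    have h5 := hu (((k - j : ℤ) : ℝ) / 2 ^ n) ((k : ℝ) / 2 ^ n) (by
      rw [← sub_div, abs_div, abs_of_pos (by positivity : (0 : ℝ) < 2 ^ n)]
      push_cast
      rw [sub_sub_cancel_left, abs_neg]
      rw [_root_.one_div_pow, mul_one_div] at hn2
      exact hn2)
    have h6 := norm_sub_le_norm_sub_add_norm_sub (maskIter a n (k - j) i t)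
      (g i (((k - j : ℤ) : ℝ) / 2 ^ n)) (g i ((k : ℝ) / 2 ^ n))
    linarith
  · obtain ⟨n₁, h₁⟩ := h i t 1 one_pos
    obtain ⟨D, hD0, hD⟩ := exists_bound_of_forall_lt
      ((hgm i).continuous_iteratedDeriv t (by norm_cast; omega))
      (iteratedDeriv_eq_zero_of_forall_lt (hg i) t)
    have h3 : Tendsto (fun n : ℕ => (1 + D) * (1 / 2) ^ n) atTop (𝓝 ((1 + D) * 0)) :=
      (tendsto_pow_atTop_nhds_zero_of_lt_one (by norm_num) (by norm_num)).const_mul _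
    rw [mul_zero] at h3
    filter_upwards [eventually_ge_atTop n₁, h3.eventually (gt_mem_nhds hε)] with n hn hn2 k
    have h4 := h₁ n hn (k - j)
    have h5 := norm_le_norm_add_norm_sub' (maskIter a n (k - j) i t * 2 ^ ((t : ℕ) * n))
      (iteratedDeriv (t : ℕ) (g i) (((k - j : ℤ) : ℝ) / 2 ^ n))
    have h6 := hD (((k - j : ℤ) : ℝ) / 2 ^ n)
    rw [norm_mul, norm_pow, Complex.norm_ofNat] at h5
    have h7 : (2 : ℝ) ^ n ≤ 2 ^ ((t : ℕ) * n) := by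
      refine pow_le_pow_right₀ (by norm_num) (Nat.le_mul_of_pos_left _ (by omega))
    have h8 : ‖maskIter a n (k - j) i t‖ * 2 ^ n ≤ 1 + D := by
      have := mul_le_mul_of_nonneg_left h7 (norm_nonneg (maskIter a n (k - j) i t))
      linarith
    rw [sub_zero]
    rw [_root_.one_div_pow, mul_one_div] at hn2
    rw [← le_div_iff₀ (by positivity)] at h8
    linarith

/-- Convolutions of the iterated masks with finite sequences. -/
theorem IsMaskLimit.eventually_sum {r m : ℕ} {a : FSeq r r} {g : Fin r → ℝ → ℂ}
    (h : IsMaskLimit a g) (hgm : ∀ i, ContDiff ℝ m (g i)) (hr : 0 < r) (hm : r ≤ m + 1) {R : ℝ}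
    (hg : ∀ i x, R < |x| → g i x = 0) {ι : Type*} (S : Finset ι) (j : ι → ℤ) (c : ι → Fin r → ℂ)
    {ε : ℝ} (hε : 0 < ε) : ∀ᶠ n in atTop, ∀ (k : ℤ) (i : Fin r),
      ‖∑ p ∈ S, ∑ t, maskIter a n (k - j p) i t * c p t -
        g i ((k : ℝ) / 2 ^ n) * ∑ p ∈ S, c p ⟨0, hr⟩‖ ≤ ε := by
  set D : ℝ := ∑ p ∈ S, ∑ t, ‖c p t‖ with hD
  have hD0 : 0 ≤ D := by positivity
  have h1 : ∀ᶠ n in atTop, ∀ p ∈ S, ∀ t i : Fin r, ∀ k : ℤ, ‖maskIter a n (k - j p) i t -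
      (if (t : ℕ) = 0 then g i ((k : ℝ) / 2 ^ n) else 0)‖ ≤ ε / (D + 1) := by
    rw [Filter.eventually_all_finset]
    intro p _
    rw [Filter.eventually_all]
    intro t
    rw [Filter.eventually_all]
    intro i
    exact h.eventually_entry hgm hm hg (j p) t i (by positivity)
  filter_upwards [h1] with n hn k i
  have h2 : ∑ p ∈ S, ∑ t, maskIter a n (k - j p) i t * c p t -
      g i ((k : ℝ) / 2 ^ n) * ∑ p ∈ S, c p ⟨0, hr⟩ = ∑ p ∈ S, ∑ t, (maskIter a n (k - j p) i t -
        (if (t : ℕ) = 0 then g i ((k : ℝ) / 2 ^ n) else 0)) * c p t := by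
    rw [Finset.mul_sum, ← Finset.sum_sub_distrib]
    refine Finset.sum_congr rfl fun p _ => ?_
    simp only [sub_mul, Finset.sum_sub_distrib]
    congr 1
    rw [Finset.sum_eq_single ⟨0, hr⟩]
    · simp
    · intro t _ ht
      rw [if_neg fun h => ht (Fin.ext h), zero_mul]
    · simp
  rw [h2]
  calc _ ≤ ∑ p ∈ S, ∑ t, ε / (D + 1) * ‖c p t‖ := by
        refine norm_sum_le_of_le _ fun p hp => norm_sum_le_of_le _ fun t _ => ?_
        rw [norm_mul]
        exact mul_le_mul_of_nonneg_right (hn p hp t i k) (norm_nonneg _)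
    _ = ε / (D + 1) * D := by simp only [hD, Finset.mul_sum]
    _ ≤ ε := by
        rw [div_mul_eq_mul_div, div_le_iff₀ (by positivity)]
        nlinarith

theorem IsMaskLimit.eventually_win {r m : ℕ} {a : FSeq r r} {g : Fin r → ℝ → ℂ}
    (h : IsMaskLimit a g) (hgm : ∀ i, ContDiff ℝ m (g i)) (hr : 0 < r) (hm : r ≤ m + 1) {R : ℝ}
    (hg : ∀ i x, R < |x| → g i x = 0) {N : ℕ} (w : Window N r) {ε : ℝ} (hε : 0 < ε) :
    ∀ᶠ n in atTop, ∀ (k : ℤ) (i : Fin r), ‖win (maskIter a n) N k i w -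
      g i ((k : ℝ) / 2 ^ n) * ∑ j : Finset.Icc (-(N : ℤ)) N, w (j, ⟨0, hr⟩)‖ ≤ ε := by
  simp only [win_apply]
  exact h.eventually_sum hgm hr hm hg Finset.univ (fun j : Finset.Icc (-(N : ℤ)) N => (j : ℤ))
    (fun j t => w (j, t)) hε

theorem comb_one_apply {r : ℕ} (A : FSeq r r) (u : FSeq r 1) (k : ℤ) (i : Fin r) :
    comb 1 A u k i 0 = ∑ p ∈ u.support, ∑ t, A (k - p) i t * u p t 0 := by
  rw [← conv_eq_comb, conv, Matrix.sum_apply]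
  simp only [Matrix.mul_apply]

theorem IsMaskLimit.eventually_comb {r m : ℕ} {a : FSeq r r} {g : Fin r → ℝ → ℂ}
    (h : IsMaskLimit a g) (hgm : ∀ i, ContDiff ℝ m (g i)) (hr : 0 < r) (hm : r ≤ m + 1) {R : ℝ}
    (hg : ∀ i x, R < |x| → g i x = 0) (u : FSeq r 1) {ε : ℝ} (hε : 0 < ε) :
    ∀ᶠ n in atTop, ∀ (k : ℤ) (i : Fin r), ‖comb 1 (maskIter a n) u k i 0 -
      g i ((k : ℝ) / 2 ^ n) * pairing u (fun _ => 1) ⟨0, hr⟩ 0‖ ≤ ε := by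
  simp only [comb_one_apply, pairing_entry, one_mul]
  exact h.eventually_sum hgm hr hm hg u.support (fun p => p) (fun p t => u p t 0) hε

/-- The comparison of limits along a dilated grid. -/
theorem eq_of_dilated_limits {r m : ℕ} {g : Fin r → ℝ → ℂ}
    (hgm : ∀ i, ContDiff ℝ m (g i)) (hr : 0 < r) (h0 : g ⟨0, hr⟩ ≠ 0)
    {F G : ℕ → ℤ → Fin r → ℂ} {c d : ℂ} {p : ℕ} {e : ℤ}
    (hFG : ∀ n k i, F (n + p) (e + 2 ^ p * k) i = G n k i)
    (hF : ∀ ε > 0, ∀ᶠ n in atTop, ∀ (k : ℤ) (i : Fin r), ‖F n k i - g i ((k : ℝ) / 2 ^ n) * c‖ ≤ ε)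
    (hG : ∀ ε > 0, ∀ᶠ n in atTop, ∀ (k : ℤ) (i : Fin r), ‖G n k i - g i ((k : ℝ) / 2 ^ n) * d‖ ≤ ε) :
    c = d := by
  obtain ⟨x, hx⟩ := Function.ne_iff.mp h0
  have hk := tendsto_floor_div x
  have hlim : ∀ {F : ℕ → ℤ → Fin r → ℂ} {c : ℂ} {k : ℕ → ℤ},
      (∀ ε > 0, ∀ᶠ n in atTop, ∀ (k : ℤ) (i : Fin r), ‖F n k i - g i ((k : ℝ) / 2 ^ n) * c‖ ≤ ε) →
      Tendsto (fun n : ℕ => (k n : ℝ) / 2 ^ n) atTop (𝓝 x) →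
      Tendsto (fun n => F n (k n) ⟨0, hr⟩) atTop (𝓝 (g ⟨0, hr⟩ x * c)) := by
    intro F c k hF hk
    have h1 := (((hgm ⟨0, hr⟩).continuous.tendsto x).comp hk).mul_const c
    have h2 : Tendsto (fun n => F n (k n) ⟨0, hr⟩ - g ⟨0, hr⟩ ((k n : ℝ) / 2 ^ n) * c) atTop
        (𝓝 0) := by
      rw [Metric.tendsto_nhds]
      intro ε hε
      filter_upwards [hF (ε / 2) (by positivity)] with n hn
      rw [dist_zero_right]
      exact (hn _ _).trans_lt (by linarith)
    have h3 := h2.add h1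
    rw [zero_add] at h3
    exact h3.congr fun n => by simp
  -- These indices stay in the coset of e modulo 2^p, yet their dyadic points still converge to x.
  let k' : ℕ → ℤ := fun n => e + 2 ^ p * ⌊2 ^ (n - p) * x⌋
  have hk' : Tendsto (fun n : ℕ => (k' n : ℝ) / 2 ^ n) atTop (𝓝 x) := by
    rw [← tendsto_add_atTop_iff_nat p]
    have h1 : Tendsto (fun n : ℕ => (e : ℝ) / 2 ^ p * (1 / 2) ^ n) atTop (𝓝 ((e : ℝ) / 2 ^ p * 0)) :=
      (tendsto_pow_atTop_nhds_zero_of_lt_one (by norm_num) (by norm_num)).const_mul _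
    have h2 := h1.add hk
    rw [mul_zero, zero_add] at h2
    refine h2.congr fun n => ?_
    simp only [k', Nat.add_sub_cancel]
    push_cast
    rw [pow_add, _root_.one_div_pow]
    field_simp
  have h1 := (tendsto_add_atTop_iff_nat p).mpr (hlim hF hk')
  have h2 := hlim hG hk
  refine mul_left_cancel₀ hx (tendsto_nhds_unique h1 (h2.congr fun n => ?_))
  rw [← hFG]
  simp only [k', Nat.add_sub_cancel]

/-- The sum of the first component determines the limit of A_n * w, and passing to a dilated grid
does not change this limit. As g_0 is not identically zero, the sum is invariant under every
contraction. -/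
theorem IsMaskLimit.sum_contr {r m : ℕ} {a : FSeq r r} {g : Fin r → ℝ → ℂ}
    (h : IsMaskLimit a g) (hgm : ∀ i, ContDiff ℝ m (g i)) (hr : 0 < r) (hm : r ≤ m + 1)
    (h0 : g ⟨0, hr⟩ ≠ 0) {R : ℝ} (hg : ∀ i x, R < |x| → g i x = 0) {B N : ℕ}
    (hB : ∀ k : ℤ, (B : ℤ) < |k| → a k = 0) (hN : B ≤ N) (p : ℕ) {e : ℤ} (he : 0 ≤ e)
    (he' : e < 2 ^ p) (w : Window N r) :
    ∑ j : Finset.Icc (-(N : ℤ)) N, w (j, ⟨0, hr⟩) =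
      ∑ j : Finset.Icc (-(N : ℤ)) N, contr a N p e w (j, ⟨0, hr⟩) :=
  eq_of_dilated_limits hgm hr h0
    (F := fun n k i => win (maskIter a n) N k i w)
    (G := fun n k i => win (maskIter a n) N k i (contr a N p e w))
    (fun n _ i => win_add hB hN n p he he' i w) (fun _ hε => h.eventually_win hgm hr hm hg w hε)
    fun _ hε => h.eventually_win hgm hr hm hg _ hε

/-- The sum over the integers along the two cosets of the even integers. -/
theorem sum_support_eq_sum_cosets {s t : ℕ} {u : FSeq s t} {B N : ℕ}
    (hB : ∀ k : ℤ, (B : ℤ) < |k| → u k = 0) (hN : B ≤ N) (F : ℤ → ℂ) (i : Fin s) (l : Fin t) :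
    pairing u F i l = ∑ j : Finset.Icc (-(N : ℤ)) N, F (2 * j) * u (2 * j) i l +
      ∑ j : Finset.Icc (-(N : ℤ)) N, F (1 + 2 * j) * u (1 + 2 * j) i l := by
  rw [pairing_entry, Finset.sum_coe_sort _ fun j => F (2 * j) * u (2 * j) i l,
    Finset.sum_coe_sort _ fun j => F (1 + 2 * j) * u (1 + 2 * j) i l]
  have h1 : u.support ⊆ (Finset.Icc (-(N : ℤ)) N).image (fun j => 2 * j) ∪
      (Finset.Icc (-(N : ℤ)) N).image (fun j => 1 + 2 * j) := by
    intro k hk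
    have h2 : |k| ≤ B := by
      by_contra! hc
      exact Finsupp.mem_support_iff.mp hk (hB k hc)
    have h3 : (B : ℤ) ≤ N := by exact_mod_cast hN
    rw [abs_le] at h2
    rw [Finset.mem_union, Finset.mem_image, Finset.mem_image]
    rcases Int.even_or_odd' k with ⟨j, hj | hj⟩
    · exact Or.inl ⟨j, Finset.mem_Icc.mpr ⟨by omega, by omega⟩, hj.symm⟩
    · exact Or.inr ⟨j, Finset.mem_Icc.mpr ⟨by omega, by omega⟩, by omega⟩
  rw [Finset.sum_subset h1 fun k _ hk => by
    rw [Finsupp.notMem_support_iff.mp hk, Matrix.zero_apply, mul_zero], Finset.sum_union,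
    Finset.sum_image, Finset.sum_image]
  · intro x _ y _ hxy
    simp only at hxy
    omega
  · intro x _ y _ hxy
    simp only at hxy
    omega
  · rw [Finset.disjoint_left]
    intro k h2 h3
    obtain ⟨x, -, rfl⟩ := Finset.mem_image.mp h2
    obtain ⟨y, -, hy⟩ := Finset.mem_image.mp h3
    omega

/-- Apply the invariance of the first-component sum, with p = 1, to unit windows: row 0 of the mask
sums to (1/2) e_0 over each parity class. Adding the classes gives the matching relation for e_0,
and subtracting them gives the sum rule. -/
theorem IsMaskLimit.hasSumRules_one {r m : ℕ} {a : FSeq r r} {g : Fin r → ℝ → ℂ}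
    (h : IsMaskLimit a g) (hgm : ∀ i, ContDiff ℝ m (g i)) (hr : 0 < r) (hm : r ≤ m + 1)
    (h0 : g ⟨0, hr⟩ ≠ 0) {R : ℝ} (hg : ∀ i x, R < |x| → g i x = 0) :
    HasSumRules a (Finsupp.single 0 (Matrix.single 0 ⟨0, hr⟩ 1)) 1 := by
  obtain ⟨B, hB⟩ := exists_support_bound a
  have h1 : ∀ e : ℤ, 0 ≤ e → e < 2 → ∀ l : Fin r,
      ∑ j : Finset.Icc (-(B : ℤ)) B, a (e + 2 * j) ⟨0, hr⟩ l = if l = ⟨0, hr⟩ then 1 / 2 else 0 := by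
    intro e he he' l
    have h0B : (0 : ℤ) ∈ Finset.Icc (-(B : ℤ)) B := by simp
    have h2 := h.sum_contr hgm hr hm h0 hg hB le_rfl 1 he (by simpa using he')
      (Pi.single (⟨0, h0B⟩, l) 1)
    have h3 : ∀ q, contr a B 1 e (Pi.single (⟨0, h0B⟩, l) 1) q = 2 * a (e + 2 * q.1) q.2 l := by
      intro q
      rw [contr_apply, win_apply, Finset.sum_eq_single ⟨0, h0B⟩, Finset.sum_eq_single l]
      · simp [maskIter_one]
      · intro t _ ht
        rw [Pi.single_eq_of_ne (by simpa using ht), mul_zero]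
      · simp
      · intro j _ hj
        refine Finset.sum_eq_zero fun t _ => ?_
        rw [Pi.single_eq_of_ne fun h => hj (congrArg Prod.fst h), mul_zero]
      · simp
    simp only [h3] at h2
    rw [← Finset.mul_sum, Finset.sum_eq_single ⟨0, h0B⟩] at h2
    · rw [eq_div_of_mul_eq two_ne_zero ((mul_comm _ _).trans h2.symm), Pi.single_apply]
      simp [eq_comm, Prod.ext_iff, ite_div]
    · intro j _ hj
      rw [Pi.single_eq_of_ne fun h => hj (congrArg Prod.fst h)]
    · simp
  have h2 : ∀ (F : ℤ → ℂ) (l : Fin r), pairing (comb 2 (Finsupp.single 0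
      (Matrix.single (0 : Fin 1) ⟨0, hr⟩ (1 : ℂ)) : FSeq 1 r) a) F 0 l = pairing a F ⟨0, hr⟩ l := by
    intro F l
    rw [pairing_comb_left, Finsupp.sum_single_index (by simp)]
    simp
  have h3 : pairing (Finsupp.single 0 (Matrix.single (0 : Fin 1) ⟨0, hr⟩ (1 : ℂ)) : FSeq 1 r)
      (fun _ => 1) = Matrix.single (0 : Fin 1) ⟨0, hr⟩ (1 : ℂ) := by
    rw [pairing_single, one_smul]
  rw [hasSumRules_iff, isMatchingFilter_iff, h3]
  have h4 := h1 0 le_rfl (by norm_num)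
  have h5 := h1 1 (by norm_num) (by norm_num)
  simp only [zero_add] at h4
  refine ⟨⟨?_, ?_⟩, ?_⟩
  · intro hc
    simpa using congrFun₂ hc 0 ⟨0, hr⟩
  · intro j hj
    obtain rfl : j = 0 := by omega
    simp only [pow_zero]
    rw [h3]
    ext i l
    rw [Subsingleton.elim i 0, h2, sum_support_eq_sum_cosets hB le_rfl]
    simp only [one_mul, h4, h5, Matrix.single_apply]
    by_cases hl : l = ⟨0, hr⟩
    · subst hl; norm_num
    · simp [hl, Ne.symm hl]
  · intro j hj
    obtain rfl : j = 0 := by omega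
    ext i l
    rw [Subsingleton.elim i 0, h2, sum_support_eq_sum_cosets hB le_rfl]
    have he : ∀ j : ℤ, (-1 : ℂ) ^ (2 * j) = 1 := fun j => by
      rw [_root_.zpow_mul]; norm_num
    have ho : ∀ j : ℤ, (-1 : ℂ) ^ (1 + 2 * j) = -1 := fun j => by
      rw [zpow_add₀ (by norm_num), he]; norm_num
    simp only [pow_zero, one_mul, he, ho, neg_mul, Finset.sum_neg_distrib, h4, h5]
    simp

/-- The kernel of the first-component sum is invariant by `sum_contr`, and on it A_n * w tends to
zero uniformly. -/
theorem IsMaskLimit.exists_decay {r m : ℕ} {a : FSeq r r} {g : Fin r → ℝ → ℂ}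
    (h : IsMaskLimit a g) (hgm : ∀ i, ContDiff ℝ m (g i)) (hr : 0 < r) (hm : r ≤ m + 1)
    (h0 : g ⟨0, hr⟩ ≠ 0) {R : ℝ} (hg : ∀ i x, R < |x| → g i x = 0) {B N : ℕ}
    (hB : ∀ k : ℤ, (B : ℤ) < |k| → a k = 0) (hN : B ≤ N) :
    ∃ C q : ℝ, 0 ≤ C ∧ 1 / 2 ≤ q ∧ q < 1 ∧ ∀ n k i, ∀ w : Window N r,
      ∑ j : Finset.Icc (-(N : ℤ)) N, w (j, ⟨0, hr⟩) = 0 →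
        ‖win (maskIter a n) N k i w‖ ≤ C * q ^ n * ‖w‖ := by
  let σ : Window N r →ₗ[ℂ] ℂ := ∑ j : Finset.Icc (-(N : ℤ)) N, LinearMap.proj (j, ⟨0, hr⟩)
  have hσ : ∀ w, σ w = ∑ j : Finset.Icc (-(N : ℤ)) N, w (j, ⟨0, hr⟩) := fun w => by
    simp [σ, LinearMap.sum_apply]
  obtain ⟨C, q, hC, hq, hq1, hd⟩ := exists_decay_on_window hB hN 1 (LinearMap.ker σ) (by
      intro p e he he' w hw
      rw [LinearMap.mem_ker, hσ] at hw
      rw [one_pow, one_smul, LinearMap.mem_ker, hσ, ← h.sum_contr hgm hr hm h0 hg hB hN p he he', hw])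
    (by
      intro w hw ε hε
      rw [LinearMap.mem_ker, hσ] at hw
      obtain ⟨n₀, hn₀⟩ := eventually_atTop.mp (h.eventually_win hgm hr hm hg w hε)
      refine ⟨n₀, fun n hn k i => ?_⟩
      have h1 := hn₀ n hn k i
      rw [hw, mul_zero, sub_zero] at h1
      rwa [one_pow, one_mul])
  refine ⟨C, q, hC, hq, hq1, fun n k i w hw => ?_⟩
  have h1 := hd n k i w (by rw [LinearMap.mem_ker, hσ, hw])
  rwa [one_pow, one_mul] at h1

theorem comb_eq_win {r : ℕ} {A : FSeq r r} {U : FSeq r 1} {N p : ℕ} {e : ℤ}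
    (hU : ∀ s : ℤ, (N : ℤ) < |s| → U (e + 2 ^ p * s) = 0) (K : ℤ) (i : Fin r) :
    comb (2 ^ p) A U (e + 2 ^ p * K) i 0 =
      win A N K i fun q => U (e + 2 ^ p * q.1) q.2 0 := by
  rw [comb_apply_apply, win_apply, Finsupp.sum, Matrix.sum_apply]
  simp only [Matrix.mul_apply]
  rw [Finset.sum_coe_sort _ fun s => ∑ t, A (K - s) i t * U (e + 2 ^ p * s) t 0]
  let F : ℤ → ℂ := fun s => ∑ t, A s i t * U (e + 2 ^ p * K - 2 ^ p * s) t 0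
  have h1 : ∑ᶠ s, F s = ∑ s ∈ A.support, F s := by
    refine finsum_eq_sum_of_support_subset _ fun s hs => ?_
    rw [Function.mem_support] at hs
    exact Finsupp.mem_support_iff.mpr fun h => hs (by simp [F, h])
  have h2 : ∑ᶠ s, F (Equiv.subLeft K s) = ∑ᶠ s, F s := finsum_comp_equiv (Equiv.subLeft K)
  have h3 : ∀ s, F (Equiv.subLeft K s) = ∑ t, A (K - s) i t * U (e + 2 ^ p * s) t 0 := by
    intro s
    simp only [F, Equiv.subLeft_apply]
    have : e + 2 ^ p * K - 2 ^ p * (K - s) = e + 2 ^ p * s := by ring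
    rw [this]
  change ∑ s ∈ A.support, F s = _
  rw [← h1, ← h2]
  simp only [h3]
  refine finsum_eq_sum_of_support_subset _ fun s hs => ?_
  rw [Function.mem_support] at hs
  rw [Finset.mem_coe, Finset.mem_Icc, ← abs_le]
  by_contra! hc
  exact hs (by simp [hU s hc])

theorem comb_maskIter_add {r : ℕ} (a : FSeq r r) (u : FSeq r 1) (n p : ℕ) :
    comb 1 (maskIter a (n + p)) u = comb (2 ^ p) (maskIter a n) (comb 1 (maskIter a p) u) := by
  rw [maskIter_add, comb_assoc, one_mul]

theorem comb_maskIter_eq_zero {r B M : ℕ} {a : FSeq r r} {u : FSeq r 1}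
    (hB : ∀ k : ℤ, (B : ℤ) < |k| → a k = 0) (hM : ∀ k : ℤ, (M : ℤ) < |k| → u k = 0) (n : ℕ) {k : ℤ}
    (hk : B * (2 ^ n - 1) + M < |k|) : comb 1 (maskIter a n) u k = 0 := by
  rw [comb_apply_apply, Finsupp.sum]
  refine Finset.sum_eq_zero fun j _ => ?_
  rcases le_or_gt |j| (B * (2 ^ n - 1)) with hj | hj
  · rw [hM, Matrix.mul_zero]
    have := abs_sub_abs_le_abs_sub k j
    rw [one_mul]
    linarith
  · rw [maskIter_apply_eq_zero hB n hj, Matrix.zero_mul]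

/-- The constant is invisible in the root limit, as D^{1/n} tends to 1. -/
theorem limsup_rpow_le {s : ℕ → ℝ≥0∞} {D q : ℝ} (hD : 0 < D) (hq : 0 < q)
    (h : ∀ᶠ n in atTop, s n ≤ ENNReal.ofReal (D * q ^ n)) :
    limsup (fun n : ℕ => s n ^ (1 / (n : ℝ))) atTop ≤ ENNReal.ofReal q := by
  have h1 : Tendsto (fun n : ℕ => ENNReal.ofReal (D ^ (1 / (n : ℝ)) * q)) atTop
      (𝓝 (ENNReal.ofReal (D ^ (0 : ℝ) * q))) := by
    refine ENNReal.tendsto_ofReal (Tendsto.mul_const _ ?_)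
    exact (Real.continuousAt_const_rpow hD.ne').tendsto.comp tendsto_one_div_atTop_nhds_zero_nat
  rw [Real.rpow_zero, one_mul] at h1
  rw [← h1.limsup_eq]
  refine limsup_le_limsup ?_
  filter_upwards [h, eventually_gt_atTop 0] with n hn hn0
  calc s n ^ (1 / (n : ℝ)) ≤ ENNReal.ofReal (D * q ^ n) ^ (1 / (n : ℝ)) :=
        ENNReal.rpow_le_rpow hn (by positivity)
    _ = ENNReal.ofReal (D ^ (1 / (n : ℝ)) * q) := by
        rw [ENNReal.ofReal_rpow_of_nonneg (by positivity) (by positivity),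
          Real.mul_rpow hD.le (by positivity), one_div, Real.pow_rpow_inv_natCast hq.le hn0.ne']

/-- Uniform decay of the iterated masks on sequences with vanishing mass in the first entry. -/
theorem IsMaskLimit.exists_limsup_le {r m : ℕ} {a : FSeq r r} {g : Fin r → ℝ → ℂ}
    (h : IsMaskLimit a g) (hgm : ∀ i, ContDiff ℝ m (g i)) (hr : 0 < r) (hm : r ≤ m + 1)
    (h0 : g ⟨0, hr⟩ ≠ 0) {R : ℝ} (hg : ∀ i x, R < |x| → g i x = 0) :
    ∃ q : ℝ, 0 < q ∧ q < 1 ∧ ∀ u : FSeq r 1, pairing u (fun _ => 1) ⟨0, hr⟩ 0 = 0 →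
      limsup (fun n : ℕ => supNorm (conv ((subdiv a)^[n] (diracId r)) u) ^ (1 / (n : ℝ))) atTop ≤
        ENNReal.ofReal q := by
  obtain ⟨B, hB⟩ := exists_support_bound a
  obtain ⟨C, q, hC, hq, hq1, hd⟩ := h.exists_decay hgm hr hm h0 hg hB (Nat.le_succ B)
  have hq0 : 0 < q := by linarith
  refine ⟨q, hq0, hq1, fun u hu => ?_⟩
  obtain ⟨M, hM⟩ := exists_support_bound u
  -- The sequence u need not fit into the window. After p steps with 2^p > M, each coset sequence of
  -- A_p * u modulo 2^p is supported in [-(B + 1), B + 1], whence the window size; the rate q does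
  -- not depend on u.
  obtain ⟨p, hp⟩ : ∃ p : ℕ, M < 2 ^ p := ⟨M, Nat.lt_two_pow_self⟩
  set U := comb 1 (maskIter a p) u with hUdef
  obtain ⟨D, hD0, hD⟩ := exists_entry_bound U
  have hU : ∀ e : ℤ, 0 ≤ e → e < 2 ^ p → ∀ s : ℤ, ((B + 1 : ℕ) : ℤ) < |s| → U (e + 2 ^ p * s) = 0 := by
    intro e he he' s hs
    refine comb_maskIter_eq_zero hB hM p ?_
    have h1 : (M : ℤ) < 2 ^ p := by exact_mod_cast hp
    have h2 : (0 : ℤ) ≤ B := by positivity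
    push_cast at hs
    rcases lt_abs.mp hs with hs | hs
    · exact lt_of_lt_of_le (by nlinarith) (le_abs_self _)
    · exact lt_of_lt_of_le (by nlinarith) (neg_le_abs _)
  have hbound : ∀ n k i, ‖comb 1 (maskIter a (n + p)) u k i 0‖ ≤ C * q ^ n * D := by
    intro n k i
    have h2p : (0 : ℤ) < 2 ^ p := by positivity
    have he := Int.emod_nonneg k h2p.ne'
    have he' := Int.emod_lt_of_pos k h2p
    set e := k % 2 ^ p
    set K := k / 2 ^ p
    have hk : k = e + 2 ^ p * K := (Int.emod_add_mul_ediv k _).symm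
    set w : Window (B + 1) r := fun q => U (e + 2 ^ p * q.1) q.2 0 with hw
    have hwin : ∀ n K i, comb 1 (maskIter a (n + p)) u (e + 2 ^ p * K) i 0 =
        win (maskIter a n) (B + 1) K i w := fun n K i => by
      rw [comb_maskIter_add, comb_eq_win (hU e he he')]
    have hw0 : ∑ j : Finset.Icc (-((B + 1 : ℕ) : ℤ)) (B + 1 : ℕ), w (j, ⟨0, hr⟩) = 0 := by
      rw [← hu]
      symm
      exact eq_of_dilated_limits hgm hr h0
        (F := fun n k i => comb 1 (maskIter a n) u k i 0)
        (G := fun n k i => win (maskIter a n) (B + 1) k i w) (p := p) (e := e)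
        hwin (fun _ hε => h.eventually_comb hgm hr hm hg u hε)
        fun _ hε => h.eventually_win hgm hr hm hg w hε
    rw [hk, hwin]
    refine (hd n K i w hw0).trans ?_
    gcongr
    rw [pi_norm_le_iff_of_nonneg hD0]
    exact fun q => hD _ _ _
  -- Division by q^p undoes the shift by p levels; the summand 1 makes the constant positive.
  refine limsup_rpow_le (D := C * D / q ^ p + 1) (by positivity) hq0 ?_
  filter_upwards [eventually_ge_atTop p] with n hn
  rw [subdiv_iterate_diracId, conv_eq_comb, supNorm]
  refine iSup_le fun k => iSup_le fun i => iSup_le fun j => ?_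
  rw [Subsingleton.elim j 0, ← ofReal_norm]
  refine ENNReal.ofReal_le_ofReal ?_
  obtain ⟨n, rfl⟩ := Nat.exists_eq_add_of_le' hn
  refine (hbound n k i).trans ?_
  have h1 : C * D / q ^ p * q ^ (n + p) = C * q ^ n * D := by
    rw [pow_add]; field_simp
  rw [add_mul, h1]
  linarith [pow_pos hq0 (n + p)]

/-- The exponent is an infimum over filters, so positivity of each term would not suffice: one q
must serve all filters. -/
theorem smMask_pos_of_rho_le {r : ℕ} {a : FSeq r r} {q : ℝ} (hq : 0 < q) (hq1 : q < 1)
    (h : ∀ v, HasSumRules a v (sumRuleOrder a) → rho a v (sumRuleOrder a) ≤ ENNReal.ofReal q) :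
    0 < smMask a := by
  have hl2 : 0 < Real.log 2 := Real.log_pos (by norm_num)
  have hlq : Real.log q < 0 := Real.log_neg hq hq1
  have h1 : (0 : EReal) < ((-(Real.log q / Real.log 2) : ℝ) : EReal) := by
    exact_mod_cast neg_pos.mpr (div_neg_of_neg_of_pos hlq hl2)
  refine h1.trans_le (le_iInf₂ fun v hv => ?_)
  rw [EReal.coe_neg, EReal.neg_le_neg_iff, EReal.coe_div]
  refine EReal.div_le_div_right_of_nonneg (by exact_mod_cast hl2.le) ?_
  rw [← ENNReal.log_ofReal_of_pos hq]
  exact ENNReal.log_monotone (h v hv)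

theorem IsMaskLimit.smMask_pos {r m : ℕ} {a : FSeq r r} {g : Fin r → ℝ → ℂ}
    (h : IsMaskLimit a g) (hgm : ∀ i, ContDiff ℝ m (g i)) (hr : 0 < r) (hm : r ≤ m + 1) {B : ℕ}
    (hB : ∀ k : ℤ, (B : ℤ) < |k| → a k = 0) (hg : ∀ i x, (B : ℝ) < |x| → g i x = 0)
    (h0 : g ⟨0, hr⟩ ≠ 0) : 0 < smMask a := by
  have hs : 0 < sumRuleOrder a :=
    -- Order at least one makes the zeroth moment condition available. As v̂(0) lives in its first
    -- entry, an annihilated u then has û_0(0) = 0.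
    le_csSup (bddAbove_sumRules a) ⟨_, h.hasSumRules_one hgm hr hm h0 hg⟩
  obtain ⟨q, hq, hq1, hd⟩ := h.exists_limsup_le hgm hr hm h0 hg
  refine smMask_pos_of_rho_le hq hq1 fun v hv => iSup₂_le fun u hu => hd u ?_
  obtain ⟨h1, h2, -⟩ := h.mass hgm hr hm hB hg hv.1 hs
  have h3 := mem_annihilated_iff.mp hu 0 hs
  simp only [pow_zero] at h3
  rw [pairing_comb_one] at h3
  have h4 := congrFun₂ h3 0 0
  rw [Matrix.mul_apply, Finset.sum_eq_single ⟨0, hr⟩] at h4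
  · exact (mul_eq_zero.mp h4).resolve_left h2
  · intro l _ hl
    rw [h1 l fun h => hl (Fin.ext h), zero_mul]
  · simp

/-- Necessary conditions for convergence. -/
theorem HermiteConvergent.necessary {r m : ℕ} (hr : 0 < r) (hm : r ≤ m + 1) {a : FSeq r r}
    {v : FSeq 1 r} (hv : IsMatchingFilter a v r) (hv1 : IsNormalized v) {φ : Fin r → 𝓢'(ℝ, ℂ)}
    (hφc : ∀ i, IsCompactlySupported (φ i)) (hφ : IsRefinable a φ)
    (hφ1 : ∑ i, symbol v 0 0 i * fourierFn (φ i) 0 = 1) (hc : HermiteConvergent a m) :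
    0 < smMask a ∧ ((m : ℝ) : EReal) < smVector φ ∧ IsHermiteFilter v := by
  obtain ⟨B, hB⟩ := exists_support_bound a
  obtain ⟨g, hgm, hg, h⟩ := hc.exists_isMaskLimit hr hB
  obtain ⟨h1, h2, h3⟩ := h.mass hgm hr hm hB hg hv hr
  have h0 : g ⟨0, hr⟩ ≠ 0 := by
    intro h0
    rw [h0] at h3
    simp at h3
  have h4 : pairing v (fun _ => 1) 0 ⟨0, hr⟩ = 1 := by
    -- All entries of v̂(0) beyond the first vanish, so the entry normalized to 1 must be the first
    -- one.
    obtain ⟨l, hl, -⟩ := hv1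
    rw [symbol_zero_eq_pairing] at hl
    by_cases hl0 : (l : ℕ) = 0
    · rwa [show l = ⟨0, hr⟩ from Fin.ext hl0] at hl
    · rw [h1 l hl0] at hl
      exact absurd hl zero_ne_one
  rw [symbol_zero_eq_pairing, Finset.sum_eq_single ⟨0, hr⟩ (fun l _ hl => by
    rw [h1 l fun h => hl (Fin.ext h), zero_mul]) (by simp), h4, one_mul] at hφ1
  exact ⟨h.smMask_pos hgm hr hm hB hg h0,
    lt_smVector_of_refinable (h.funRefinable hgm hr hm) hgm hg
      fun i => h.isGivenBy hgm hr hm hB hg hφc hφ hφ1 i,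
    h.isHermiteFilter hgm hr hm hB hg hv h4⟩

/-! ### Functions of large smoothness exponent -/

/-- The difference of f and a primitive of g is absolutely continuous with derivative zero almost
everywhere, hence constant. -/
theorem eq_integral_of_absolutelyContinuous {f g : ℝ → ℂ}
    (hf : ∀ x y, AbsolutelyContinuousOnInterval f x y) (hg : Continuous g)
    (h : deriv f =ᵐ[volume] g) (x : ℝ) : f x = f 0 + ∫ t in (0 : ℝ)..x, g t := by
  set H : ℝ → ℂ := fun x => ∫ t in (0 : ℝ)..x, g t with hH
  have hHd : ∀ x, HasDerivAt H (g x) x := fun x =>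
    intervalIntegral.integral_hasDerivAt_right (hg.intervalIntegrable _ _)
      hg.stronglyMeasurable.stronglyMeasurableAtFilter hg.continuousAt
  have hH1 : ContDiff ℝ 1 H := by
    rw [contDiff_one_iff_deriv]
    refine ⟨fun x => (hHd x).differentiableAt, ?_⟩
    rw [show deriv H = g from funext fun x => (hHd x).deriv]
    exact hg
  have hD := (hf 0 x).sub hH1.contDiffOn.absolutelyContinuousOnInterval
  obtain ⟨c, hc⟩ := hD.const_of_ae_hasDerivAt_zero (by
    filter_upwards [(hf 0 x).boundedVariationOn.ae_differentiableAt_of_mem_uIcc, h] with y hy hyg hm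
    have h1 := (hy hm).hasDerivAt.sub (hHd y)
    rw [hyg, sub_self] at h1
    exact h1)
  have h0 := hc 0 Set.left_mem_uIcc
  have hx := hc x Set.right_mem_uIcc
  rw [← h0] at hx
  simp only [Pi.sub_apply, hH, intervalIntegral.integral_same, sub_zero] at hx
  linear_combination hx

/-- Integrate the continuous representative of the top derivative step by step. For positive order f
itself turns out to be smooth, so modification on a null set is needed only for m = 0. -/
theorem exists_contDiff_of_iteratedDeriv_ae_eq {m : ℕ} {f h : ℝ → ℂ}
    (hf : ∀ j < m, ∀ x y, AbsolutelyContinuousOnInterval (iteratedDeriv j f) x y)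
    (hh : Continuous h) (he : iteratedDeriv m f =ᵐ[volume] h) :
    ∃ g : ℝ → ℂ, ContDiff ℝ m g ∧ f =ᵐ[volume] g := by
  induction m generalizing f with
  | zero => exact ⟨h, by simpa using hh, by simpa using he⟩
  | succ m ih =>
    obtain ⟨g, hg, hfg⟩ := ih (f := deriv f) (fun j hj x y => by
      rw [← iteratedDeriv_succ']; exact hf (j + 1) (by omega) x y)
      (by rwa [← iteratedDeriv_succ'])
    have h1 := eq_integral_of_absolutelyContinuous
      (fun x y => by simpa using hf 0 (Nat.succ_pos m) x y) hg.continuous hfg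
    have hd : ∀ x, HasDerivAt f (g x) x := by
      intro x
      have h2 := (intervalIntegral.integral_hasDerivAt_right
        (hg.continuous.intervalIntegrable (μ := volume) 0 x)
        hg.continuous.stronglyMeasurable.stronglyMeasurableAtFilter
        hg.continuous.continuousAt).const_add (f 0)
      rwa [← funext h1] at h2
    refine ⟨f, ?_, EventuallyEq.rfl⟩
    rw [Nat.cast_succ, contDiff_succ_iff_deriv]
    refine ⟨fun x => (hd x).differentiableAt, by simp, ?_⟩
    rwa [funext fun x => (hd x).deriv]

/-- An almost everywhere Hölder continuous function has a continuous representative. -/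
theorem exists_continuous_of_memLipInf {τ : ℝ} (hτ : 0 < τ) {F : ℝ → ℂ}
    (hF : AEStronglyMeasurable F volume) (h : MemLipInf τ F) :
    ∃ g : ℝ → ℂ, Continuous g ∧ F =ᵐ[volume] g := by
  obtain ⟨C, hC, h⟩ := h
  set G := hF.mk F with hG
  have hGm : StronglyMeasurable G := hF.stronglyMeasurable_mk
  have hFG : F =ᵐ[volume] G := hF.ae_eq_mk
  have h1 : ∀ᵐ t : ℝ, ∀ᵐ x : ℝ, ‖G x - G (x - t)‖ ≤ C * |t| ^ τ := by
    refine Eventually.of_forall fun t => ?_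
    have h2 := h t
    rw [eLpNorm_exponent_top] at h2
    have h3 : ∀ᵐ x : ℝ, ‖F x - F (x - t)‖ₑ ≤ ENNReal.ofReal (C * |t| ^ τ) :=
      (ae_le_eLpNormEssSup (f := fun x => F x - F (x - t))).mono fun x hx => hx.trans h2
    have h4 : ∀ᵐ x : ℝ, F (x - t) = G (x - t) :=
      (measurePreserving_sub_right volume t).quasiMeasurePreserving.ae hFG
    filter_upwards [h3, hFG, h4] with x hx h5 h6
    rw [← h5, ← h6]
    rw [← ofReal_norm] at hx
    exact (ENNReal.ofReal_le_ofReal_iff (by positivity)).mp hx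
  have hmeas : MeasurableSet {p : ℝ × ℝ | ‖G p.2 - G (p.2 - p.1)‖ ≤ C * |p.1| ^ τ} := by
    refine measurableSet_le ?_ ?_
    · exact ((hGm.measurable.comp measurable_snd).sub
        (hGm.measurable.comp (measurable_snd.sub measurable_fst))).norm
    · exact ((continuous_abs.measurable.comp measurable_fst).pow_const τ).const_mul C
  -- Fubini turns "for each t, almost every x" into "for almost every x, almost every t"; the
  -- measurable modification G is introduced for this exchange.
  have h2 := (Measure.ae_ae_comm (p := fun t x => ‖G x - G (x - t)‖ ≤ C * |t| ^ τ) hmeas).mp h1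
  have h3 : ∀ᵐ x : ℝ, ∀ᵐ y : ℝ, ‖G x - G y‖ ≤ C * |x - y| ^ τ := by
    filter_upwards [h2] with x hx
    have h4 := (Measure.measurePreserving_sub_left volume x).quasiMeasurePreserving.ae hx
    filter_upwards [h4] with y hy
    rwa [sub_sub_cancel] at hy
  set X : Set ℝ := {x | ∀ᵐ y : ℝ, ‖G x - G y‖ ≤ C * |x - y| ^ τ} with hX
  have hXd : Dense X := Measure.dense_of_ae h3
  have hh : ∀ x ∈ X, ∀ y ∈ X, ‖G x - G y‖ ≤ 2 * C * |x - y| ^ τ := by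
    -- Compare both values through a point z between x and y lying in both full-measure sets; the
    -- constant doubles.
    have key : ∀ x ∈ X, ∀ y ∈ X, x < y → ‖G x - G y‖ ≤ 2 * C * |x - y| ^ τ := by
      intro x hx y hy hxy
      have hd : Dense {z | ‖G x - G z‖ ≤ C * |x - z| ^ τ ∧ ‖G y - G z‖ ≤ C * |y - z| ^ τ} :=
        Measure.dense_of_ae (Filter.Eventually.and hx hy)
      obtain ⟨z, ⟨hz1, hz2⟩, hz⟩ := hd.exists_mem_open (isOpen_Ioo (a := x) (b := y)) ⟨(x + y) / 2, by
        constructor <;> linarith⟩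
      have h5 : |x - z| ^ τ ≤ |x - y| ^ τ := by
        refine Real.rpow_le_rpow (abs_nonneg _) ?_ hτ.le
        rw [abs_sub_comm, abs_sub_comm x y, abs_of_pos (by linarith [hz.1]),
          abs_of_pos (by linarith)]
        linarith [hz.2]
      have h6 : |y - z| ^ τ ≤ |x - y| ^ τ := by
        refine Real.rpow_le_rpow (abs_nonneg _) ?_ hτ.le
        rw [abs_sub_comm x y, abs_of_pos (by linarith [hz.2]), abs_of_pos (by linarith)]
        linarith [hz.1]
      have h7 := norm_sub_le_norm_sub_add_norm_sub (G x) (G z) (G y)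
      rw [norm_sub_rev (G z)] at h7
      have h8 := mul_le_mul_of_nonneg_left h5 hC.le
      have h9 := mul_le_mul_of_nonneg_left h6 hC.le
      linarith
    intro x hx y hy
    rcases lt_trichotomy x y with hxy | rfl | hxy
    · exact key x hx y hy hxy
    · simp [Real.zero_rpow hτ.ne']
    · rw [norm_sub_rev, abs_sub_comm]
      exact key y hy x hx hxy
  have hu : UniformContinuous fun x : X => G x := by
    rw [Metric.uniformContinuous_iff]
    intro ε hε
    refine ⟨(ε / (2 * C)) ^ (1 / τ), by positivity, fun {x y} hxy => ?_⟩
    rw [dist_eq_norm]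
    refine (hh x x.2 y y.2).trans_lt ?_
    rw [Subtype.dist_eq, Real.dist_eq] at hxy
    have h5 : |(x : ℝ) - y| ^ τ < ε / (2 * C) := by
      have := Real.rpow_lt_rpow (abs_nonneg _) hxy hτ
      rwa [← Real.rpow_mul (by positivity), one_div_mul_cancel hτ.ne', Real.rpow_one] at this
    rw [lt_div_iff₀ (by positivity)] at h5
    linarith
  have hi : IsUniformInducing (Subtype.val : X → ℝ) := isUniformInducing_val X
  have hdr : DenseRange (Subtype.val : X → ℝ) := hXd.denseRange_val
  refine ⟨_, (uniformContinuous_uniformly_extend hi hdr hu).continuous, ?_⟩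
  filter_upwards [hFG, h3] with x hx hxX
  rw [hx]
  exact (uniformly_extend_of_ind hi hdr hu (⟨x, hxX⟩ : X)).symm

theorem exists_contDiff_of_lt_smDistribution {m : ℕ} {T : 𝓢'(ℝ, ℂ)}
    (h : ((m : ℝ) : EReal) < smDistribution T) : ∃ g : ℝ → ℂ, ContDiff ℝ m g ∧ IsGivenBy T g := by
  obtain ⟨s, ⟨k, τ, f, hτ0, hτ1, hT, ⟨hAC, hL⟩, hLip, rfl⟩, hs⟩ := lt_sSup_iff.mp h
  have hs' : (m : ℝ) < k + τ := by exact_mod_cast hs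
  -- From m < k + τ with τ < 1 follows m ≤ k. If m < k, the m-th derivative is absolutely
  -- continuous, hence continuous; if m = k, then τ > 0 and the Hölder condition supplies a
  -- continuous representative.
  have hk : m ≤ k := by
    have h1 : (m : ℝ) < (k + 1 : ℕ) := by push_cast; linarith
    have h2 : m < k + 1 := by exact_mod_cast h1
    omega
  obtain ⟨h, hh, he⟩ : ∃ h : ℝ → ℂ, Continuous h ∧ iteratedDeriv m f =ᵐ[volume] h := by
    rcases hk.lt_or_eq with hlt | rfl
    · refine ⟨iteratedDeriv m f, ?_, EventuallyEq.rfl⟩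
      rw [continuous_iff_continuousAt]
      intro x
      refine (hAC m hlt (x - 1) (x + 1)).continuousOn.continuousAt ?_
      rw [Set.uIcc_of_le (by linarith)]
      exact Icc_mem_nhds (by linarith) (by linarith)
    · exact exists_continuous_of_memLipInf (by linarith) (hL m le_rfl).1 hLip
  obtain ⟨g, hg, hfg⟩ := exists_contDiff_of_iteratedDeriv_ae_eq
    (fun j hj => hAC j (hj.trans_le hk)) hh he
  refine ⟨g, hg, fun q => ?_⟩
  rw [hT q]
  refine integral_congr_ae ?_
  filter_upwards [hfg] with x hx
  rw [hx]

/-- Testing against smooth functions supported off the interval shows that g vanishes there almost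
everywhere, and continuity removes the exceptional set. -/
theorem SupportedIn.eq_zero_of_isGivenBy {T : 𝓢'(ℝ, ℂ)} {R : ℝ} (hT : SupportedIn T R) {g : ℝ → ℂ}
    (hg : Continuous g) (h : IsGivenBy T g) (x : ℝ) (hx : R < |x|) : g x = 0 := by
  set U : Set ℝ := (Set.Icc (-R) R)ᶜ with hU
  have hUo : IsOpen U := isClosed_Icc.isOpen_compl
  have h1 := hUo.ae_eq_zero_of_integral_contDiff_smul_eq_zero (f := g) (μ := volume)
    (hg.locallyIntegrable.locallyIntegrableOn _) (by
      intro ψ hψ hψc hψU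
      have hc : HasCompactSupport fun x => (ψ x : ℂ) :=
        hψc.comp_left (g := fun y : ℝ => (y : ℂ)) (by simp)
      have hd : ContDiff ℝ (⊤ : ℕ∞) fun x => (ψ x : ℂ) := Complex.ofRealCLM.contDiff.comp hψ
      have h2 : T (hc.toSchwartzMap hd) = 0 := by
        refine hT _ fun y hy => hψU ?_
        refine closure_mono (fun z hz => ?_) hy
        rw [Function.mem_support] at hz ⊢
        intro h0
        refine hz ?_
        change (ψ z : ℂ) = 0
        rw [h0, Complex.ofReal_zero]
      rw [h] at h2
      rw [← h2]
      refine integral_congr_ae (Eventually.of_forall fun y => ?_)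
      change ψ y • g y = g y * (ψ y : ℂ)
      rw [Complex.real_smul, mul_comm])
  have hxU : x ∈ U := by
    rw [hU, Set.mem_compl_iff, Set.mem_Icc, ← abs_le, not_le]
    exact hx
  by_contra hne
  have ho : IsOpen (U ∩ {y | g y ≠ 0}) := hUo.inter (isOpen_ne_fun hg continuous_const)
  have h0 : volume (U ∩ {y | g y ≠ 0}) = 0 := by
    refine measure_mono_null (fun y hy => ?_) (ae_iff.mp h1)
    rw [Set.mem_ofPred_eq]
    exact fun hc => hy.2 (hc hy.1)
  exact Set.notMem_empty x (((ho.measure_eq_zero_iff volume).mp h0) ▸ ⟨hxU, hne⟩)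

/-- A refinable vector of compactly supported distributions of large smoothness consists of
compactly supported smooth functions. -/
theorem exists_contDiff_of_lt_smVector {r m : ℕ} {φ : Fin r → 𝓢'(ℝ, ℂ)}
    (hφc : ∀ i, IsCompactlySupported (φ i)) (h : ((m : ℝ) : EReal) < smVector φ) :
    ∃ (g : Fin r → ℝ → ℂ) (R : ℕ), (∀ i, ContDiff ℝ m (g i)) ∧ (∀ i x, (R : ℝ) < |x| → g i x = 0) ∧
      ∀ i, IsGivenBy (φ i) (g i) := by
  have h1 : ∀ i, ((m : ℝ) : EReal) < smDistribution (φ i) := fun i => h.trans_le (iInf_le _ i)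
  choose g hg hgφ using fun i => exists_contDiff_of_lt_smDistribution (h1 i)
  choose S hS using hφc
  obtain ⟨R, hR⟩ := exists_nat_ge (∑ i, |S i|)
  refine ⟨g, R, hg, fun i x hx => (hS i).eq_zero_of_isGivenBy (hg i).continuous (hgφ i) x ?_, hgφ⟩
  have h2 : |S i| ≤ ∑ i, |S i| :=
    Finset.single_le_sum (f := fun i => |S i|) (fun i _ => abs_nonneg _) (Finset.mem_univ i)
  linarith [le_abs_self (S i)]

/-- Both sides of the refinement equation are continuous with compact support and have the same
Fourier transform. -/
theorem funRefinable_of_isRefinable {r : ℕ} {a : FSeq r r} {φ : Fin r → 𝓢'(ℝ, ℂ)}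
    (hφc : ∀ i, IsCompactlySupported (φ i)) (hφ : IsRefinable a φ) {g : Fin r → ℝ → ℂ}
    (hgc : ∀ i, Continuous (g i)) {R : ℝ} (hg : ∀ i x, R < |x| → g i x = 0)
    (hgφ : ∀ i, IsGivenBy (φ i) (g i)) : FunRefinable a g := by
  intro i
  obtain ⟨B, hB⟩ := exists_support_bound (maskIter a 1)
  set F : ℝ → ℂ := fun x => applySeq (maskIter a 1) g i (2 * x) with hF
  have hterm : ∀ (b : ℤ) (j : Fin r), Continuous fun x : ℝ => maskIter a 1 b i j * g j (2 * x - b) :=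
    fun b j => continuous_const.mul ((hgc j).comp (by fun_prop))
  have hFc : Continuous F :=
    continuous_finsetSum _ fun b _ => continuous_finsetSum _ fun j _ => hterm b j
  have hsh : ∀ b ∈ (maskIter a 1).support, ∀ x : ℝ, |R| + B < |x| → R < |2 * x - b| := by
    intro b hb x hx
    have h1 : |b| ≤ (B : ℤ) := by
      by_contra! hc
      exact Finsupp.mem_support_iff.mp hb (hB b hc)
    have h2 : |(b : ℝ)| ≤ B := by exact_mod_cast h1
    have h3 := abs_sub_abs_le_abs_sub (2 * x) (b : ℝ)
    rw [abs_mul, abs_two] at h3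
    linarith [le_abs_self R, abs_nonneg R, abs_nonneg x]
  have hR : ∀ x, |R| + B < |x| → (g i - F) x = 0 := by
    intro x hx
    have h1 : g i x = 0 := hg i x (by linarith [le_abs_self R, Nat.cast_nonneg (α := ℝ) B])
    rw [Pi.sub_apply, h1, zero_sub, neg_eq_zero]
    refine Finset.sum_eq_zero fun b hb => Finset.sum_eq_zero fun j _ => ?_
    rw [hg j _ (hsh b hb x hx), mul_zero]
  have hzero := eq_zero_of_integral_exp_eq_zero ((hgc i).sub hFc) hR fun ξ => ?_
  · intro x
    have := congrFun hzero x
    rw [Pi.sub_apply, Pi.zero_apply, sub_eq_zero] at this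
    exact this
  set E : ℝ → ℂ := fun x => Complex.exp (-(Complex.I * (x : ℂ) * (ξ : ℂ))) with hE
  have hEc : Continuous E := by fun_prop
  have hgi : Integrable fun x => g i x * E x :=
    ((hgc i).mul hEc).integrable_of_hasCompactSupport
      (hasCompactSupport_of_forall_lt (hg i)).mul_right
  have hti : ∀ b ∈ (maskIter a 1).support, ∀ j, Integrable fun x : ℝ =>
      maskIter a 1 b i j * g j (2 * x - b) * E x := by
    intro b hb j
    refine ((hterm b j).mul hEc).integrable_of_hasCompactSupport
      (hasCompactSupport_of_forall_lt (R := |R| + B) fun x hx => ?_)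
    rw [Pi.mul_apply, hg j _ (hsh b hb x hx), mul_zero, zero_mul]
  have hFE : ∀ x, F x * E x = ∑ b ∈ (maskIter a 1).support, ∑ j,
      maskIter a 1 b i j * g j (2 * x - b) * E x := by
    intro x
    simp only [hF, applySeq, Finset.sum_mul]
  have hFi : Integrable fun x => F x * E x := by
    simp only [hFE]
    exact integrable_finsetSum _ fun b hb => integrable_finsetSum _ fun j _ => hti b hb j
  simp only [Pi.sub_apply, sub_mul]
  change ∫ x, (g i x * E x - F x * E x) = 0
  rw [integral_sub hgi hFi, ← fourierFn_eq_integral (hφc i) (hg i) (hgφ i) ξ]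
  simp only [hFE]
  rw [integral_finsetSum _ fun b hb => integrable_finsetSum _ fun j _ => hti b hb j]
  have h1 := congrFun (hφ (ξ / 2)) i
  simp only [mul_div_cancel₀ ξ (two_ne_zero (α := ℝ))] at h1
  rw [h1, sub_eq_zero, Matrix.mulVec, dotProduct]
  -- The substitution y = 2x - b produces the factor 1/2, which offsets A_1 = 2a.
  have h2 : ∀ b ∈ (maskIter a 1).support, ∫ x, ∑ j, maskIter a 1 b i j * g j (2 * x - b) * E x =
      ∑ j, maskIter a 1 b i j * (2⁻¹ * (Complex.exp (-(Complex.I * (b : ℂ) * ((ξ / 2 : ℝ) : ℂ))) *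
        fourierFn (φ j) (ξ / 2))) := by
    intro b hb
    rw [integral_finsetSum _ fun j _ => hti b hb j]
    refine Finset.sum_congr rfl fun j _ => ?_
    simp only [mul_assoc]
    rw [integral_const_mul]
    congr 1
    rw [fourierFn_eq_integral (hφc j) (hg j) (hgφ j), ← integral_const_mul]
    set H : ℝ → ℂ := fun y => g j (y - b) * Complex.exp (-(Complex.I * (y : ℂ) * ((ξ / 2 : ℝ) : ℂ)))
      with hH
    have h3 : ∀ x : ℝ, g j (2 * x - b) * E x = H (2 * x) := by
      intro x
      simp only [hH, hE]
      congr 2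
      push_cast
      ring
    simp only [h3]
    rw [Measure.integral_comp_mul_left H 2, ← integral_add_right_eq_self H (b : ℝ),
      abs_of_pos (by norm_num), Complex.real_smul, ← integral_const_mul, ← integral_const_mul]
    push_cast
    congr 1
    funext y
    simp only [hH, add_sub_cancel_right]
    rw [mul_left_comm (Complex.exp _), ← Complex.exp_add]
    push_cast
    congr 3
    ring
  rw [Finset.sum_congr rfl h2, Finset.sum_comm]
  refine Finset.sum_congr rfl fun j _ => ?_
  have h3 : symbol a (ξ / 2) = (2⁻¹ : ℂ) • symbol (maskIter a 1) (ξ / 2) := by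
    rw [maskIter_one, symbol_eq_pairing, symbol_eq_pairing, map_smul, LinearMap.smul_apply, smul_smul]
    norm_num
  rw [h3, Matrix.smul_apply, symbol_eq_pairing, pairing_entry, smul_eq_mul, Finset.mul_sum,
    Finset.sum_mul]
  refine Finset.sum_congr rfl fun b _ => ?_
  ring

/-! ### Differences of sample sequences -/

/-- The samples `k ↦ G(k)`, `|k| ≤ R`. -/
def sampleSeq {r : ℕ} (R : ℕ) (G : Fin r → ℝ → ℂ) : FSeq r 1 :=
  ∑ k ∈ Finset.Icc (-(R : ℤ)) R, Finsupp.single k (Matrix.of fun i _ => G i k)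

theorem sampleSeq_apply {r R : ℕ} {G : Fin r → ℝ → ℂ} (hG : ∀ i x, (R : ℝ) < |x| → G i x = 0)
    (k : ℤ) (i : Fin r) : sampleSeq R G k i 0 = G i k := by
  rw [sampleSeq, Finsupp.finsetSum_apply]
  simp only [Finsupp.single_apply]
  rw [Finset.sum_ite_eq' (Finset.Icc (-(R : ℤ)) R) k]
  split_ifs with hk
  · rfl
  · rw [Finset.mem_Icc, ← abs_le, not_le] at hk
    rw [hG i k (by exact_mod_cast hk), Matrix.zero_apply]

theorem comb_sampleSeq {r R : ℕ} {G : Fin r → ℝ → ℂ} (hG : ∀ i x, (R : ℝ) < |x| → G i x = 0)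
    (A : FSeq r r) (k : ℤ) (i : Fin r) :
    comb 1 A (sampleSeq R G) k i 0 = applySeq A G i k := by
  rw [comb_apply_apply, Finsupp.sum, Matrix.sum_apply, applySeq]
  refine Finset.sum_congr rfl fun b _ => ?_
  rw [Matrix.mul_apply]
  refine Finset.sum_congr rfl fun j _ => ?_
  rw [sampleSeq_apply hG]
  push_cast
  rw [one_mul]

/-- The backward difference `u ↦ u(· - 1) - u`. -/
def shiftDiff {r : ℕ} : FSeq r 1 →ₗ[ℂ] FSeq r 1 :=
  comb 1 (Finsupp.single 1 1 - Finsupp.single 0 1)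

theorem shiftDiff_apply {r : ℕ} (u : FSeq r 1) (k : ℤ) : shiftDiff u k = u (k - 1) - u k := by
  rw [shiftDiff, map_sub, LinearMap.sub_apply, Finsupp.sub_apply, comb_apply_apply,
    comb_apply_apply, Finsupp.sum_single_index (by simp), Finsupp.sum_single_index (by simp)]
  simp

theorem pairing_shiftDiff {r : ℕ} (u : FSeq r 1) (F : ℤ → ℂ) :
    pairing (shiftDiff u) F = pairing u (fun b => F (1 + b)) - pairing u F := by
  rw [shiftDiff, map_sub, LinearMap.sub_apply, map_sub, LinearMap.sub_apply, pairing_comb_left,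
    pairing_comb_left, Finsupp.sum_single_index (by simp), Finsupp.sum_single_index (by simp)]
  simp

theorem comb_shiftDiff_apply {r : ℕ} (A : FSeq r r) (u : FSeq r 1) (k : ℤ) (i : Fin r) :
    comb 1 A (shiftDiff u) k i 0 = fwdDiff (-1) (fun k : ℤ => comb 1 A u k i 0) k := by
  change _ = comb 1 A u (k + -1) i 0 - comb 1 A u k i 0
  simp only [comb_apply_apply, Finsupp.sum, Matrix.sum_apply]
  rw [← Finset.sum_sub_distrib]
  refine Finset.sum_congr rfl fun b _ => ?_
  have h : k - 1 * b - 1 = k + -1 - 1 * b := by ring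
  rw [shiftDiff_apply, Matrix.mul_sub, Matrix.sub_apply, h]

theorem comb_iterate_shiftDiff_apply {r : ℕ} (A : FSeq r r) (u : FSeq r 1) (q : ℕ) (i : Fin r) :
    (fun k : ℤ => comb 1 A (shiftDiff^[q] u) k i 0) =
      (fwdDiff (-1))^[q] fun k : ℤ => comb 1 A u k i 0 := by
  induction q with
  | zero => rfl
  | succ q ih =>
    rw [Function.iterate_succ_apply', Function.iterate_succ_apply', ← ih]
    exact funext fun k => comb_shiftDiff_apply A _ k i

theorem iterate_fwdDiff_comp {M N : Type*} [AddCommGroup M] [AddCommGroup N] {L : M →+ N}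
    (F : N → ℂ) (h : M) (q : ℕ) :
    (fwdDiff h)^[q] (fun k => F (L k)) = fun k => (fwdDiff (L h))^[q] F (L k) := by
  induction q with
  | zero => rfl
  | succ q ih =>
    rw [Function.iterate_succ_apply', Function.iterate_succ_apply', ih]
    funext k
    simp only [fwdDiff, map_add]

/-- By the iterated refinement equation A_n * U samples g at k/2^n, and shifting the index by one is
a shift of the argument by 2^{-n}. -/
theorem comb_maskIter_iterate_shiftDiff {r R : ℕ} {a : FSeq r r} {g : Fin r → ℝ → ℂ}
    (hg : FunRefinable a g) (hR : ∀ i x, (R : ℝ) < |x| → g i x = 0) (n q : ℕ) (k : ℤ) (i : Fin r) :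
    comb 1 (maskIter a n) (shiftDiff^[q] (sampleSeq R g)) k i 0 =
      (fwdDiff (-((1 / 2) ^ n)))^[q] (g i) ((k : ℝ) / 2 ^ n) := by
  refine (congrFun (comb_iterate_shiftDiff_apply (maskIter a n) (sampleSeq R g) q i) k).trans ?_
  have h2 : (fun k : ℤ => comb 1 (maskIter a n) (sampleSeq R g) k i 0) =
      fun k : ℤ => g i (((AddMonoidHom.mulRight ((1 / 2 : ℝ) ^ n)).comp (Int.castAddHom ℝ)) k) := by
    funext k
    rw [comb_sampleSeq hR, hg.iterate n]
    congr 1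
    simp only [AddMonoidHom.comp_apply, Int.coe_castAddHom, AddMonoidHom.coe_mulRight]
    rw [_root_.one_div_pow]
    field_simp
  rw [h2, iterate_fwdDiff_comp]
  simp only [AddMonoidHom.comp_apply, Int.coe_castAddHom, AddMonoidHom.coe_mulRight]
  push_cast
  rw [neg_one_mul, _root_.one_div_pow, mul_one_div]

/-! ### Moments -/

/-- The functional `u ↦ ∑ F(k) (v * u)(k)`. -/
def moment {r : ℕ} (v : FSeq 1 r) (F : ℤ → ℂ) : FSeq r 1 →ₗ[ℂ] ℂ where
  toFun u := pairing (comb 1 v u) F 0 0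
  map_add' u w := by rw [map_add, map_add]; rfl
  map_smul' c u := by rw [map_smul, map_smul]; rfl

theorem moment_apply {r : ℕ} (v : FSeq 1 r) (F : ℤ → ℂ) (u : FSeq r 1) :
    moment v F u = pairing (comb 1 v u) F 0 0 := rfl

theorem mem_annihilated_iff_moment {r : ℕ} {v : FSeq 1 r} {u : FSeq r 1} {n : ℕ} :
    u ∈ annihilated v n ↔ ∀ j < n, moment v (fun k => (k : ℂ) ^ j) u = 0 := by
  rw [mem_annihilated_iff]
  refine forall₂_congr fun j _ => ⟨fun h => by rw [moment_apply, h]; rfl, fun h => ?_⟩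
  ext i l
  rw [Subsingleton.elim i 0, Subsingleton.elim l 0]
  exact h

/-- Summation by parts: differencing the sequence is differencing the test function. Thus ∇^q lowers
the degree of a test polynomial by q, which makes the moment system triangular. -/
theorem moment_shiftDiff {r : ℕ} (v : FSeq 1 r) (F : ℤ → ℂ) (u : FSeq r 1) :
    moment v F (shiftDiff u) = moment v (fwdDiff 1 F) u := by
  simp only [moment_apply, pairing_comb_left]
  refine congrFun₂ (Finsupp.sum_congr fun k _ => ?_) 0 0
  rw [pairing_shiftDiff]
  congr 1
  rw [← map_sub]
  congr 1
  funext b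
  simp only [Pi.sub_apply, fwdDiff]
  congr 2
  ring

theorem moment_iterate_shiftDiff {r : ℕ} (v : FSeq 1 r) (F : ℤ → ℂ) (u : FSeq r 1) (q : ℕ) :
    moment v F (shiftDiff^[q] u) = moment v ((fwdDiff 1)^[q] F) u := by
  induction q generalizing F with
  | zero => rfl
  | succ q ih =>
    rw [Function.iterate_succ_apply', moment_shiftDiff, ih, ← Function.iterate_succ_apply]

theorem iterate_fwdDiff_intCast_pow (q j : ℕ) :
    (fwdDiff 1)^[q] (fun k : ℤ => (k : ℂ) ^ j) =
      fun k : ℤ => (fwdDiff 1)^[q] (fun x : ℂ => x ^ j) k := by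
  have h := iterate_fwdDiff_comp (L := Int.castAddHom ℂ) (fun x : ℂ => x ^ j) 1 q
  simpa using h

theorem moment_pow_iterate_shiftDiff_of_lt {r : ℕ} (v : FSeq 1 r) (u : FSeq r 1) {j q : ℕ}
    (h : j < q) : moment v (fun k => (k : ℂ) ^ j) (shiftDiff^[q] u) = 0 := by
  rw [moment_iterate_shiftDiff, iterate_fwdDiff_intCast_pow, fwdDiff_iter_pow_eq_zero_of_lt h,
    moment_apply]
  exact congrFun₂ ((pairing (comb 1 v u)).map_zero) 0 0

theorem moment_pow_iterate_shiftDiff_self {r : ℕ} (v : FSeq 1 r) (u : FSeq r 1) (q : ℕ) :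
    moment v (fun k => (k : ℂ) ^ q) (shiftDiff^[q] u) =
      (Nat.factorial q : ℂ) * moment v (fun _ => 1) u := by
  rw [moment_iterate_shiftDiff, iterate_fwdDiff_intCast_pow, fwdDiff_iter_eq_factorial,
    moment_apply, moment_apply]
  have h1 : (fun k : ℤ => ((Nat.factorial q : ℂ → ℂ)) (k : ℂ)) =
      (Nat.factorial q : ℂ) • fun _ : ℤ => (1 : ℂ) := by
    funext k
    simp
  rw [h1, map_smul]
  rfl

theorem pairing_iterate_shiftDiff_one {r : ℕ} (u : FSeq r 1) {q : ℕ} (hq : 0 < q) :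
    pairing (shiftDiff^[q] u) (fun _ => 1) = 0 := by
  obtain ⟨p, rfl⟩ := Nat.exists_eq_add_of_lt hq
  rw [Nat.zero_add, Function.iterate_succ_apply', pairing_shiftDiff, sub_self]

/-- Solving a triangular system. -/
theorem exists_sub_mem_annihilated {r : ℕ} (v : FSeq 1 r) (U : FSeq r 1)
    (hU : moment v (fun _ => 1) U ≠ 0) (x : FSeq r 1) (l s : ℕ)
    (hx : ∀ j < l, moment v (fun k => (k : ℂ) ^ j) x = 0) :
    ∃ c : ℕ → ℂ, x - ∑ q ∈ Finset.Ico l s, c q • shiftDiff^[q] U ∈ annihilated v s := by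
  have hlow : ∀ (c : ℕ → ℂ) (s j : ℕ), j < l → moment v (fun k => (k : ℂ) ^ j)
      (x - ∑ q ∈ Finset.Ico l s, c q • shiftDiff^[q] U) = 0 := by
    intro c s j hj
    rw [map_sub, hx j hj, map_sum, Finset.sum_eq_zero, sub_zero]
    intro q hq
    rw [map_smul, moment_pow_iterate_shiftDiff_of_lt _ _ (hj.trans_le (Finset.mem_Ico.mp hq).1),
      smul_zero]
  induction s with
  | zero => exact ⟨0, mem_annihilated_iff_moment.mpr fun j hj => absurd hj (Nat.not_lt_zero j)⟩
  | succ s ih =>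
    obtain ⟨c, hc⟩ := ih
    rw [mem_annihilated_iff_moment] at hc
    rcases lt_or_ge s l with hsl | hls
    · exact ⟨c, mem_annihilated_iff_moment.mpr fun j hj => hlow c _ j (by omega)⟩
    · set y := x - ∑ q ∈ Finset.Ico l s, c q • shiftDiff^[q] U with hy
      -- This multiple of ∇^s U cancels the s-th moment; lower moments are untouched since those of
      -- ∇^s U vanish.
      set d := moment v (fun k => (k : ℂ) ^ s) y /
        ((Nat.factorial s : ℂ) * moment v (fun _ => 1) U) with hd
      have hne : (Nat.factorial s : ℂ) * moment v (fun _ => 1) U ≠ 0 :=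
        mul_ne_zero (by exact_mod_cast Nat.factorial_ne_zero s) hU
      refine ⟨fun q => if q = s then d else c q, ?_⟩
      have h1 : x - ∑ q ∈ Finset.Ico l (s + 1), (if q = s then d else c q) • shiftDiff^[q] U =
          y - d • shiftDiff^[s] U := by
        rw [Finset.sum_Ico_succ_top hls, if_pos rfl, hy, sub_sub]
        congr 2
        refine Finset.sum_congr rfl fun q hq => ?_
        rw [if_neg (Finset.mem_Ico.mp hq).2.ne]
      rw [h1, mem_annihilated_iff_moment]
      intro j hj
      rw [map_sub, map_smul]
      rcases (Nat.lt_succ_iff.mp hj).lt_or_eq with hlt | rfl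
      · rw [hc j hlt, moment_pow_iterate_shiftDiff_of_lt _ _ hlt, smul_zero, sub_zero]
      · rw [moment_pow_iterate_shiftDiff_self, smul_eq_mul, hd, div_mul_cancel₀ _ hne, sub_self]

/-- Differences of order above l have vanishing l-th moment, so the l-th moment of x isolates the
leading coefficient. -/
theorem moment_eq_of_sub_mem_annihilated {r : ℕ} {v : FSeq 1 r} {U x : FSeq r 1} {l s : ℕ}
    {c : ℕ → ℂ} (h : x - ∑ q ∈ Finset.Ico l s, c q • shiftDiff^[q] U ∈ annihilated v s)
    (hl : l < s) : moment v (fun k => (k : ℂ) ^ l) x =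
      c l * ((Nat.factorial l : ℂ) * moment v (fun _ => 1) U) := by
  have h1 := mem_annihilated_iff_moment.mp h l hl
  rw [map_sub, map_sum, sub_eq_zero] at h1
  rw [h1, Finset.sum_eq_single l]
  · rw [map_smul, moment_pow_iterate_shiftDiff_self, smul_eq_mul]
  · intro q hq hql
    rw [map_smul, moment_pow_iterate_shiftDiff_of_lt _ _
      (lt_of_le_of_ne (Finset.mem_Ico.mp hq).1 (Ne.symm hql)), smul_zero]
  · intro hc
    exact absurd (Finset.mem_Ico.mpr ⟨le_rfl, hl⟩) hc

/-! ### Masks of large smoothness exponent -/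

/-- Iterated masks decay faster than `2^{-dn}` on sequences annihilated to order `s`. -/
def HasMaskDecay {r : ℕ} (a : FSeq r r) (v : FSeq 1 r) (s d : ℕ) : Prop :=
  ∀ u ∈ annihilated v s, ∀ ε > 0, ∃ n₀, ∀ n ≥ n₀, ∀ (k : ℤ) (i : Fin r),
    2 ^ (d * n) * ‖comb 1 (maskIter a n) u k i 0‖ ≤ ε

/-- Choose x strictly between the root limit and 2^{-d}; then the norms are eventually at most x^n,
and 2^{dn} x^n tends to zero. -/
theorem hasMaskDecay_of_rho_lt {r : ℕ} {a : FSeq r r} {v : FSeq 1 r} {s d : ℕ}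
    (h : rho a v s < ENNReal.ofReal ((1 / 2) ^ d)) : HasMaskDecay a v s d := by
  intro u hu ε hε
  have h1 : limsup (fun n : ℕ => supNorm (conv ((subdiv a)^[n] (diracId r)) u) ^ (1 / (n : ℝ)))
      atTop < ENNReal.ofReal ((1 / 2) ^ d) := lt_of_le_of_lt (le_iSup₂ (f := fun u _ =>
        limsup (fun n : ℕ => supNorm (conv ((subdiv a)^[n] (diracId r)) u) ^ (1 / (n : ℝ))) atTop)
        u hu) h
  obtain ⟨x, hx1, hx2⟩ := exists_between h1
  have hx : x ≠ ⊤ := hx2.ne_top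
  set q := x.toReal with hq
  have hq0 : 0 ≤ q := ENNReal.toReal_nonneg
  have hqx : ENNReal.ofReal q = x := ENNReal.ofReal_toReal hx
  have hqd : q < (1 / 2) ^ d := by
    rw [← hqx] at hx2
    exact (ENNReal.ofReal_lt_ofReal_iff (by positivity)).mp hx2
  have hq1 : 2 ^ d * q < 1 := by
    calc (2 : ℝ) ^ d * q < 2 ^ d * (1 / 2) ^ d := by gcongr
      _ = 1 := by rw [← mul_pow]; norm_num
  obtain ⟨n₁, hn₁⟩ := exists_pow_lt_of_lt_one hε hq1
  obtain ⟨n₂, hn₂⟩ := eventually_atTop.mp (eventually_lt_of_limsup_lt hx1)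
  -- The level n = 0 is excluded because there the exponent 1/n is 0 by convention and cannot be
  -- inverted.
  refine ⟨max (max n₁ n₂) 1, fun n hn k i => ?_⟩
  have hn0 : n ≠ 0 := by
    have := le_of_max_le_right hn
    omega
  have h2 := hn₂ n (le_of_max_le_right (le_of_max_le_left hn))
  have h3 : supNorm (conv ((subdiv a)^[n] (diracId r)) u) ≤ x ^ n := by
    have h4 := ENNReal.rpow_le_rpow h2.le (Nat.cast_nonneg (α := ℝ) n)
    rw [← ENNReal.rpow_mul, one_div, inv_mul_cancel₀ (by exact_mod_cast hn0), ENNReal.rpow_one,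
      ENNReal.rpow_natCast] at h4
    exact h4
  rw [subdiv_iterate_diracId, conv_eq_comb, supNorm, iSup_le_iff] at h3
  have h4 := iSup_le_iff.mp (iSup_le_iff.mp (h3 k) i) 0
  rw [← hqx, ← ENNReal.ofReal_pow hq0, ← ofReal_norm] at h4
  have h5 := (ENNReal.ofReal_le_ofReal_iff (by positivity)).mp h4
  calc 2 ^ (d * n) * ‖comb 1 (maskIter a n) u k i 0‖ ≤ 2 ^ (d * n) * q ^ n := by gcongr
    _ = (2 ^ d * q) ^ n := by rw [pow_mul, mul_pow]
    _ ≤ (2 ^ d * q) ^ n₁ := pow_le_pow_of_le_one (by positivity) hq1.le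
        (le_of_max_le_left (le_of_max_le_left hn))
    _ ≤ ε := hn₁.le

theorem exists_hasMaskDecay_of_lt_smMask {r : ℕ} (hr : 0 < r) {a : FSeq r r} {v : FSeq 1 r}
    (hv : IsMatchingFilter a v r) (h : (((r : ℝ) - 1 : ℝ) : EReal) < smMask a) :
    ∃ (s : ℕ) (v' : FSeq 1 r), HasSumRules a v' s ∧ HasMaskDecay a v' s (r - 1) := by
  -- Order zero only requires v̂(0) ≠ 0, so the set is nonempty; being bounded as well, it contains
  -- its supremum.
  have hne : {n : ℕ | ∃ v : FSeq 1 r, HasSumRules a v n}.Nonempty :=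
    ⟨0, v, ⟨hv.1, fun l j hj => absurd hj (Nat.not_lt_zero j)⟩,
      fun l j hj => absurd hj (Nat.not_lt_zero j)⟩
  obtain ⟨v', hv'⟩ := Nat.sSup_mem hne (bddAbove_sumRules a)
  change HasSumRules a v' (sumRuleOrder a) at hv'
  refine ⟨_, v', hv', hasMaskDecay_of_rho_lt ?_⟩
  by_contra! hc
  have h1 := h.trans_le (iInf₂_le v' hv')
  refine absurd h1 (not_lt.mpr ?_)
  have hl2 : 0 < Real.log 2 := Real.log_pos (by norm_num)
  have h2 : (((r : ℝ) - 1 : ℝ) : EReal) =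
      -(((-((r : ℝ) - 1) * Real.log 2 : ℝ) : EReal) / ((Real.log 2 : ℝ) : EReal)) := by
    rw [← EReal.coe_div, ← EReal.coe_neg]
    congr 1
    field_simp
  rw [h2, EReal.neg_le_neg_iff]
  refine EReal.div_le_div_right_of_nonneg (by exact_mod_cast hl2.le) ?_
  have h3 := ENNReal.log_monotone hc
  rw [ENNReal.log_ofReal_of_pos (by positivity), Real.log_pow, one_div, Real.log_inv,
    Nat.cast_sub (by omega), Nat.cast_one] at h3
  convert h3 using 2
  ring

theorem exists_forall_fin {r : ℕ} {P : Fin r → ℝ → Prop}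
    (hP : ∀ i δ δ', δ' ≤ δ → P i δ → P i δ') (h : ∀ i, ∃ δ > 0, P i δ) : ∃ δ > 0, ∀ i, P i δ := by
  choose δ hδ hu using h
  rcases isEmpty_or_nonempty (Fin r) with hE | hE
  · exact ⟨1, one_pos, fun i => (hE.false i).elim⟩
  · obtain ⟨i₀, hi₀⟩ := Finite.exists_min δ
    exact ⟨δ i₀, hδ i₀, fun i => hP i _ _ (hi₀ i) (hu i)⟩

theorem eventually_half_pow_lt {δ : ℝ} (hδ : 0 < δ) : ∃ n₀, ∀ n ≥ n₀, (1 / 2 : ℝ) ^ n < δ := by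
  obtain ⟨n₀, hn₀⟩ := exists_pow_lt_of_lt_one hδ (by norm_num : (1 / 2 : ℝ) < 1)
  exact ⟨n₀, fun n hn => (pow_le_pow_of_le_one (by norm_num) (by norm_num) hn).trans_lt hn₀⟩

/-- Differences of samples of refinable functions approximate derivatives. -/
theorem eventually_iterate_shiftDiff_sub {r R l : ℕ} {a : FSeq r r} {g : Fin r → ℝ → ℂ}
    (hg : FunRefinable a g) (hgl : ∀ i, ContDiff ℝ l (g i)) (hR : ∀ i x, (R : ℝ) < |x| → g i x = 0)
    {ε : ℝ} (hε : 0 < ε) : ∃ n₀, ∀ n ≥ n₀, ∀ (k : ℤ) (i : Fin r),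
      ‖2 ^ (l * n) * comb 1 (maskIter a n) (shiftDiff^[l] (sampleSeq R g)) k i 0 -
        (-1) ^ l * iteratedDeriv l (g i) ((k : ℝ) / 2 ^ n)‖ ≤ ε := by
  obtain ⟨δ, hδ, hu⟩ := exists_forall_fin
    (P := fun i δ => ∀ h, 0 ≤ h → h < δ → ∀ x,
      ‖(fwdDiff (-h))^[l] (g i) x - (-h) ^ l * iteratedDeriv l (g i) x‖ ≤ h ^ l * ε)
    (fun i δ δ' hle hP h h0 hh => hP h h0 (hh.trans_le hle))
    fun i => exists_norm_iterate_fwdDiff_sub_le (hgl i) (hR i) hε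
  obtain ⟨n₀, hn₀⟩ := eventually_half_pow_lt hδ
  refine ⟨n₀, fun n hn k i => ?_⟩
  have h1 := hu i ((1 / 2) ^ n) (by positivity) (hn₀ n hn) ((k : ℝ) / 2 ^ n)
  rw [comb_maskIter_iterate_shiftDiff hg hR]
  have h2 : (2 : ℝ) ^ (l * n) * ((1 / 2) ^ n) ^ l = 1 := by
    rw [← pow_mul, mul_comm n l, ← mul_pow]; norm_num
  have h3 : (2 : ℂ) ^ (l * n) * (-(((1 / 2 : ℝ) ^ n : ℝ) : ℂ)) ^ l = (-1) ^ l := by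
    rw [neg_pow, mul_left_comm]
    have h4 : (2 : ℂ) ^ (l * n) * (((1 / 2 : ℝ) ^ n : ℝ) : ℂ) ^ l = 1 := by exact_mod_cast h2
    rw [h4, mul_one]
  rw [← h3, mul_assoc, ← mul_sub, norm_mul, norm_pow, Complex.norm_ofNat]
  calc _ ≤ (2 : ℝ) ^ (l * n) * (((1 / 2) ^ n) ^ l * ε) := by gcongr
    _ = ε := by rw [← mul_assoc, h2, one_mul]

theorem eventually_iterate_shiftDiff_le {r R l q : ℕ} {a : FSeq r r} {g : Fin r → ℝ → ℂ}
    (hg : FunRefinable a g) (hgl : ∀ i, ContDiff ℝ l (g i)) (hR : ∀ i x, (R : ℝ) < |x| → g i x = 0)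
    (hlq : l < q) {ε : ℝ} (hε : 0 < ε) : ∃ n₀, ∀ n ≥ n₀, ∀ (k : ℤ) (i : Fin r),
      ‖2 ^ (l * n) * comb 1 (maskIter a n) (shiftDiff^[q] (sampleSeq R g)) k i 0‖ ≤ ε := by
  obtain ⟨δ, hδ, hu⟩ := exists_forall_fin
    (P := fun i δ => ∀ h, 0 ≤ h → h < δ → ∀ x, ‖(fwdDiff (-h))^[q] (g i) x‖ ≤ h ^ l * ε)
    (fun i δ δ' hle hP h h0 hh => hP h h0 (hh.trans_le hle))
    fun i => exists_norm_iterate_fwdDiff_le (hgl i) (hR i) hlq hε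
  obtain ⟨n₀, hn₀⟩ := eventually_half_pow_lt hδ
  refine ⟨n₀, fun n hn k i => ?_⟩
  have h1 := hu i ((1 / 2) ^ n) (by positivity) (hn₀ n hn) ((k : ℝ) / 2 ^ n)
  rw [comb_maskIter_iterate_shiftDiff hg hR]
  have h2 : (2 : ℝ) ^ (l * n) * ((1 / 2) ^ n) ^ l = 1 := by
    rw [← pow_mul, mul_comm n l, ← mul_pow]; norm_num
  rw [norm_mul, norm_pow, Complex.norm_ofNat]
  calc _ ≤ (2 : ℝ) ^ (l * n) * (((1 / 2) ^ n) ^ l * ε) := by gcongr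
    _ = ε := by rw [← mul_assoc, h2, one_mul]

/-- Fast decay forces a large order of annihilation. -/
theorem HasMaskDecay.lt_order {r R s d m : ℕ} {a : FSeq r r} {v' : FSeq 1 r} {g : Fin r → ℝ → ℂ}
    (h : HasMaskDecay a v' s d) (hg : FunRefinable a g) (hgm : ∀ i, ContDiff ℝ m (g i))
    (hdm : d ≤ m) (hR : ∀ i x, (R : ℝ) < |x| → g i x = 0) (hne : ∃ i, ∫ x, g i x ≠ 0) : d < s := by
  by_contra! hc
  obtain ⟨i, hi⟩ := hne
  have hgs : ∀ i, ContDiff ℝ s (g i) := fun i => (hgm i).of_le (by exact_mod_cast hc.trans hdm)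
  -- Differences of order s are annihilated whatever the filter. If s ≤ d, the decay would give
  -- g^{(s)} = 0 for every entry, hence zero integrals.
  have hu : shiftDiff^[s] (sampleSeq R g) ∈ annihilated v' s :=
    mem_annihilated_iff_moment.mpr fun j hj => moment_pow_iterate_shiftDiff_of_lt _ _ hj
  have hzero : ∀ x, iteratedDeriv s (g i) x = 0 := by
    intro x
    have h1 := ((hgs i).continuous_iteratedDeriv s le_rfl).tendsto x |>.comp (tendsto_floor_div x)
    refine tendsto_nhds_unique h1 ?_
    rw [Metric.tendsto_atTop]
    intro ε hε
    obtain ⟨n₁, hn₁⟩ := eventually_iterate_shiftDiff_sub hg hgs hR (ε := ε / 4) (by positivity)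
    obtain ⟨n₂, hn₂⟩ := h _ hu (ε / 4) (by positivity)
    refine ⟨max n₁ n₂, fun n hn => ?_⟩
    rw [dist_zero_right, Function.comp_apply]
    have h2 := hn₁ n (le_of_max_le_left hn) ⌊2 ^ n * x⌋ i
    have h3 := hn₂ n (le_of_max_le_right hn) ⌊2 ^ n * x⌋ i
    set c := comb 1 (maskIter a n) (shiftDiff^[s] (sampleSeq R g)) ⌊2 ^ n * x⌋ i 0 with hcdef
    set D := iteratedDeriv s (g i) (((⌊2 ^ n * x⌋ : ℤ) : ℝ) / 2 ^ n) with hD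
    have h4 : ‖(-1 : ℂ) ^ s * D‖ = ‖D‖ := by simp
    have h5 : ‖2 ^ (s * n) * c‖ ≤ ε / 4 := by
      rw [norm_mul, norm_pow, Complex.norm_ofNat]
      refine le_trans ?_ h3
      gcongr
      norm_num
    have h6 := norm_le_norm_add_norm_sub (2 ^ (s * n) * c) ((-1 : ℂ) ^ s * D)
    linarith
  have h1 := integral_iteratedDeriv_pow_mul (hgs i) (hR i) 0
  simp only [hzero, mul_zero, integral_zero] at h1
  have h2 : (-1 : ℂ) ^ s * (Nat.factorial s) ≠ 0 :=
    mul_ne_zero (pow_ne_zero _ (by norm_num)) (by exact_mod_cast Nat.factorial_ne_zero s)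
  exact hi ((mul_eq_zero.mp h1.symm).resolve_left h2)

/-- The samples of a refinable vector satisfy a partition of unity. -/
theorem moment_sampleSeq {r R n : ℕ} {a : FSeq r r} {v : FSeq 1 r} {g : Fin r → ℝ → ℂ}
    (hg : FunRefinable a g) (hgc : ∀ i, Continuous (g i)) (hR : ∀ i x, (R : ℝ) < |x| → g i x = 0)
    (hv : IsMatchingFilter a v n) (hn : 0 < n) : moment v (fun _ => 1) (sampleSeq R g) =
      ∑ i, pairing v (fun _ => 1) 0 i * ∫ x, g i x := by
  have h1 := tendsto_finsetSum (Finset.univ : Finset (Fin r)) fun i _ =>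
    (tendsto_riemann_sum (hgc i) (hR i)).const_mul (pairing v (fun _ => 1) 0 i)
  refine tendsto_nhds_unique (tendsto_const_nhds.congr fun N => ?_) h1
  have hp : (2 : ℂ) ^ N ≠ 0 := pow_ne_zero _ two_ne_zero
  have h2 : ∀ i, pairing (comb 1 (maskIter a N) (sampleSeq R g)) (fun _ => 1) i 0 =
      ∑ b ∈ Finset.Ico (-((R + 1) * 2 ^ N : ℤ)) ((R + 1) * 2 ^ N), g i ((b : ℝ) / 2 ^ N) := by
    intro i
    have h3 : ∀ b : ℤ, comb 1 (maskIter a N) (sampleSeq R g) b i 0 = g i ((b : ℝ) / 2 ^ N) := by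
      intro b
      rw [comb_sampleSeq hR, hg.iterate N, mul_div_cancel₀ _ (by positivity)]
    rw [pairing_entry, Finset.sum_congr rfl fun b _ => by rw [one_mul, h3]]
    have h4 : ∑ᶠ b : ℤ, g i ((b : ℝ) / 2 ^ N) =
        ∑ b ∈ (comb 1 (maskIter a N) (sampleSeq R g)).support, g i ((b : ℝ) / 2 ^ N) := by
      refine finsum_eq_sum_of_support_subset _ fun b hb => ?_
      rw [Function.mem_support, ← h3] at hb
      exact Finsupp.mem_support_iff.mpr fun h => hb (by rw [h]; rfl)
    rw [← h4]
    refine finsum_eq_sum_of_support_subset _ fun b hb => ?_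
    rw [Function.mem_support] at hb
    rw [Finset.mem_coe, Finset.mem_Ico]
    have h5 : |(b : ℝ) / 2 ^ N| ≤ R := by
      by_contra! hc
      exact hb (hR i _ hc)
    have hq : (0 : ℝ) < 2 ^ N := by positivity
    rw [abs_div, abs_of_pos hq, div_le_iff₀ hq] at h5
    have h6 : |b| ≤ (R : ℤ) * 2 ^ N := by exact_mod_cast h5
    have h7 : (0 : ℤ) < 2 ^ N := by positivity
    have h8 := abs_le.mp h6
    constructor <;> linarith
  simp only [← h2]
  rw [moment_apply, pairing_comb_one]
  -- Since v̂(0) Â_N(0) = 2^N v̂(0), the moment is the same for A_N * U scaled by 2^{-N}. It is thus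
  -- equal to a Riemann sum at every level N.
  have h3 := pairing_mul_pairing_maskIter_one hv hn N
  have h4 : pairing v (fun _ => 1) =
      ((2 : ℂ) ^ N)⁻¹ • (pairing v (fun _ => 1) * pairing (maskIter a N) (fun _ => 1)) := by
    rw [h3, smul_smul, inv_mul_cancel₀ hp, one_smul]
  conv_lhs => rw [h4]
  rw [Matrix.smul_mul, Matrix.mul_assoc, ← pairing_comb_one 1, Matrix.smul_apply, Matrix.mul_apply,
    smul_eq_mul, Finset.mul_sum]
  refine Finset.sum_congr rfl fun i _ => ?_
  ring

/-! ### Uniqueness of the moments of matching filters -/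

theorem mul_pairing_maskIter_one {r : ℕ} {a : FSeq r r} {w : Matrix (Fin 1) (Fin r) ℂ} {μ : ℂ}
    (hw : w * pairing a (fun _ => 1) = μ • w) (n : ℕ) :
    w * pairing (maskIter a n) (fun _ => 1) = (2 * μ) ^ n • w := by
  induction n with
  | zero => simp [maskIter_zero, pairing_single]
  | succ n ih =>
    rw [maskIter_succ, map_smul, LinearMap.smul_apply, pairing_comb_one, Matrix.mul_smul,
      ← Matrix.mul_assoc, ih, Matrix.smul_mul, hw, smul_smul, smul_smul]
    congr 1
    ring

/-- Left eigenvectors of the mask do not see annihilated sequences. -/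
theorem HasMaskDecay.mul_pairing_one {r s d j : ℕ} {a : FSeq r r} {v' : FSeq 1 r}
    (h : HasMaskDecay a v' s d) {w : Matrix (Fin 1) (Fin r) ℂ} (hj : j ≤ d)
    (hw : w * pairing a (fun _ => 1) = ((2 : ℂ) ^ j)⁻¹ • w) {u : FSeq r 1}
    (hu : u ∈ annihilated v' s) : (w * pairing u fun _ => 1) 0 0 = 0 := by
  obtain ⟨B, hB⟩ := exists_support_bound a
  obtain ⟨M, hM⟩ := exists_support_bound u
  set K : ℝ := (∑ i, ‖w 0 i‖) * (2 * (B + M) + 1) with hK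
  have hK0 : 0 ≤ K := by positivity
  refine norm_le_zero_iff.mp (le_of_forall_pos_le_add fun ε hε => ?_)
  rw [zero_add]
  obtain ⟨n, hn⟩ := h u hu (ε / (K + 1)) (by positivity)
  have h1 := hn n le_rfl
  have hp : (0 : ℝ) < 2 ^ n := by positivity
  have h2 : ∀ i, ‖pairing (comb 1 (maskIter a n) u) (fun _ => 1) i 0‖ ≤
      (2 * (B + M) + 1) * 2 ^ n * (ε / (K + 1) / 2 ^ (d * n)) := by
    intro i
    rw [pairing_entry]
    have h3 : ∀ k ∈ (comb 1 (maskIter a n) u).support,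
        ‖1 * comb 1 (maskIter a n) u k i 0‖ ≤ ε / (K + 1) / 2 ^ (d * n) := by
      intro k _
      rw [one_mul, le_div_iff₀ (by positivity), mul_comm]
      exact h1 k i
    refine (norm_sum_le_of_le _ h3).trans ?_
    rw [Finset.sum_const, nsmul_eq_mul]
    gcongr
    have h4 : (comb 1 (maskIter a n) u).support ⊆
        Finset.Icc (-((B + M : ℕ) * 2 ^ n : ℤ)) ((B + M : ℕ) * 2 ^ n) := by
      intro k hk
      rw [Finset.mem_Icc, ← abs_le]
      by_contra! hc
      refine Finsupp.mem_support_iff.mp hk (comb_maskIter_eq_zero hB hM n (lt_of_le_of_lt ?_ hc))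
      have h5 : (1 : ℤ) ≤ 2 ^ n := one_le_pow₀ (by norm_num)
      have h6 : (0 : ℤ) ≤ B := by positivity
      have h7 : (0 : ℤ) ≤ M := by positivity
      push_cast
      nlinarith
    have h5 := Finset.card_le_card h4
    rw [Int.card_Icc] at h5
    have h6 : ((((B + M : ℕ) * 2 ^ n : ℤ) + 1 - -((B + M : ℕ) * 2 ^ n : ℤ)).toNat) =
        2 * (B + M) * 2 ^ n + 1 := by
      have : (((B + M : ℕ) * 2 ^ n : ℤ) + 1 - -((B + M : ℕ) * 2 ^ n : ℤ)) =
          ((2 * (B + M) * 2 ^ n + 1 : ℕ) : ℤ) := by push_cast; ring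
      rw [this, Int.toNat_natCast]
    rw [h6] at h5
    have h7 : ((comb 1 (maskIter a n) u).support.card : ℝ) ≤ 2 * (B + M) * 2 ^ n + 1 := by
      exact_mod_cast h5
    have h8 : (1 : ℝ) ≤ 2 ^ n := one_le_pow₀ (by norm_num)
    linarith
  -- The total mass of A_n * u seen by w is 2^{(1-j)n} w û(0), whereas O(2^n) support points of size
  -- o(2^{-dn}) bound it from above; j ≤ d leaves only w û(0) = 0.
  have h3 : (w * pairing (comb 1 (maskIter a n) u) fun _ => 1) 0 0 =
      (2 * ((2 : ℂ) ^ j)⁻¹) ^ n * (w * pairing u fun _ => 1) 0 0 := by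
    rw [pairing_comb_one, ← Matrix.mul_assoc, mul_pairing_maskIter_one hw, Matrix.smul_mul,
      Matrix.smul_apply, smul_eq_mul]
  have h4 : ‖(w * pairing (comb 1 (maskIter a n) u) fun _ => 1) 0 0‖ ≤
      K * 2 ^ n * (ε / (K + 1) / 2 ^ (d * n)) := by
    rw [Matrix.mul_apply, hK]
    calc _ ≤ ∑ i, ‖w 0 i‖ * ((2 * (B + M) + 1) * 2 ^ n * (ε / (K + 1) / 2 ^ (d * n))) := by
          refine norm_sum_le_of_le _ fun i _ => ?_
          rw [norm_mul]
          exact mul_le_mul_of_nonneg_left (h2 i) (norm_nonneg _)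
      _ = _ := by rw [← Finset.sum_mul]; ring
  rw [h3, norm_mul, norm_pow, norm_mul, norm_inv, norm_pow, Complex.norm_ofNat] at h4
  have h5 : ‖(w * pairing u fun _ => 1) 0 0‖ ≤
      K * (ε / (K + 1)) * ((2 ^ (j * n)) / 2 ^ (d * n)) := by
    have h6 : (2 * ((2 : ℝ) ^ j)⁻¹) ^ n = 2 ^ n / 2 ^ (j * n) := by
      rw [mul_pow, inv_pow, ← pow_mul]; rfl
    rw [h6, div_mul_eq_mul_div, div_le_iff₀ (by positivity)] at h4
    refine le_of_mul_le_mul_left (h4.trans_eq ?_) hp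
    field_simp
  have h6 : (2 : ℝ) ^ (j * n) / 2 ^ (d * n) ≤ 1 := by
    rw [div_le_one (by positivity)]
    exact pow_le_pow_right₀ (by norm_num) (Nat.mul_le_mul_right n hj)
  have h7 : K * (ε / (K + 1)) ≤ ε := by
    rw [mul_div_assoc', div_le_iff₀ (by positivity)]
    nlinarith
  calc _ ≤ _ := h5
    _ ≤ K * (ε / (K + 1)) * 1 := by gcongr
    _ ≤ ε := by rw [mul_one]; exact h7

theorem moment_single {r : ℕ} (v : FSeq 1 r) (F : ℤ → ℂ) (x : Matrix (Fin r) (Fin 1) ℂ) :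
    moment v F (Finsupp.single 0 x) = (pairing v F * x) 0 0 := by
  rw [moment_apply, pairing_comb_right, Finsupp.sum_single_index (by simp)]
  simp

/-- A vector x in the kernel of v̂'(0) can be completed to an annihilated sequence by adding
differences of order at least one, whose total mass is zero. Hence w x = 0, so w vanishes on the
kernel of v̂'(0). -/
theorem HasMaskDecay.exists_eq_smul {r s d j : ℕ} {a : FSeq r r} {v' : FSeq 1 r}
    (h : HasMaskDecay a v' s d) (hv' : pairing v' (fun _ => 1) ≠ 0)
    {w : Matrix (Fin 1) (Fin r) ℂ} (hj : j ≤ d)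
    (hw : w * pairing a (fun _ => 1) = ((2 : ℂ) ^ j)⁻¹ • w) :
    ∃ e : ℂ, w = e • pairing v' fun _ => 1 := by
  set μ := pairing v' fun _ => 1 with hμ
  obtain ⟨p, hp⟩ : ∃ p, μ 0 p ≠ 0 := by
    by_contra! hc
    exact hv' (by ext i l; rw [Subsingleton.elim i 0]; exact hc l)
  have hXm : moment v' (fun _ => 1) (Finsupp.single 0 (Matrix.single p 0 1)) ≠ 0 := by
    rw [moment_single]; simpa using hp
  refine ⟨w 0 p / μ 0 p, ?_⟩
  ext i l
  rw [Subsingleton.elim i 0]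
  -- These vectors span the kernel of μ, with p a pivot entry of μ.
  let x : Matrix (Fin r) (Fin 1) ℂ := Matrix.single l 0 1 - (μ 0 l / μ 0 p) • Matrix.single p 0 1
  have hx : ∀ y : Matrix (Fin 1) (Fin r) ℂ, (y * x) 0 0 = y 0 l - (μ 0 l / μ 0 p) * y 0 p := by
    intro y
    simp only [x, Matrix.mul_sub, Matrix.mul_smul, Matrix.sub_apply, Matrix.smul_apply, smul_eq_mul]
    simp
  obtain ⟨c, hc⟩ := exists_sub_mem_annihilated v' _ hXm (Finsupp.single 0 x) 1 s (by
    intro j hj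
    obtain rfl : j = 0 := by omega
    simp only [pow_zero]
    rw [moment_single, hx, ← hμ, div_mul_cancel₀ _ hp, sub_self])
  have h1 := h.mul_pairing_one hj hw hc
  rw [map_sub, LinearMap.sub_apply, map_sum, LinearMap.sum_apply, Finset.sum_eq_zero fun q hq => by
    rw [map_smul, LinearMap.smul_apply, pairing_iterate_shiftDiff_one _ (Finset.mem_Ico.mp hq).1,
      smul_zero], sub_zero, pairing_single, one_smul, hx, sub_eq_zero] at h1
  rw [h1, Matrix.smul_apply, smul_eq_mul]
  ring

/-- Expanding (2k + b)^j binomially, all terms but 2^j k^j pair to zero. The lowest nonvanishing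
moment is therefore a left eigenvector of â(0) for 2^{-j}. -/
theorem pairing_pow_mul_of_lowest {r j : ℕ} {a : FSeq r r} {z : FSeq 1 r}
    (hz : pairing (comb 2 z a) (fun k => (k : ℂ) ^ j) = pairing z fun k => (k : ℂ) ^ j)
    (h0 : ∀ i < j, pairing z (fun k => (k : ℂ) ^ i) = 0) :
    (pairing z fun k => (k : ℂ) ^ j) * pairing a (fun _ => 1) =
      ((2 : ℂ) ^ j)⁻¹ • pairing z fun k => (k : ℂ) ^ j := by
  have h1 : ∀ b : ℤ, (pairing z fun k => ((2 * k + b : ℤ) : ℂ) ^ j) =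
      (2 : ℂ) ^ j • pairing z fun k => (k : ℂ) ^ j := by
    intro b
    have h2 : (fun k : ℤ => ((2 * k + b : ℤ) : ℂ) ^ j) = ∑ i ∈ Finset.range (j + 1),
        ((2 : ℂ) ^ i * (b : ℂ) ^ (j - i) * (j.choose i)) • fun k : ℤ => (k : ℂ) ^ i := by
      funext k
      rw [Finset.sum_apply]
      push_cast
      rw [add_pow]
      refine Finset.sum_congr rfl fun i _ => ?_
      rw [Pi.smul_apply, smul_eq_mul, mul_pow]
      ring
    rw [h2, map_sum, Finset.sum_range_succ, Finset.sum_eq_zero, zero_add, map_smul]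
    · simp
    · intro i hi
      rw [map_smul, h0 i (Finset.mem_range.mp hi), smul_zero]
  rw [pairing_comb_right] at hz
  simp only [h1] at hz
  have h3 : (a.sum fun b U => ((2 : ℂ) ^ j • pairing z fun k => (k : ℂ) ^ j) * U) =
      (2 : ℂ) ^ j • ((pairing z fun k => (k : ℂ) ^ j) * pairing a fun _ => 1) := by
    rw [pairing_apply a, Finsupp.sum, Finsupp.sum, Matrix.mul_sum, Finset.smul_sum]
    refine Finset.sum_congr rfl fun b _ => ?_
    rw [one_smul, Matrix.smul_mul]
  rw [h3] at hz
  conv_rhs => rw [← hz]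
  rw [smul_smul, inv_mul_cancel₀ (pow_ne_zero _ two_ne_zero), one_smul]

/-- The moments of the matching filters agree up to a factor. -/
theorem HasMaskDecay.exists_moments_eq {r s d : ℕ} {a : FSeq r r} {v v' : FSeq 1 r}
    (h : HasMaskDecay a v' s d) (hds : d < s) (hv' : IsMatchingFilter a v' s)
    (hv : IsMatchingFilter a v (d + 1)) : ∃ c : ℂ, c ≠ 0 ∧ ∀ j ≤ d,
      pairing v' (fun k => (k : ℂ) ^ j) = c • pairing v fun k => (k : ℂ) ^ j := by
  obtain ⟨hv'0, hv'1⟩ := isMatchingFilter_iff.mp hv'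
  obtain ⟨hv0, hv1⟩ := isMatchingFilter_iff.mp hv
  have hμ : ∀ {z : FSeq 1 r},
      pairing (comb 2 z a) (fun k => (k : ℂ) ^ 0) = pairing z (fun k => (k : ℂ) ^ 0) →
      pairing z (fun _ => 1) * pairing a (fun _ => 1) = ((2 : ℂ) ^ 0)⁻¹ • pairing z fun _ => 1 := by
    intro z hz
    simpa using pairing_pow_mul_of_lowest hz (by simp)
  obtain ⟨e, he⟩ := h.exists_eq_smul hv'0 (Nat.zero_le d) (hμ (hv1 0 (Nat.succ_pos d)))
  have he0 : e ≠ 0 := by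
    rintro rfl
    exact hv0 (by rw [he, zero_smul])
  refine ⟨e⁻¹, inv_ne_zero he0, fun j => ?_⟩
  -- The difference of the normalized filters satisfies the same matching relation, with zeroth
  -- moment zero.
  set z : FSeq 1 r := v' - e⁻¹ • v with hz
  have hzp : ∀ F, pairing z F = pairing v' F - e⁻¹ • pairing v F := by
    intro F
    rw [hz, map_sub, LinearMap.sub_apply, map_smul, LinearMap.smul_apply]
  suffices hzero : ∀ j ≤ d, pairing z (fun k => (k : ℂ) ^ j) = 0 by
    intro hj
    have := hzero j hj
    rwa [hzp, sub_eq_zero] at this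
  intro j
  induction j using Nat.strong_induction_on with
  | _ j ih =>
    intro hj
    have hzm : pairing (comb 2 z a) (fun k => (k : ℂ) ^ j) = pairing z fun k => (k : ℂ) ^ j := by
      rw [hzp, hz, map_sub, map_smul, LinearMap.sub_apply, LinearMap.smul_apply, map_sub, map_smul,
        LinearMap.sub_apply, LinearMap.smul_apply, hv'1 j (by omega), hv1 j (by omega)]
    rcases Nat.eq_zero_or_pos j with rfl | hpos
    · simp only [pow_zero]
      rw [hzp, he, smul_smul, inv_mul_cancel₀ he0, one_smul, sub_self]
    -- The next moment of z is an eigenvector for 2^{-j} and at the same time a multiple of v̂'(0),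
    -- which belongs to the eigenvalue 1; for j > 0 it must vanish.
    · have hw := pairing_pow_mul_of_lowest hzm fun i hi => ih i hi (by omega)
      obtain ⟨f, hf⟩ := h.exists_eq_smul hv'0 hj hw
      have h0 := hμ (hv'1 0 (by omega))
      rw [pow_zero, inv_one, one_smul] at h0
      rw [hf, Matrix.smul_mul, h0] at hw
      have h1 : (1 - ((2 : ℂ) ^ j)⁻¹) • (f • pairing v' fun _ => 1) = 0 := by
        rw [sub_smul, one_smul, ← hw, sub_self]
      have h2 : (1 : ℂ) - ((2 : ℂ) ^ j)⁻¹ ≠ 0 := by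
        intro hc
        have h3 : (2 : ℂ) ^ j = 1 := inv_eq_one.mp (sub_eq_zero.mp hc).symm
        have h4 : (2 : ℝ) ^ j = 1 := by
          have := congrArg norm h3
          rwa [norm_pow, Complex.norm_ofNat, norm_one] at this
        have h5 : (1 : ℝ) < 2 ^ j := one_lt_pow₀ (by norm_num) hpos.ne'
        linarith
      rw [hf]
      exact (smul_eq_zero.mp h1).resolve_left h2

/-! ### Sufficient conditions for convergence -/

theorem comb_one_single_apply {r : ℕ} (A : FSeq r r) (k : ℤ) (i l : Fin r) :
    comb 1 A (Finsupp.single 0 (Matrix.single l (0 : Fin 1) (1 : ℂ))) k i 0 = A k i l := by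
  rw [comb_one_apply, Finsupp.support_single _ (by
    intro h
    simpa using congrFun₂ h l 0), Finset.sum_singleton, Finset.sum_eq_single l]
  · simp
  · intro t _ ht
    simp [Ne.symm ht]
  · simp

/-- Column l of A_n is A_n * δe_l. Decompose δe_l into differences of samples of order l and higher
and an annihilated remainder; after scaling by 2^{ln} only the difference of order l survives. -/
theorem HasMaskDecay.isMaskLimit {r R s d m : ℕ} {a : FSeq r r} {v v' : FSeq 1 r}
    {g : Fin r → ℝ → ℂ} (h : HasMaskDecay a v' s d) (hrd : r = d + 1) (hdm : d ≤ m)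
    (hv' : IsMatchingFilter a v' s) (hv : IsMatchingFilter a v r) (hH : IsHermiteFilter v)
    (hg : FunRefinable a g) (hgm : ∀ i, ContDiff ℝ m (g i)) (hR : ∀ i x, (R : ℝ) < |x| → g i x = 0)
    (h1 : ∑ i, pairing v (fun _ => 1) 0 i * ∫ x, g i x = 1) : IsMaskLimit a g := by
  have hds : d < s := by
    refine h.lt_order hg hgm hdm hR ?_
    by_contra! hc
    simp [hc] at h1
  obtain ⟨c, hc0, hc⟩ := h.exists_moments_eq hds hv' (by rwa [← hrd])
  have hU : moment v' (fun _ => 1) (sampleSeq R g) = c := by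
    rw [moment_sampleSeq hg (fun i => (hgm i).continuous) hR hv' (by omega)]
    have hc1 := hc 0 (Nat.zero_le d)
    simp only [pow_zero] at hc1
    rw [hc1]
    simp only [Matrix.smul_apply, smul_eq_mul, mul_assoc]
    rw [← Finset.mul_sum, h1, mul_one]
  have hU0 : moment v' (fun _ => 1) (sampleSeq R g) ≠ 0 := hU ▸ hc0
  rw [isHermiteFilter_iff] at hH
  intro i l ε hε
  have hld : (l : ℕ) ≤ d := by omega
  have hls : (l : ℕ) < s := by omega
  set x : FSeq r 1 := Finsupp.single 0 (Matrix.single l (0 : Fin 1) (1 : ℂ)) with hx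
  have hxm : ∀ j ≤ (l : ℕ), moment v' (fun k => (k : ℂ) ^ j) x =
      c * if j = l then (-1) ^ (l : ℕ) * (Nat.factorial l : ℂ) else 0 := by
    intro j hj
    rw [hx, moment_single, hc j (hj.trans hld), ← hH l j hj]
    simp
  obtain ⟨b, hb⟩ := exists_sub_mem_annihilated v' _ hU0 x l s (by
    intro j hj
    rw [hxm j hj.le, if_neg hj.ne, mul_zero])
  -- The l-th moment of δe_l is c (-1)^l l! by the Hermite condition, that of ∇^l U is l! c. The
  -- resulting sign cancels the one in the limit of ∇^l.
  have hbl : b l = (-1) ^ (l : ℕ) := by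
    have h2 := moment_eq_of_sub_mem_annihilated hb hls
    rw [hxm l le_rfl, if_pos rfl, hU] at h2
    have h3 : (Nat.factorial l : ℂ) * c ≠ 0 :=
      mul_ne_zero (by exact_mod_cast Nat.factorial_ne_zero l) hc0
    refine mul_right_cancel₀ h3 (h2.symm.trans ?_)
    ring
  set y := x - ∑ q ∈ Finset.Ico (l : ℕ) s, b q • shiftDiff^[q] (sampleSeq R g) with hy
  set K : ℝ := ∑ q ∈ Finset.Ico ((l : ℕ) + 1) s, ‖b q‖ with hK
  have hK0 : 0 ≤ K := by positivity
  have hgl : ∀ i, ContDiff ℝ (l : ℕ) (g i) := fun i => (hgm i).of_le (by norm_cast; omega)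
  have hε' : 0 < ε / (K + 2) := by positivity
  obtain ⟨n₁, hn₁⟩ := eventually_iterate_shiftDiff_sub hg hgl hR hε'
  have e2 : ∀ᶠ n in atTop, ∀ q ∈ Finset.Ico ((l : ℕ) + 1) s, ∀ (k : ℤ) (i : Fin r),
      ‖2 ^ ((l : ℕ) * n) * comb 1 (maskIter a n) (shiftDiff^[q] (sampleSeq R g)) k i 0‖ ≤
        ε / (K + 2) := by
    rw [Filter.eventually_all_finset]
    intro q hq
    exact eventually_atTop.mpr (eventually_iterate_shiftDiff_le hg hgl hR
      (Nat.lt_of_succ_le (Finset.mem_Ico.mp hq).1) hε')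
  obtain ⟨n₂, hn₂⟩ := eventually_atTop.mp e2
  obtain ⟨n₃, hn₃⟩ := h y hb _ hε'
  refine ⟨max n₁ (max n₂ n₃), fun n hn k => ?_⟩
  have h2 := hn₁ n (le_of_max_le_left hn) k i
  have h3 := fun q hq => hn₂ n (le_of_max_le_left (le_of_max_le_right hn)) q hq k i
  have h4 := hn₃ n (le_of_max_le_right (le_of_max_le_right hn)) k i
  have hdec : maskIter a n k i l = comb 1 (maskIter a n) y k i 0 +
      ∑ q ∈ Finset.Ico (l : ℕ) s, b q *
        comb 1 (maskIter a n) (shiftDiff^[q] (sampleSeq R g)) k i 0 := by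
    rw [← comb_one_single_apply (maskIter a n) k i l, ← hx]
    have h5 : x = y + ∑ q ∈ Finset.Ico (l : ℕ) s, b q • shiftDiff^[q] (sampleSeq R g) := by
      rw [hy, sub_add_cancel]
    conv_lhs => rw [h5]
    rw [map_add, map_sum, Finsupp.add_apply, Finsupp.finsetSum_apply, Matrix.add_apply,
      Matrix.sum_apply]
    congr 1
    refine Finset.sum_congr rfl fun q _ => ?_
    rw [map_smul, Finsupp.smul_apply, Matrix.smul_apply, smul_eq_mul]
  rw [Finset.sum_eq_sum_Ico_succ_bot hls, hbl] at hdec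
  set D := iteratedDeriv (l : ℕ) (g i) ((k : ℝ) / 2 ^ n)
  set Z : ℕ → ℂ := fun q => comb 1 (maskIter a n) (shiftDiff^[q] (sampleSeq R g)) k i 0 with hZ
  have hsplit : maskIter a n k i l * 2 ^ ((l : ℕ) * n) - D =
      2 ^ ((l : ℕ) * n) * comb 1 (maskIter a n) y k i 0 +
      (-1) ^ (l : ℕ) * (2 ^ ((l : ℕ) * n) * Z l - (-1) ^ (l : ℕ) * D) +
      ∑ q ∈ Finset.Ico ((l : ℕ) + 1) s, b q * (2 ^ ((l : ℕ) * n) * Z q) := by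
    have h5 : (-1 : ℂ) ^ (l : ℕ) * (-1) ^ (l : ℕ) = 1 := by rw [← mul_pow]; simp
    have h6 : ∑ q ∈ Finset.Ico ((l : ℕ) + 1) s, b q * (2 ^ ((l : ℕ) * n) * Z q) =
        2 ^ ((l : ℕ) * n) * ∑ q ∈ Finset.Ico ((l : ℕ) + 1) s, b q * Z q := by
      rw [Finset.mul_sum]
      exact Finset.sum_congr rfl fun q _ => by ring
    rw [hdec, h6]
    linear_combination D * h5
  have h5 : ‖2 ^ ((l : ℕ) * n) * comb 1 (maskIter a n) y k i 0‖ ≤ ε / (K + 2) := by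
    rw [norm_mul, norm_pow, Complex.norm_ofNat]
    refine le_trans ?_ h4
    gcongr
    norm_num
  have h6 : ‖(-1 : ℂ) ^ (l : ℕ) * (2 ^ ((l : ℕ) * n) * Z l - (-1) ^ (l : ℕ) * D)‖ ≤ ε / (K + 2) := by
    rw [norm_mul, norm_pow, norm_neg, norm_one, one_pow, one_mul]
    exact h2
  have h7 : ‖∑ q ∈ Finset.Ico ((l : ℕ) + 1) s, b q * (2 ^ ((l : ℕ) * n) * Z q)‖ ≤
      K * (ε / (K + 2)) := by
    rw [hK, Finset.sum_mul]
    refine norm_sum_le_of_le _ fun q hq => ?_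
    rw [norm_mul]
    exact mul_le_mul_of_nonneg_left (h3 q hq) (norm_nonneg _)
  rw [hsplit]
  calc _ ≤ ε / (K + 2) + ε / (K + 2) + K * (ε / (K + 2)) :=
        (norm_add_le _ _).trans (add_le_add ((norm_add_le _ _).trans (add_le_add h5 h6)) h7)
    _ = ε := by field_simp; ring

/-! ### Limit functions for arbitrary initial data. -/

/-- The limit function `∑ₖ w(k) g(· - k)` of a Hermite scheme, with finitely many terms. -/
def limitSum {r : ℕ} (w : MSeq 1 r) (g : Fin r → ℝ → ℂ) (S : Finset ℤ) (x : ℝ) : ℂ :=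
  ∑ k ∈ S, ∑ i, w k 0 i * g i (1 * x - k)

theorem contDiff_limitSum {r m : ℕ} (w : MSeq 1 r) {g : Fin r → ℝ → ℂ}
    (hgm : ∀ i, ContDiff ℝ m (g i)) (S : Finset ℤ) : ContDiff ℝ m (limitSum w g S) :=
  ContDiff.sum fun _ _ => ContDiff.sum fun i _ => contDiff_const.mul
    ((hgm i).comp ((contDiff_const.mul contDiff_id).sub contDiff_const))

theorem iteratedDeriv_limitSum {r l : ℕ} (w : MSeq 1 r) {g : Fin r → ℝ → ℂ}
    (hgl : ∀ i, ContDiff ℝ l (g i)) (S : Finset ℤ) (x : ℝ) :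
    iteratedDeriv l (limitSum w g S) x = ∑ k ∈ S, ∑ i, w k 0 i * iteratedDeriv l (g i) (x - k) := by
  have h2 : ∀ (b : ℤ) (j : Fin r), ContDiff ℝ l fun x : ℝ => g j (1 * x - b) := fun b j =>
    (hgl j).comp ((contDiff_const.mul contDiff_id).sub contDiff_const)
  have h3 : ∀ (b : ℤ) (j : Fin r), ContDiff ℝ l fun x : ℝ => w b 0 j * g j (1 * x - b) :=
    fun b j => contDiff_const.mul (h2 b j)
  change iteratedDeriv l (fun x => ∑ k ∈ S, ∑ i, w k 0 i * g i (1 * x - k)) x = _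
  rw [iteratedDeriv_fun_sum fun b _ => (ContDiff.sum fun j _ => h3 b j).contDiffAt]
  refine Finset.sum_congr rfl fun b _ => ?_
  rw [iteratedDeriv_fun_sum fun j _ => (h3 b j).contDiffAt]
  refine Finset.sum_congr rfl fun j _ => ?_
  rw [iteratedDeriv_const_mul _ (h2 b j).contDiffAt, iteratedDeriv_comp_mul_sub (hgl j)]
  simp

theorem exists_restrict {r : ℕ} (w : MSeq 1 r) (N : ℤ) :
    ∃ w' : FSeq 1 r, (∀ k, |k| ≤ N → w k = w' k) ∧ w'.support ⊆ Finset.Icc (-N) N := by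
  classical
  refine ⟨Finsupp.onFinset (Finset.Icc (-N) N) (fun k => if |k| ≤ N then w k else 0) fun k hk => ?_,
    fun k hk => ?_, Finsupp.support_onFinset_subset⟩
  · rw [Finset.mem_Icc, ← abs_le]
    by_contra hc
    exact hk (if_neg hc)
  · rw [Finsupp.onFinset_apply, if_pos hk]

/-- Convergence of the iterated masks implies convergence of the Hermite scheme. -/
theorem IsMaskLimit.hermiteConvergent {r m R : ℕ} {a : FSeq r r} {g : Fin r → ℝ → ℂ}
    (h : IsMaskLimit a g) (hgm : ∀ i, ContDiff ℝ m (g i)) (hm : r ≤ m + 1)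
    (hR : ∀ i x, (R : ℝ) < |x| → g i x = 0) : HermiteConvergent a m := by
  obtain ⟨B, hB⟩ := exists_support_bound a
  intro w
  -- Near each point only finitely many translates are nonzero, so smoothness and derivatives can be
  -- computed from finite sums.
  set η : ℝ → ℂ := fun x => ∑ᶠ k : ℤ, ∑ i, w k 0 i * g i (1 * x - k) with hη
  have hloc : ∀ (N : ℤ) (x : ℝ), |x| + R ≤ N → η x = limitSum w g (Finset.Icc (-N) N) x := by
    intro N x hx
    refine finsum_eq_sum_of_support_subset _ fun k hk => ?_
    rw [Function.mem_support] at hk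
    rw [Finset.mem_coe, Finset.mem_Icc, ← abs_le]
    by_contra! hc
    refine hk (Finset.sum_eq_zero fun i _ => ?_)
    have h1 : (N : ℝ) < |(k : ℝ)| := by exact_mod_cast hc
    have h2 := abs_sub_abs_le_abs_sub (k : ℝ) x
    rw [hR i _ (by rw [one_mul, abs_sub_comm]; linarith), mul_zero]
  have hev : ∀ (N : ℤ) (x : ℝ), |x| + R < N → η =ᶠ[𝓝 x] limitSum w g (Finset.Icc (-N) N) := by
    intro N x hx
    have h1 : ∀ᶠ y : ℝ in 𝓝 x, |y| + R < N :=
      ((continuous_abs.add continuous_const).tendsto x).eventually (gt_mem_nhds hx)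
    filter_upwards [h1] with y hy
    exact hloc N y hy.le
  refine ⟨η, ?_, fun K hK l => ?_⟩
  · rw [contDiff_iff_contDiffAt]
    intro x
    obtain ⟨N, hN⟩ := exists_nat_gt (|x| + R)
    exact (contDiff_limitSum w hgm _).contDiffAt.congr_of_eventuallyEq
      (hev N x (by exact_mod_cast hN))
  -- The bound K + R captures every translate that meets [-K, K]; the additional margin B is the one
  -- required by locality of subdivision.
  obtain ⟨M, hM⟩ := exists_nat_gt (K + R)
  obtain ⟨w', hw', hw's⟩ := exists_restrict w ((M : ℤ) + B)
  set S := Finset.Icc (-((M : ℤ) + B)) ((M : ℤ) + B) with hS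
  set D : ℝ := ∑ k ∈ S, ∑ i, ‖w k 0 i‖ with hD
  have hD0 : 0 ≤ D := by positivity
  rw [ENNReal.tendsto_nhds_zero]
  intro ε hε
  obtain ⟨ε', hε'0, hε'⟩ : ∃ ε' : ℝ, 0 < ε' ∧ ENNReal.ofReal ε' ≤ ε := by
    obtain ⟨e, he0, he⟩ := exists_between hε
    exact ⟨e.toReal, ENNReal.toReal_pos he0.ne' he.ne_top,
      (ENNReal.ofReal_toReal he.ne_top).le.trans he.le⟩
  have e1 : ∀ᶠ n in atTop, ∀ i : Fin r, ∀ k : ℤ, ‖maskIter a n k i l * 2 ^ ((l : ℕ) * n) -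
      iteratedDeriv (l : ℕ) (g i) ((k : ℝ) / 2 ^ n)‖ ≤ ε' / (D + 1) := by
    rw [Filter.eventually_all]
    intro i
    exact eventually_atTop.mpr (h i l _ (by positivity))
  filter_upwards [e1] with n hn
  refine iSup₂_le fun k hk => le_trans ?_ hε'
  rw [← ofReal_norm]
  refine ENNReal.ofReal_le_ofReal ?_
  have hp : (0 : ℝ) < 2 ^ n := by positivity
  have hKM : K < M := by linarith [Nat.cast_nonneg (α := ℝ) R]
  have hkM : |k| ≤ 2 ^ n * (M : ℤ) + B := by
    have h1 : |(k : ℝ)| ≤ 2 ^ n * M + B := by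
      have : (2 : ℝ) ^ n * K ≤ 2 ^ n * M := by gcongr
      linarith [Nat.cast_nonneg (α := ℝ) B]
    exact_mod_cast h1
  have hsub : ((subdiv a)^[n] w) k 0 l =
      ∑ b ∈ S, ∑ i, w b 0 i * maskIter a n (k - 2 ^ n * b) i l := by
    rw [subdiv_iterate_local hB hw' n k hkM, subdiv_iterate_coe, comb_apply_apply, Finsupp.sum,
      Matrix.sum_apply]
    simp only [Matrix.mul_apply]
    rw [Finset.sum_subset hw's fun b _ hb => by simp [Finsupp.notMem_support_iff.mp hb]]
    refine Finset.sum_congr rfl fun b hb => ?_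
    rw [hw' b (abs_le.mpr (Finset.mem_Icc.mp hb))]
  have hder : iteratedDeriv (l : ℕ) η ((k : ℝ) / 2 ^ n) =
      ∑ b ∈ S, ∑ i, w b 0 i * iteratedDeriv (l : ℕ) (g i) (((k - 2 ^ n * b : ℤ) : ℝ) / 2 ^ n) := by
    have h1 : |(k : ℝ) / 2 ^ n| + R < ((M : ℤ) + B : ℤ) := by
      rw [abs_div, abs_of_pos hp]
      have : |(k : ℝ)| / 2 ^ n ≤ K := by
        rw [div_le_iff₀ hp]; linarith
      push_cast
      linarith [Nat.cast_nonneg (α := ℝ) B]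
    rw [(hev _ _ h1).iteratedDeriv_eq, iteratedDeriv_limitSum w
      (fun i => (hgm i).of_le (by norm_cast; omega))]
    refine Finset.sum_congr rfl fun b _ => Finset.sum_congr rfl fun i _ => ?_
    congr 2
    push_cast
    rw [sub_div, mul_div_cancel_left₀ _ hp.ne']
  rw [hsub, hder, Finset.sum_mul, ← Finset.sum_sub_distrib]
  calc _ ≤ ∑ b ∈ S, ∑ i, ‖w b 0 i‖ * (ε' / (D + 1)) := by
        refine norm_sum_le_of_le _ fun b _ => ?_
        rw [Finset.sum_mul, ← Finset.sum_sub_distrib]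
        refine norm_sum_le_of_le _ fun i _ => ?_
        rw [mul_assoc, ← mul_sub, norm_mul]
        exact mul_le_mul_of_nonneg_left (hn i _) (norm_nonneg _)
    _ = D * (ε' / (D + 1)) := by simp only [hD, Finset.sum_mul]
    _ ≤ ε' := by
        rw [mul_div_assoc', div_le_iff₀ (by positivity)]
        nlinarith

/-- Sufficient conditions for convergence. -/
theorem hermiteConvergent_of_lt {r m : ℕ} (hr : 0 < r) (hm : r ≤ m + 1) {a : FSeq r r}
    {v : FSeq 1 r} (hv : IsMatchingFilter a v r) {φ : Fin r → 𝓢'(ℝ, ℂ)}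
    (hφc : ∀ i, IsCompactlySupported (φ i)) (hφ : IsRefinable a φ)
    (hφ1 : ∑ i, symbol v 0 0 i * fourierFn (φ i) 0 = 1)
    (hsm : (((r : ℝ) - 1 : ℝ) : EReal) < smMask a) (hsφ : ((m : ℝ) : EReal) < smVector φ)
    (hH : IsHermiteFilter v) : HermiteConvergent a m := by
  obtain ⟨g, R, hgm, hR, hgφ⟩ := exists_contDiff_of_lt_smVector hφc hsφ
  have hg := funRefinable_of_isRefinable hφc hφ (fun i => (hgm i).continuous) hR hgφ
  obtain ⟨s, v', hv', hdec⟩ := exists_hasMaskDecay_of_lt_smMask hr hv hsm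
  have hint : ∀ i, fourierFn (φ i) 0 = ∫ x, g i x := by
    intro i
    rw [fourierFn_eq_integral (hφc i) (hR i) (hgφ i)]
    simp
  simp only [hint, symbol_zero_eq_pairing] at hφ1
  exact (hdec.isMaskLimit (m := m) (by omega) (by omega) hv'.1 hv hH hg hgm hR hφ1).hermiteConvergent
    hgm hm hR

end Subdivision

end

theorem mainTheorem5 (r m : ℕ) (hr : 1 ≤ r) (hm : r - 1 ≤ m)
    (a : Subdivision.FSeq r r) (ha : Subdivision.EigenvalueCondition a)
    (v : Subdivision.FSeq 1 r) (hv : Subdivision.IsMatchingFilter a v r)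
    (hv1 : Subdivision.IsNormalized v)
    (φ : Fin r → 𝓢'(ℝ, ℂ)) (hφc : ∀ i, Subdivision.IsCompactlySupported (φ i))
    (hφ : Subdivision.IsRefinable a φ)
    (hφ1 : ∑ i, Subdivision.symbol v 0 0 i * Subdivision.fourierFn (φ i) 0 = 1) :
    (Subdivision.HermiteConvergent a m →
      0 < Subdivision.smMask a ∧ ((m : ℝ) : EReal) < Subdivision.smVector φ ∧
        Subdivision.IsHermiteFilter v) ∧
    ((((r : ℝ) - 1 : ℝ) : EReal) < Subdivision.smMask a →
      ((m : ℝ) : EReal) < Subdivision.smVector φ →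
      Subdivision.IsHermiteFilter v →
      Subdivision.HermiteConvergent a m) := by
  refine ⟨fun h => h.necessary hr (by omega) hv hv1 hφc hφ hφ1, fun h1 h2 h3 => ?_⟩
  exact Subdivision.hermiteConvergent_of_lt hr (by omega) hv hφc hφ hφ1 h1 h2 h3
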